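/- **Setting.** Customer types $i\in\mathcal I$ and server types $s\in\mathcal S$ form finite sets. For each $s$ let $\bar{\mathcal K}^s\subset\mathbb Z_+^{\mathcal I}$ be a finite set of configurations that contains $\mathbf 0^s:=\mathbf 0$ and is closed under passing to componentwise smaller vectors; every unit vector $\mathbf e_i$ lies in some $\bar{\mathcal K}^s$. Let $\mathcal K^s=\bar{\mathcal K}^s\setminus\{\mathbf 0^s\}$, and let $\mathcal K$, $\bar{\mathcal K}$ be the disjoint unions over $s$ of $\mathcal K^s$, $\bar{\mathcal K}^s$. Let $\lambda_i,\mu_i,h_s>0$, $\rho_i=\lambda_i/\mu_i$, and let $\mathcal M$ be the set of pairs $(k,i)$ with $k\in\mathcal K$, $k_i\ge 1$. **Systems.** Consider finite-server systems indexed by $n\in\mathbb N$, with scaling parameters $r_n>0$, $r_n\to\infty$. In system $n$, type-$i$ customers arrive at rate $\lambda_i r_n$ and are served at rate $\mu_i$, and there are $H^n_s\in\mathbb Z_+$ servers of type $s$, where $H_s^n/r_n\to h_s$. Write $X_k(t)$, $k\in\bar{\mathcal K}$, for the number of servers in configuration $k$. Under GRAND-F an arriving type-$i$ customer is placed into a server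 chosen uniformly among the $X_{(i)}=\sum_{k:\,k+\mathbf e_i\in\bar{\mathcal K}}X_k$ servers that can still fit it, and is blocked if $X_{(i)}=0$. All systems are driven by common primitives: unit-jump counting processes $\Pi_{ki}$, $(k,i)\in\mathcal M$, and $\Pi_i$, $i\in\mathcal I$ (realizations of unit-rate Poisson processes), and marks $\xi_i(m)\in(0,1]$, $m\ge 1$ (realizations of i.i.d. uniform variables). The number of departures along $(k,i)$ (from $k$ to $k-\mathbf e_i$) in $[0,t]$ is $D_{ki}(t)=\Pi_{ki}\big(\int_0^tX_k(u)k_i\mu_i\,du\big)$. Type-$i$ arrivals are counted by $\Pi_i(\lambda_i r_nt)$. To place the $m$-th one, list the configurations that can fit it in a fixed order and divide $(0,1]$ into consecutive intervals of lengths $X_k/X_{(i)}$, where $X$ is the state just before the arrival; the customer goes to a server in the configuration whose interval contains $\xi_i(m)$. $A_{ki}(t)$ is the number of arrivals placed along $(k,i)$ (from $k-\mathbf e_i$ to $k$) in $[0,t]$. Realizations are such that arrivals and departures occur one at a time. A *fluid sample path* (FSP) is a triple of locally Lipschitz functions $(x_k)_{k\in\mathcal K}$, $(d_{ki})_{\mathcal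 M}$, $(a_{ki})_{\mathcal M}$ on $[0,\infty)$ which is, for some realization of the primitives and along some subsequence of systems, the limit, uniform on compact sets, of $r_n^{-1}\big((X_k)_{k\in\mathcal K},(D_{ki}),(A_{ki})\big)$, with arbitrary initial states. Here the realization has to satisfy, uniformly on compact sets along the sequence $(r_n)$, for all $(k,i)\in\mathcal M$ and all $i\in\mathcal I$: $r_n^{-1}\Pi_{ki}(r_nt)\to t$, $r_n^{-1}\Pi_i(r_nt)\to t$ and $r_n^{-1}\#\{m\le r_n\tau:\xi_i(m)\le\zeta\}\to\tau\zeta$ (for $\tau\ge 0$, $0\le\zeta\le 1$). **Optimum.** For $x\in\mathbb R^{\mathcal K}$ put $x_{\mathbf 0^s}=h_s-\sum_{k\in\mathcal K^s}x_k$. Let $\mathcal X^\diamond$ be the set of $x\in\mathbb R_+^{\mathcal K}$ with $x_{\mathbf 0^s}\ge 0$ for all $s$ and $\sum_{k\in\mathcal K}k_ix_k=\rho_i$ for all $i$. Let $L^\Box(x)=\sum_{k\in\bar{\mathcal K}}x_k\log\big(x_k\prod_ik_i!/e\big)$ (with $0\log 0=0$). **Lemma.** Assume that there is $x\in\mathcal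 X^\diamond$ with $x_{\mathbf 0^s}>0$ for all $s$. Then $L^\Box$ has a unique minimizer $x^{*,\Box}$ on $\mathcal X^\diamond$, and the following hold. 1. There is $\epsilon>0$ such that $x(t)\to x^{*,\Box}$ as $t\to\infty$, uniformly over all FSPs with $x(0)\in\mathcal X^\diamond$ and $\|x(0)-x^{*,\Box}\|\le\epsilon$ (Euclidean norm). 2. There is an FSP with $x(t)\equiv x^{*,\Box}$; it satisfies $x_{\mathbf 0^s}(0)>0$ for all $s$, and no customers are blocked along it: $\sum_{k:(k,i)\in\mathcal M}a_{ki}(t)=\lambda_it$ for all $i$ and $t\ge 0$. It is the unique invariant FSP (i.e. FSP with $x(t)\equiv x(0)$) such that $x_{\mathbf 0^s}(0)>0$ for all $s$. -/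

import Mathlib

open Filter Topology Set

noncomputable section

/-- Parameters of the finite-server packing system: customer types `ι`, server types `σ`.
`configs s` is the finite set of allowed configurations of a type `s` server (the zero configuration
included); `lam`, `mu` are arrival and service rates, `h s` is the (scaled) size of pool `s`. -/
structure PackingSystem (ι σ : Type*) [DecidableEq ι] where
  configs : σ → Finset (ι → ℕ)
  isLowerSet : ∀ s, IsLowerSet (configs s : Set (ι → ℕ))
  zero_mem : ∀ s, (0 : ι → ℕ) ∈ configs s
  single_mem : ∀ i, ∃ s, Pi.single i 1 ∈ configs s
  lam : ι → ℝ
  lam_pos : ∀ i, 0 < lam i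
  mu : ι → ℝ
  mu_pos : ∀ i, 0 < mu i
  h : σ → ℝ
  h_pos : ∀ s, 0 < h s

namespace PackingSystem

variable {ι σ : Type*} [Fintype ι] [DecidableEq ι] [Fintype σ] [DecidableEq σ]
variable (S : PackingSystem ι σ)

/-- All configurations `(k; s)`, including the zero configurations. -/
abbrev Config : Type _ := (s : σ) × {k : ι → ℕ // k ∈ S.configs s}

/-- The nonzero configurations. -/
abbrev NzConfig : Type _ := {k : S.Config // k.2.1 ≠ 0}

/-- The zero configuration of a type `s` server. -/
def zeroConfig (s : σ) : S.Config := ⟨s, 0, S.zero_mem s⟩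

/-- Edges `(k, i)`: `k` is a configuration with `k_i ≥ 1`. By monotonicity of the configuration sets
this says that `k` is a nonzero configuration and `k - e_i` is a configuration. -/
abbrev Edge : Type _ := {p : S.Config × ι // p.1.2.1 p.2 ≠ 0}

/-- The upper end `k` of the edge `(k, i)`. -/
def upper (e : S.Edge) : S.Config := e.1.1

/-- The customer type `i` of the edge `(k, i)`. -/
def ctype (e : S.Edge) : ι := e.1.2

/-- The lower end `k - e_i` of the edge `(k, i)`. -/
def lower (e : S.Edge) : S.Config :=
  ⟨e.1.1.1, e.1.1.2.1 - Pi.single e.1.2 1,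
    S.isLowerSet e.1.1.1 (show e.1.1.2.1 - Pi.single e.1.2 1 ≤ e.1.1.2.1 from tsub_le_self)
      e.1.1.2.2⟩

/-- A type `i` customer can be added to a server in configuration `k`. -/
def Fits (i : ι) (k : S.Config) : Prop := k.2.1 + Pi.single i 1 ∈ S.configs k.1

instance (i : ι) : DecidablePred (S.Fits i) := fun k =>
  inferInstanceAs (Decidable (k.2.1 + Pi.single i 1 ∈ S.configs k.1))

/-! ### Fluid states, the optimization problem -/

/-- Fluid states: vectors indexed by the nonzero configurations, with the Euclidean norm. -/
abbrev State : Type _ := EuclideanSpace ℝ S.NzConfig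

/-- The extension of `x` to all configurations, `x_{0^s} = h_s - ∑_{k ∈ K^s} x_k`. -/
def bar (x : S.State) (k : S.Config) : ℝ :=
  if hk : k.2.1 = 0 then S.h k.1 - ∑ k' : S.NzConfig with k'.1.1 = k.1, x k' else x ⟨k, hk⟩

/-- The compact set of fluid states of the finite-server system. -/
def box : Set S.State :=
  {x | (∀ k, 0 ≤ x k) ∧ ∀ s, ∑ k : S.NzConfig with k.1.1 = s, x k ≤ S.h s}

/-- The states of `box` for which the amount of type `i` customers is `ρ_i = λ_i / μ_i`. -/
def diamond : Set S.State :=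
  {x | x ∈ S.box ∧ ∀ i, ∑ k : S.NzConfig, (k.1.2.1 i : ℝ) * x k = S.lam i / S.mu i}

/-- Subcritical load: there is a state in `diamond` with idle servers in each pool. -/
def Subcritical : Prop := ∃ x ∈ S.diamond, ∀ s, 0 < S.bar x (S.zeroConfig s)

/-- `c_k = ∏ i, k_i !`. -/
def cfact (k : S.Config) : ℝ := ∏ i, (Nat.factorial (k.2.1 i) : ℝ)

/-- `L(z) = ∑_k z_k log (z_k c_k / e)`, with `0 log 0 = 0`. -/
def lyap (z : S.Config → ℝ) : ℝ :=
  ∑ k, z k * Real.log (z k * S.cfact k / Real.exp 1)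

/-- `x` is an optimal solution of the problem of minimizing `L` over `diamond`. -/
def IsOptimal (x : S.State) : Prop :=
  x ∈ S.diamond ∧ ∀ y ∈ S.diamond, S.lyap (S.bar x) ≤ S.lyap (S.bar y)

/-! ### The sequence of systems under GRAND-F -/

/-- A sequence of finite-server systems: the `n`-th one has scaling parameter `r n`, arrival rates
`λ_i r n` and `H n s` servers of type `s`, where `H n s / r n → h_s`. The injection `rank i` is the
arbitrary fixed order in which configurations are listed when a type `i` customer is placed. -/
structure Scaling where
  r : ℕ → ℝ
  r_pos : ∀ n, 0 < r n
  r_tendsto : Tendsto r atTop atTop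
  H : ℕ → σ → ℕ
  H_tendsto : ∀ s, Tendsto (fun n => (H n s : ℝ) / r n) atTop (𝓝 (S.h s))
  rank : ι → S.Config → ℕ
  rank_injective : ∀ i, Function.Injective (rank i)

/-- `T` is the sequence of jump times of a counting process on `[0, ∞)` with unit jumps. -/
def IsEpochs (T : ℕ → ℝ) : Prop := 0 < T 0 ∧ StrictMono T ∧ Tendsto T atTop atTop

/-- The counting process with jump times `T`. -/
def counting (T : ℕ → ℝ) (t : ℝ) : ℕ := {m : ℕ | T m ≤ t}.ncard

/-- A realization of the primitive driving processes: the jump times of the unit-rate Poisson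
processes which drive departures along each edge and arrivals of each type, and the marks in `(0, 1]`
which drive the random placement. It is common to all the systems of the sequence. -/
structure Driving where
  dep : S.Edge → ℕ → ℝ
  dep_epochs : ∀ e, IsEpochs (dep e)
  arr : ι → ℕ → ℝ
  arr_epochs : ∀ i, IsEpochs (arr i)
  mark : ι → ℕ → ℝ
  mark_mem : ∀ i m, mark i m ∈ Ioc (0 : ℝ) 1

variable {S}

/-- The counting process with jump times `T` obeys the functional law of large numbers along `r`. -/
def CountingFSLLN (r : ℕ → ℝ) (T : ℕ → ℝ) : Prop :=
  ∀ b : ℝ, TendstoUniformlyOn (fun n t => (counting T (r n * t) : ℝ) / r n) (fun t => t)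
    atTop (Icc 0 b)

/-- The marks `ξ` obey the functional law of large numbers along `r`. -/
def MarkFSLLN (r : ℕ → ℝ) (ξ : ℕ → ℝ) : Prop :=
  ∀ b : ℝ, TendstoUniformlyOn
    (fun n (p : ℝ × ℝ) =>
      (((Finset.range ⌊r n * p.1⌋₊).filter (fun m => ξ m ≤ p.2)).card : ℝ) / r n)
    (fun p => p.1 * p.2) atTop (Icc 0 b ×ˢ Icc 0 1)

/-- The driving realization satisfies all the functional laws of large numbers. -/
def Driving.FSLLN (ω : S.Driving) (C : S.Scaling) : Prop :=
  (∀ e, CountingFSLLN C.r (ω.dep e)) ∧ (∀ i, CountingFSLLN C.r (ω.arr i)) ∧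
    ∀ i, MarkFSLLN C.r (ω.mark i)

/-- The number `X_(i)` of servers to which a type `i` customer can be added. -/
def avail (i : ι) (X : S.Config → ℕ) : ℕ := ∑ k : S.Config with S.Fits i k, X k

/-- The GRAND-F rule: in state `X`, a type `i` arrival with mark `ξ` is placed into a server in
configuration `k`. The interval `(0, 1]` is divided into consecutive intervals of lengths
`X_k / X_(i)`, and `ξ` selects `k` by falling into its interval. Every one of these fails (the
customer is blocked) when `X_(i) = 0`. -/
def Selects (C : S.Scaling) (i : ι) (ξ : ℝ) (X : S.Config → ℕ) (k : S.Config) : Prop :=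
  S.Fits i k ∧
  (∑ k' : S.Config with S.Fits i k' ∧ C.rank i k' < C.rank i k, (X k' : ℝ)) < ξ * avail i X ∧
  ξ * avail i X ≤ (∑ k' : S.Config with S.Fits i k' ∧ C.rank i k' < C.rank i k, (X k' : ℝ)) + X k

/-- The arrival time of the `m`-th type `i` customer in the `n`-th system. -/
def arrTime (C : S.Scaling) (ω : S.Driving) (n : ℕ) (i : ι) (m : ℕ) : ℝ :=
  ω.arr i m / (S.lam i * C.r n)

/-- At time `t` there is an arrival of type `i` (`Sum.inl i`), blocked or not, respectively a
departure along the edge `e` (`Sum.inr e`). -/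
def EventAt (C : S.Scaling) (ω : S.Driving) (n : ℕ) (D : ℝ → S.Edge → ℕ) (t : ℝ) :
    ι ⊕ S.Edge → Prop
  | Sum.inl i => ∃ m, arrTime C ω n i m = t
  | Sum.inr e => ¬ ∀ᶠ u in 𝓝[<] t, D u e = D t e

/-- `X` is the trajectory on `[0, ∞)` of the `n`-th system under GRAND-F driven by `ω`, from some
initial state; `A t e` and `D t e` are the numbers of arrivals and departures along the edge `e`
in `[0, t]`. -/
structure IsTrajectory (C : S.Scaling) (ω : S.Driving) (n : ℕ)
    (X : ℝ → S.Config → ℕ) (A D : ℝ → S.Edge → ℕ) : Prop where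
  /-- `X` is a right-continuous step function. -/
  right_const : ∀ t, 0 ≤ t → ∀ᶠ u in 𝓝[>] t, X u = X t
  left_const : ∀ t, 0 < t → ∃ c, ∀ᶠ u in 𝓝[<] t, X u = c
  pool : ∀ s, ∑ k : S.Config with k.1 = s, X 0 k = C.H n s
  /-- Each type `i` customer is served at rate `μ_i`. -/
  dep_eq : ∀ t, 0 ≤ t → ∀ e : S.Edge, D t e = counting (ω.dep e)
    (∫ u in (0 : ℝ)..t,
      (X u (S.upper e) : ℝ) * ((S.upper e).2.1 (S.ctype e) : ℝ) * S.mu (S.ctype e))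
  /-- Each arrival is placed by the GRAND-F rule in the state just before the arrival. -/
  arr_eq : ∀ t, 0 ≤ t → ∀ e : S.Edge, A t e =
    {m : ℕ | arrTime C ω n (S.ctype e) m ≤ t ∧
      ∀ᶠ u in 𝓝[<] (arrTime C ω n (S.ctype e) m),
        Selects C (S.ctype e) (ω.mark (S.ctype e) m) (X u) (S.lower e)}.ncard
  balance : ∀ t, 0 ≤ t → ∀ k, (X t k : ℤ) = X 0 k
    + ∑ e : S.Edge with S.upper e = k, ((A t e : ℤ) - D t e)
    - ∑ e : S.Edge with S.lower e = k, ((A t e : ℤ) - D t e)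
  /-- Arrivals and departures take place one at a time (this holds with probability one). -/
  simple : ∀ t, 0 < t → ∀ p q, EventAt C ω n D t p → EventAt C ω n D t q → p = q

variable (S) in
/-- A triple of functions on `[0, ∞)`: state, departures and arrivals along the edges. (The values
at negative times are irrelevant.) -/
structure FluidPath where
  x : ℝ → S.State
  d : ℝ → S.Edge → ℝ
  a : ℝ → S.Edge → ℝ

/-- Fluid sample paths: locally Lipschitz limits, uniform on compact sets, of fluid-scaled
trajectories along a subsequence, for a driving realization which satisfies the functional laws of
large numbers. -/
def IsFSP (C : S.Scaling) (F : S.FluidPath) : Prop :=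
  LocallyLipschitzOn (Ici 0) F.x ∧ LocallyLipschitzOn (Ici 0) F.d ∧
  LocallyLipschitzOn (Ici 0) F.a ∧
  ∃ ω : S.Driving, ω.FSLLN C ∧ ∃ φ : ℕ → ℕ, StrictMono φ ∧
  ∃ (X : ℕ → ℝ → S.Config → ℕ) (A D : ℕ → ℝ → S.Edge → ℕ),
    (∀ n, IsTrajectory C ω (φ n) (X n) (A n) (D n)) ∧
    ∀ b : ℝ,
      TendstoUniformlyOn
        (fun n t => (WithLp.toLp 2 fun k : S.NzConfig => (X n t k.1 : ℝ) / C.r (φ n) : S.State))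
        F.x atTop (Icc 0 b) ∧
      TendstoUniformlyOn (fun n t e => (D n t e : ℝ) / C.r (φ n)) F.d atTop (Icc 0 b) ∧
      TendstoUniformlyOn (fun n t e => (A n t e : ℝ) / C.r (φ n)) F.a atTop (Icc 0 b)

/-- An invariant fluid sample path with idle servers of each type. -/
def IsIdleInvariantFSP (C : S.Scaling) (F : S.FluidPath) : Prop :=
  IsFSP C F ∧ (∀ t, 0 ≤ t → F.x t = F.x 0) ∧ ∀ s, 0 < S.bar (F.x 0) (S.zeroConfig s)

end PackingSystem

end

/-!
A fluid sample path obeys an autonomous differential equation, at least as long as servers are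
available for every customer type: in the state `z` arrivals along an edge `e` take place at rate
`upRate z e`, departures at rate `downRate z e`, and the difference `flow z e` moves mass from the
lower to the upper end of `e`. The theorem combines an analysis of this equation with the link
between the equation and fluid sample paths.

*Dissipation.* Along an edge the gradient of the Lyapunov function equals the logarithm of
`downRate / upRate`, up to a constant which depends on the customer type only
(`log_upper_sub_log_lower`). On the diamond the total flow of each type vanishes, these constants
drop out, and the derivative of the Lyapunov function along the dynamics becomes
`∑ e, (u e - v e) * (log (v e) - log (u e)) ≤ 0`, where `u` and `v` are the two rates
(`dissipation_eq`). It vanishes only in detailed balance. Two states in detailed balance differ by a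
factor of product form, so that the monotonicity of the logarithm shows that they agree if they have
the same pool sizes and loads (`eq_of_flow_eq_zero`). A minimizer on the diamond has all
configurations occupied, because the logarithm is singular at zero (`IsOptimal.bar_pos`), and it is
in detailed balance, because the dynamics stay in the diamond to first order and cannot decrease the
Lyapunov function there (`IsOptimal.flow_eq_zero`). Hence the minimizer is unique, and it is the
only stationary point with idle servers in each pool (`IsOptimal.eq_of_net_flow_eq_zero`).

*Stability.* Near the minimizer all configurations are occupied, and paths which start on the
diamond stay there. The Lyapunov function exceeds its minimum by a fixed amount on a small sphere in
the diamond, so that a path which starts close enough never reaches the sphere; the dissipation is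
bounded away from zero outside a neighbourhood of the minimizer, which gives a uniform time of
convergence (`IsOptimal.exists_stable`).

*Fluid limits.* If the scaled states stay close to `w` during `[s, t]`, the marks which select an
edge fill an interval close to the one which belongs to `w`, and the law of large numbers for the
marks bounds the number of arrivals along the edge (`IsPrelimit.abs_arr_sub_le`). This yields the
right derivatives of the limit (`IsFluidLimit.isFluidSolution`). The argument works along arbitrary
filters, in particular along ultrafilters.

*Existence.* A deterministic realization of the primitives suffices. The jump times are taken
linearly independent over a countable field which contains all parameters, with the `m`-th jump of
each process in `(m, m + 1)`, and the marks run through finer and finer equidistant grids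
(`exists_driving`). Linear independence excludes simultaneous events, so that a trajectory can be
built event by event from any initial state (`exists_isTrajectory`). Start the systems close to the
minimizer. Along every ultrafilter the scaled trajectories converge, since they are asymptotically
Lipschitz, and the limit solves the equation from the minimizer and hence is constant. As the limit
does not depend on the ultrafilter, the whole sequence converges
(`isIdleInvariantFSP_constPath`).
-/

set_option linter.unusedSectionVars false

noncomputable section

namespace PackingSystem

variable {ι σ : Type*} [Fintype ι] [DecidableEq ι] [Fintype σ] [DecidableEq σ]
variable {S : PackingSystem ι σ}

/-! ### Configurations and edges -/

theorem upper_apply_ctype_pos (e : S.Edge) : 0 < (S.upper e).2.1 (S.ctype e) :=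
  Nat.pos_of_ne_zero e.2

theorem upper_fst (e : S.Edge) : (S.upper e).1 = (S.lower e).1 := rfl

theorem upper_eq_lower_add (e : S.Edge) :
    (S.upper e).2.1 = (S.lower e).2.1 + Pi.single (S.ctype e) 1 := by
  have h := upper_apply_ctype_pos e
  funext j
  change e.1.1.2.1 j = (e.1.1.2.1 - (Pi.single e.1.2 1 : ι → ℕ)) j + (Pi.single e.1.2 1 : ι → ℕ) j
  rcases eq_or_ne j e.1.2 with rfl | hj
  · have h' : 0 < e.1.1.2.1 e.1.2 := h
    simp only [Pi.sub_apply, Pi.single_eq_same]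
    omega
  · simp [Pi.sub_apply, Pi.single_eq_of_ne hj]

theorem upper_apply (e : S.Edge) (j : ι) :
    (S.upper e).2.1 j = (S.lower e).2.1 j + if j = S.ctype e then 1 else 0 := by
  rw [upper_eq_lower_add, Pi.add_apply, Pi.single_apply]

theorem fits_lower (e : S.Edge) : S.Fits (S.ctype e) (S.lower e) := by
  have := (S.upper e).2.2
  rw [upper_eq_lower_add] at this
  exact this

theorem config_ext {k l : S.Config} (h₁ : k.1 = l.1) (h₂ : k.2.1 = l.2.1) : k = l := by
  obtain ⟨s, k, hk⟩ := k
  obtain ⟨t, l, hl⟩ := l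
  obtain rfl : s = t := h₁
  obtain rfl : k = l := h₂
  rfl

/-- The configuration obtained by adding a customer. -/
def addCustomer (i : ι) (k : S.Config) (hk : S.Fits i k) : S.Config :=
  ⟨k.1, k.2.1 + Pi.single i 1, hk⟩

/-- The edge along which a type `i` customer is placed into a server in configuration `k`. -/
def edgeAt (i : ι) (k : S.Config) (hk : S.Fits i k) : S.Edge :=
  ⟨(addCustomer i k hk, i), by simp [addCustomer]⟩

@[simp] theorem ctype_edgeAt (i : ι) (k : S.Config) (hk : S.Fits i k) :
    S.ctype (edgeAt i k hk) = i := rfl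

@[simp] theorem lower_edgeAt (i : ι) (k : S.Config) (hk : S.Fits i k) :
    S.lower (edgeAt i k hk) = k := by
  refine config_ext rfl ?_
  funext j
  change (k.2.1 + (Pi.single i 1 : ι → ℕ) - (Pi.single i 1 : ι → ℕ)) j = k.2.1 j
  simp

theorem edge_ext {e f : S.Edge} (h₁ : S.ctype e = S.ctype f) (h₂ : S.lower e = S.lower f) :
    e = f := by
  have h : S.upper e = S.upper f := by
    refine config_ext ?_ ?_
    · rw [upper_fst, upper_fst, h₂]
    · rw [upper_eq_lower_add, upper_eq_lower_add, h₁, h₂]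
  exact Subtype.ext (Prod.ext h h₁)

/-- Edges of type `i` correspond to the configurations into which a type `i` customer fits. -/
theorem sum_ctype_lower (i : ι) (g : S.Config → ℝ) :
    ∑ e : S.Edge with S.ctype e = i, g (S.lower e) = ∑ k : S.Config with S.Fits i k, g k := by
  refine Finset.sum_bij' (fun e _ => S.lower e)
    (fun k hk => edgeAt i k (by simpa using hk)) ?_ ?_ ?_ ?_ ?_
  · intro e he
    have : S.ctype e = i := by simpa using he
    simpa [← this] using fits_lower e
  · intro k hk; simp
  · intro e he
    have : S.ctype e = i := by simpa using he
    exact edge_ext (by simp [this]) (by simp)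
  · intro k hk; simp
  · intro e he; rfl

theorem sum_ctype_upper (i : ι) (g : S.Config → ℝ) :
    ∑ e : S.Edge with S.ctype e = i, ((S.upper e).2.1 (S.ctype e) : ℝ) * g (S.upper e)
      = ∑ k : S.Config, (k.2.1 i : ℝ) * g k := by
  rw [← Finset.sum_filter_of_ne (s := Finset.univ) (p := fun k : S.Config => k.2.1 i ≠ 0)]
  · refine Finset.sum_bij' (fun e _ => S.upper e)
      (fun k hk => ⟨(k, i), by simpa using hk⟩) ?_ ?_ ?_ ?_ ?_
    · intro e he
      have : S.ctype e = i := by simpa using he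
      simpa [← this] using (upper_apply_ctype_pos e).ne'
    · intro k hk
      simp only [Finset.mem_filter, Finset.mem_univ, true_and]
      rfl
    · intro e he
      have : S.ctype e = i := by simpa using he
      exact Subtype.ext (Prod.ext rfl this.symm)
    · intro k hk; rfl
    · intro e he
      have : S.ctype e = i := by simpa using he
      rw [this]
  · intro k _ hk h0
    exact hk (by simp [h0])

/-- The net inflow into configuration `k`, if `w e` is the flow upwards along the edge `e`. -/
def net (w : S.Edge → ℝ) (k : S.Config) : ℝ :=
  ∑ e : S.Edge with S.upper e = k, w e - ∑ e : S.Edge with S.lower e = k, w e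

/-- Summation by parts on the graph of configurations. -/
theorem sum_mul_net (g : S.Config → ℝ) (w : S.Edge → ℝ) :
    ∑ k, g k * net w k = ∑ e, w e * (g (S.upper e) - g (S.lower e)) := by
  have key : ∀ f : S.Edge → S.Config,
      ∑ k, g k * ∑ e : S.Edge with f e = k, w e = ∑ e, w e * g (f e) := by
    intro f
    rw [← Finset.sum_fiberwise (s := Finset.univ) f (fun e => w e * g (f e))]
    refine Finset.sum_congr rfl fun k _ => ?_
    rw [Finset.mul_sum]
    refine Finset.sum_congr rfl fun e he => ?_
    have : f e = k := by simpa using he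
    rw [this, mul_comm]
  simp only [net, mul_sub, Finset.sum_sub_distrib, key]

theorem sum_pool_net (s : σ) (w : S.Edge → ℝ) :
    ∑ k : S.Config with k.1 = s, net w k = 0 := by
  have := sum_mul_net (fun k : S.Config => if k.1 = s then (1 : ℝ) else 0) w
  simp only [ite_mul, one_mul, zero_mul] at this
  rw [Finset.sum_filter, this]
  refine Finset.sum_eq_zero fun e _ => ?_
  rw [upper_fst, sub_self, mul_zero]

theorem sum_load_net (i : ι) (w : S.Edge → ℝ) :
    ∑ k : S.Config, (k.2.1 i : ℝ) * net w k = ∑ e : S.Edge with S.ctype e = i, w e := by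
  rw [sum_mul_net, Finset.sum_filter]
  refine Finset.sum_congr rfl fun e _ => ?_
  rw [upper_apply]
  by_cases h : i = S.ctype e
  · simp [h]
  · simp [h, Ne.symm h]

/-- A function of the configuration which increases by `ν i` whenever a type `i` customer is added
is affine on the configurations of each server type. -/
theorem eq_add_sum_of_edge_increments {g : S.Config → ℝ} {ν : ι → ℝ}
    (h : ∀ e, g (S.upper e) - g (S.lower e) = ν (S.ctype e)) (k : S.Config) :
    g k = g (S.zeroConfig k.1) + ∑ i, (k.2.1 i : ℝ) * ν i := by
  induction hN : ∑ i, k.2.1 i generalizing k with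
  | zero =>
    have h0 : ∀ i, k.2.1 i = 0 := by simpa using hN
    have : k = S.zeroConfig k.1 := config_ext rfl (funext h0)
    simp only [h0, Nat.cast_zero, zero_mul, Finset.sum_const_zero, add_zero]
    rw [← this]
  | succ N ih =>
    obtain ⟨i, hi⟩ : ∃ i, k.2.1 i ≠ 0 := by
      by_contra! hc
      simp [hc] at hN
    let e : S.Edge := ⟨(k, i), hi⟩
    have hk : ∀ j, k.2.1 j = (S.lower e).2.1 j + if j = i then 1 else 0 := fun j => upper_apply e j
    have hl := ih (S.lower e) (by
      have : ∑ j, k.2.1 j = ∑ j, (S.lower e).2.1 j + 1 := by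
        simp [hk, Finset.sum_add_distrib]
      omega)
    have he := h e
    change g k - g (S.lower e) = ν i at he
    have hz : S.zeroConfig (S.lower e).1 = S.zeroConfig k.1 := rfl
    rw [hz] at hl
    simp only [hk, Nat.cast_add, add_mul, Finset.sum_add_distrib]
    have : ∑ j, ((if j = i then 1 else 0 : ℕ) : ℝ) * ν j = ν i := by simp
    rw [this]
    linarith

/-- Induction on the number of customers in the server. -/
theorem induction_on_lower {P : S.Config → Prop} (h0 : ∀ s, P (S.zeroConfig s))
    (h : ∀ e, P (S.lower e) → P (S.upper e)) (k : S.Config) : P k := by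
  induction hN : ∑ i, k.2.1 i generalizing k with
  | zero =>
    have hk : ∀ i, k.2.1 i = 0 := by simpa using hN
    have : k = S.zeroConfig k.1 := config_ext rfl (funext hk)
    rw [this]; exact h0 _
  | succ N ih =>
    obtain ⟨i, hi⟩ : ∃ i, k.2.1 i ≠ 0 := by
      by_contra! hc
      simp [hc] at hN
    let e : S.Edge := ⟨(k, i), hi⟩
    have hk : ∀ j, k.2.1 j = (S.lower e).2.1 j + if j = i then 1 else 0 := fun j => upper_apply e j
    refine h e (ih (S.lower e) ?_)
    have : ∑ j, k.2.1 j = ∑ j, (S.lower e).2.1 j + 1 := by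
      simp [hk, Finset.sum_add_distrib]
    omega

/-! ### States and their extension to all configurations -/

theorem bar_nz (x : S.State) (k : S.NzConfig) : S.bar x k.1 = x k := by
  simp [bar, k.2]

theorem bar_zero (x : S.State) (s : σ) :
    S.bar x (S.zeroConfig s) = S.h s - ∑ k : S.NzConfig with k.1.1 = s, x k := by
  exact dif_pos rfl

theorem sum_config (g : S.Config → ℝ) :
    ∑ k, g k = ∑ s, g (S.zeroConfig s) + ∑ k : S.NzConfig, g k.1 := by
  classical
  rw [← Finset.sum_filter_add_sum_filter_not Finset.univ (fun k : S.Config => k.2.1 = 0)]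
  congr 1
  · refine Finset.sum_bij' (fun k _ => k.1) (fun s _ => S.zeroConfig s) ?_ ?_ ?_ ?_ ?_
    · intro k _; simp
    · intro s _; simp [zeroConfig]
    · intro k hk
      exact config_ext rfl (by simpa [eq_comm, zeroConfig] using hk)
    · intro s _; rfl
    · intro k hk
      congr 1
      exact config_ext rfl (by simpa [zeroConfig] using hk)
  · exact Finset.sum_subtype _ (by simp) _

theorem sum_pool_config (s : σ) (g : S.Config → ℝ) :
    ∑ k : S.Config with k.1 = s, g k
      = g (S.zeroConfig s) + ∑ k : S.NzConfig with k.1.1 = s, g k.1 := by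
  rw [Finset.sum_filter, sum_config, Finset.sum_filter]
  congr 1
  exact (Finset.sum_ite_eq' Finset.univ s _).trans (by simp)

theorem sum_pool_bar (x : S.State) (s : σ) :
    ∑ k : S.Config with k.1 = s, S.bar x k = S.h s := by
  rw [sum_pool_config, bar_zero]
  simp [bar_nz]

theorem sum_load_bar (x : S.State) (i : ι) :
    ∑ k : S.Config, (k.2.1 i : ℝ) * S.bar x k
      = ∑ k : S.NzConfig, (k.1.2.1 i : ℝ) * x k := by
  rw [sum_config]
  simp [bar_nz, zeroConfig]

/-- The state with prescribed values on the nonzero configurations. -/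
def toState (z : S.Config → ℝ) : S.State := WithLp.toLp 2 fun k => z k.1

theorem bar_toState {z : S.Config → ℝ}
    (h : ∀ s, ∑ k : S.Config with k.1 = s, z k = S.h s) : S.bar (toState z) = z := by
  funext k
  by_cases hk : k.2.1 = 0
  · have hk' : k = S.zeroConfig k.1 := config_ext rfl hk
    rw [hk', bar_zero, ← h, sum_pool_config]
    simp [toState, zeroConfig]
  · rw [bar_nz _ ⟨k, hk⟩]; rfl

theorem toState_bar (x : S.State) : toState (S.bar x) = x := by
  ext k
  exact bar_nz x k

theorem bar_injective : Function.Injective (S.bar) := fun x y h => by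
  rw [← toState_bar x, ← toState_bar y, h]

theorem mem_diamond_iff (x : S.State) :
    x ∈ S.diamond ↔ (∀ k, 0 ≤ S.bar x k) ∧
      ∀ i, ∑ k : S.Config, (k.2.1 i : ℝ) * S.bar x k = S.lam i / S.mu i := by
  simp only [diamond, box, mem_ofPred_eq, sum_load_bar]
  refine and_congr_left fun _ => ⟨fun h k => ?_, fun h => ⟨fun k => ?_, fun s => ?_⟩⟩
  · by_cases hk : k.2.1 = 0
    · have hk' : k = S.zeroConfig k.1 := config_ext rfl hk
      rw [hk', bar_zero]
      linarith [h.2 k.1]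
    · rw [bar_nz _ ⟨k, hk⟩]; exact h.1 _
  · rw [← bar_nz]; exact h _
  · have := h (S.zeroConfig s)
    rw [bar_zero] at this
    linarith

theorem continuous_bar : Continuous (S.bar) := by
  refine continuous_pi fun k => ?_
  by_cases hk : k.2.1 = 0
  · simp only [bar, hk, dif_pos]
    fun_prop
  · simp only [bar, hk, dif_neg, not_false_iff]
    fun_prop

theorem continuous_toState : Continuous (toState (S := S)) := by
  unfold toState
  fun_prop

theorem isClosed_diamond : IsClosed S.diamond := by
  have : S.diamond = {x | (∀ k, 0 ≤ S.bar x k) ∧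
      ∀ i, ∑ k : S.Config, (k.2.1 i : ℝ) * S.bar x k = S.lam i / S.mu i} :=
    Set.ext mem_diamond_iff
  rw [this]
  have hb : ∀ k, Continuous fun x : S.State => S.bar x k := fun k =>
    (continuous_apply k).comp continuous_bar
  refine IsClosed.and (isClosed_iInter_setOf hb) (isClosed_iInter_eq hb)
where
  isClosed_iInter_setOf (hb : ∀ k, Continuous fun x : S.State => S.bar x k) :
      IsClosed {x : S.State | ∀ k, 0 ≤ S.bar x k} := by
    simp only [ofPred_forall]
    exact isClosed_iInter fun k => isClosed_le continuous_const (hb k)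
  isClosed_iInter_eq (hb : ∀ k, Continuous fun x : S.State => S.bar x k) :
      IsClosed {x : S.State | ∀ i, ∑ k : S.Config, (k.2.1 i : ℝ) * S.bar x k
        = S.lam i / S.mu i} := by
    simp only [ofPred_forall]
    exact isClosed_iInter fun i => isClosed_eq (by fun_prop) continuous_const

theorem bar_le_of_nonneg {x : S.State} (h : ∀ k, 0 ≤ S.bar x k) (k : S.Config) :
    S.bar x k ≤ S.h k.1 := by
  rw [← sum_pool_bar x k.1]
  exact Finset.single_le_sum (f := fun k => S.bar x k) (fun l _ => h l) (by simp)

theorem isCompact_diamond : IsCompact S.diamond := by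
  refine Metric.isCompact_of_isClosed_isBounded isClosed_diamond ?_
  have hK : IsCompact (toState (S := S) '' Set.univ.pi fun k => Icc 0 (S.h k.1)) :=
    (isCompact_univ_pi fun k => isCompact_Icc).image continuous_toState
  refine hK.isBounded.subset fun x hx => ?_
  have h := ((mem_diamond_iff x).1 hx).1
  exact ⟨S.bar x, fun k _ => ⟨h k, bar_le_of_nonneg h k⟩, toState_bar x⟩

/-! ### The fluid dynamics and the dissipation of the Lyapunov function -/

/-- The amount `x_(i)` of servers into which a type `i` customer fits, in the fluid state `z`. -/
def fluidAvail (i : ι) (z : S.Config → ℝ) : ℝ := ∑ k : S.Config with S.Fits i k, z k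

/-- The rate of arrivals along the edge `e` in the fluid state `z`. -/
def upRate (z : S.Config → ℝ) (e : S.Edge) : ℝ :=
  S.lam (S.ctype e) * (z (S.lower e) / fluidAvail (S.ctype e) z)

/-- The rate of departures along the edge `e` in the fluid state `z`. -/
def downRate (z : S.Config → ℝ) (e : S.Edge) : ℝ :=
  z (S.upper e) * ((S.upper e).2.1 (S.ctype e) : ℝ) * S.mu (S.ctype e)

/-- The net upward flow along the edge `e` in the fluid state `z`. -/
def flow (z : S.Config → ℝ) (e : S.Edge) : ℝ := upRate z e - downRate z e

/-- The derivative of the Lyapunov function along the fluid dynamics, in a state with all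
configurations occupied. -/
def dissipation (z : S.Config → ℝ) : ℝ :=
  ∑ k, Real.log (z k * S.cfact k) * net (flow z) k

theorem cfact_pos (k : S.Config) : 0 < S.cfact k :=
  Finset.prod_pos fun i _ => by exact_mod_cast Nat.factorial_pos _

theorem cfact_upper (e : S.Edge) :
    S.cfact (S.upper e) = ((S.upper e).2.1 (S.ctype e) : ℝ) * S.cfact (S.lower e) := by
  unfold cfact
  rw [← Finset.mul_prod_erase _ _ (Finset.mem_univ (S.ctype e)),
    ← Finset.mul_prod_erase _ (fun i => (Nat.factorial ((S.lower e).2.1 i) : ℝ))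
      (Finset.mem_univ (S.ctype e)), ← mul_assoc]
  congr 1
  · rw [upper_apply]
    simp [Nat.factorial_succ]
  · refine Finset.prod_congr rfl fun i hi => ?_
    rw [upper_apply, if_neg (Finset.ne_of_mem_erase hi), add_zero]

theorem fluidAvail_pos_of_idle {z : S.Config → ℝ} (h0 : ∀ k, 0 ≤ z k)
    (h : ∀ s, 0 < z (S.zeroConfig s)) (i : ι) : 0 < fluidAvail i z := by
  obtain ⟨s, hs⟩ := S.single_mem i
  refine Finset.sum_pos' (fun k _ => h0 k) ⟨S.zeroConfig s, ?_, h s⟩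
  rw [Finset.mem_filter]
  refine ⟨Finset.mem_univ _, ?_⟩
  change 0 + Pi.single i 1 ∈ S.configs s
  rwa [zero_add]

theorem fluidAvail_pos {z : S.Config → ℝ} (h : ∀ k, 0 < z k) (i : ι) : 0 < fluidAvail i z :=
  fluidAvail_pos_of_idle (fun k => (h k).le) (fun _ => h _) i

theorem sum_upRate {z : S.Config → ℝ} {i : ι} (h : 0 < fluidAvail i z) :
    ∑ e : S.Edge with S.ctype e = i, upRate z e = S.lam i := by
  have : ∑ e : S.Edge with S.ctype e = i, upRate z e
      = ∑ e : S.Edge with S.ctype e = i, S.lam i * (z (S.lower e) / fluidAvail i z) := by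
    refine Finset.sum_congr rfl fun e he => ?_
    have : S.ctype e = i := by simpa using he
    rw [upRate, this]
  rw [this, sum_ctype_lower i (fun k => S.lam i * (z k / fluidAvail i z)), ← Finset.mul_sum,
    ← Finset.sum_div]
  change S.lam i * (fluidAvail i z / fluidAvail i z) = _
  rw [div_self h.ne', mul_one]

theorem sum_downRate (z : S.Config → ℝ) (i : ι) :
    ∑ e : S.Edge with S.ctype e = i, downRate z e
      = S.mu i * ∑ k : S.Config, (k.2.1 i : ℝ) * z k := by
  rw [← sum_ctype_upper, Finset.mul_sum]
  refine Finset.sum_congr rfl fun e he => ?_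
  have : S.ctype e = i := by simpa using he
  rw [downRate, this]; ring

theorem sum_flow {z : S.Config → ℝ} {i : ι} (h : 0 < fluidAvail i z) :
    ∑ e : S.Edge with S.ctype e = i, flow z e
      = S.lam i - S.mu i * ∑ k : S.Config, (k.2.1 i : ℝ) * z k := by
  simp only [flow, Finset.sum_sub_distrib, sum_upRate h, sum_downRate]

theorem sum_flow_eq_zero {z : S.Config → ℝ} (h : ∀ k, 0 < z k)
    (hl : ∀ i, ∑ k : S.Config, (k.2.1 i : ℝ) * z k = S.lam i / S.mu i) (i : ι) :
    ∑ e : S.Edge with S.ctype e = i, flow z e = 0 := by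
  rw [sum_flow (fluidAvail_pos h i), hl, mul_div_cancel₀ _ (S.mu_pos i).ne', sub_self]

theorem upRate_pos {z : S.Config → ℝ} (h : ∀ k, 0 < z k) (e : S.Edge) : 0 < upRate z e :=
  mul_pos (S.lam_pos _) (div_pos (h _) (fluidAvail_pos h _))

theorem downRate_pos {z : S.Config → ℝ} (h : ∀ k, 0 < z k) (e : S.Edge) : 0 < downRate z e :=
  mul_pos (mul_pos (h _) (by exact_mod_cast upper_apply_ctype_pos e)) (S.mu_pos _)

/-- The gradient of the Lyapunov function along an edge compares the two rates along the edge. -/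
theorem log_upper_sub_log_lower {z : S.Config → ℝ} (h : ∀ k, 0 < z k) (e : S.Edge) :
    Real.log (z (S.upper e) * S.cfact (S.upper e)) - Real.log (z (S.lower e) * S.cfact (S.lower e))
      = Real.log (downRate z e) - Real.log (upRate z e)
        + Real.log (S.lam (S.ctype e) / (S.mu (S.ctype e) * fluidAvail (S.ctype e) z)) := by
  have hm : (0 : ℝ) < ((S.upper e).2.1 (S.ctype e) : ℝ) := by
    exact_mod_cast upper_apply_ctype_pos e
  have h1 := h (S.upper e)
  have h2 := h (S.lower e)
  have h3 := cfact_pos (S.lower e)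
  have h4 := S.lam_pos (S.ctype e)
  have h5 := S.mu_pos (S.ctype e)
  have h6 := fluidAvail_pos h (S.ctype e)
  have h7 := downRate_pos h e
  have h8 := upRate_pos h e
  rw [cfact_upper, ← Real.log_div (by positivity) (by positivity),
    ← Real.log_div h7.ne' h8.ne', ← Real.log_mul (by positivity) (by positivity)]
  congr 1
  unfold downRate upRate
  field_simp

theorem mul_log_sub_log_nonpos {p q : ℝ} (hp : 0 < p) (hq : 0 < q) :
    (p - q) * (Real.log q - Real.log p) ≤ 0 := by
  rcases le_total p q with h | h
  · exact mul_nonpos_of_nonpos_of_nonneg (by linarith) (by linarith [Real.log_le_log hp h])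
  · exact mul_nonpos_of_nonneg_of_nonpos (by linarith) (by linarith [Real.log_le_log hq h])

theorem eq_of_mul_log_sub_log_eq_zero {p q : ℝ} (hp : 0 < p) (hq : 0 < q)
    (h : (p - q) * (Real.log q - Real.log p) = 0) : p = q := by
  rcases mul_eq_zero.1 h with h | h
  · linarith
  · exact (Real.log_injOn_pos hq hp (by linarith)).symm

/-- The type-dependent constants in `log_upper_sub_log_lower` do not contribute to the dissipation
when the total flow of every customer type vanishes. -/
theorem dissipation_eq {z : S.Config → ℝ} (h : ∀ k, 0 < z k)
    (hf : ∀ i, ∑ e : S.Edge with S.ctype e = i, flow z e = 0) :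
    dissipation z = ∑ e, (upRate z e - downRate z e) *
      (Real.log (downRate z e) - Real.log (upRate z e)) := by
  rw [dissipation, sum_mul_net]
  simp only [log_upper_sub_log_lower h, mul_add, Finset.sum_add_distrib]
  have : ∑ e, flow z e *
      Real.log (S.lam (S.ctype e) / (S.mu (S.ctype e) * fluidAvail (S.ctype e) z)) = 0 := by
    rw [← Finset.sum_fiberwise (s := Finset.univ) S.ctype]
    refine Finset.sum_eq_zero fun i _ => ?_
    have : ∑ e : S.Edge with S.ctype e = i, flow z e *
        Real.log (S.lam (S.ctype e) / (S.mu (S.ctype e) * fluidAvail (S.ctype e) z))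
        = ∑ e : S.Edge with S.ctype e = i, flow z e *
        Real.log (S.lam i / (S.mu i * fluidAvail i z)) := by
      refine Finset.sum_congr rfl fun e he => ?_
      have : S.ctype e = i := by simpa using he
      rw [this]
    rw [this, ← Finset.sum_mul, hf, zero_mul]
  rw [this, add_zero]
  rfl

/-- When the total flow of every customer type vanishes, the Lyapunov function does not increase. -/
theorem dissipation_nonpos {z : S.Config → ℝ} (h : ∀ k, 0 < z k)
    (hf : ∀ i, ∑ e : S.Edge with S.ctype e = i, flow z e = 0) : dissipation z ≤ 0 := by
  rw [dissipation_eq h hf]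
  exact Finset.sum_nonpos fun e _ => mul_log_sub_log_nonpos (upRate_pos h e) (downRate_pos h e)

/-- The dissipation vanishes only in the states of detailed balance. -/
theorem flow_eq_zero_of_dissipation_eq_zero {z : S.Config → ℝ} (h : ∀ k, 0 < z k)
    (hf : ∀ i, ∑ e : S.Edge with S.ctype e = i, flow z e = 0) (h0 : dissipation z = 0)
    (e : S.Edge) : flow z e = 0 := by
  rw [dissipation_eq h hf, Finset.sum_eq_zero_iff_of_nonpos
    fun e _ => mul_log_sub_log_nonpos (upRate_pos h e) (downRate_pos h e)] at h0
  exact sub_eq_zero.2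
    (eq_of_mul_log_sub_log_eq_zero (upRate_pos h e) (downRate_pos h e) (h0 e (Finset.mem_univ e)))

/-- States in detailed balance are of product form, hence determined by the pool sizes and loads. -/
theorem eq_of_flow_eq_zero {z w : S.Config → ℝ} (hz : ∀ k, 0 < z k) (hw : ∀ k, 0 < w k)
    (hp : ∀ s, ∑ k : S.Config with k.1 = s, z k = ∑ k : S.Config with k.1 = s, w k)
    (hl : ∀ i, ∑ k : S.Config, (k.2.1 i : ℝ) * z k = ∑ k : S.Config, (k.2.1 i : ℝ) * w k)
    (fz : ∀ e, flow z e = 0) (fw : ∀ e, flow w e = 0) : z = w := by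
  set g : S.Config → ℝ := fun k => Real.log (z k) - Real.log (w k) with hg
  set ν : ι → ℝ := fun i => Real.log (S.lam i / (S.mu i * fluidAvail i z))
    - Real.log (S.lam i / (S.mu i * fluidAvail i w)) with hν
  have hinc : ∀ e, g (S.upper e) - g (S.lower e) = ν (S.ctype e) := by
    intro e
    have key : ∀ {y : S.Config → ℝ}, (∀ k, 0 < y k) → flow y e = 0 →
        Real.log (y (S.upper e)) - Real.log (y (S.lower e))
        = Real.log (S.lam (S.ctype e) / (S.mu (S.ctype e) * fluidAvail (S.ctype e) y))
          + (Real.log (S.cfact (S.lower e)) - Real.log (S.cfact (S.upper e))) := by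
      intro y hy fy
      have h1 := log_upper_sub_log_lower hy e
      have h2 : upRate y e = downRate y e := sub_eq_zero.1 fy
      rw [h2, sub_self, zero_add, Real.log_mul (hy _).ne' (cfact_pos _).ne',
        Real.log_mul (hy _).ne' (cfact_pos _).ne'] at h1
      linarith
    have h1 := key hz (fz e)
    have h2 := key hw (fw e)
    simp only [hg, hν]
    linarith
  -- by `hinc`, `g k` depends on the pool and, linearly, on `k`, and these parts are orthogonal to
  -- `z - w`
  have hsum : ∑ k, (z k - w k) * g k = 0 := by
    have : ∀ k, (z k - w k) * g k = (z k - w k) * g (S.zeroConfig k.1)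
        + ∑ i, ((k.2.1 i : ℝ) * z k - (k.2.1 i : ℝ) * w k) * ν i := by
      intro k
      rw [eq_add_sum_of_edge_increments hinc k, mul_add, Finset.mul_sum]
      congr 1
      exact Finset.sum_congr rfl fun i _ => by ring
    simp only [this, Finset.sum_add_distrib]
    rw [Finset.sum_comm, ← Finset.sum_fiberwise (s := Finset.univ) (fun k : S.Config => k.1)]
    have h1 : ∀ s, ∑ k : S.Config with k.1 = s, (z k - w k) * g (S.zeroConfig k.1) = 0 := by
      intro s
      have : ∑ k : S.Config with k.1 = s, (z k - w k) * g (S.zeroConfig k.1)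
          = ∑ k : S.Config with k.1 = s, (z k - w k) * g (S.zeroConfig s) := by
        refine Finset.sum_congr rfl fun k hk => ?_
        have : k.1 = s := by simpa using hk
        rw [this]
      rw [this, ← Finset.sum_mul, Finset.sum_sub_distrib, hp, sub_self, zero_mul]
    simp only [h1, ← Finset.sum_mul, Finset.sum_sub_distrib, hl, sub_self, zero_mul,
      Finset.sum_const_zero, add_zero]
  have hle : ∀ k ∈ Finset.univ, 0 ≤ (z k - w k) * g k := fun k _ => by
    have := mul_log_sub_log_nonpos (hz k) (hw k)
    simp only [hg]; linarith
  rw [Finset.sum_eq_zero_iff_of_nonneg hle] at hsum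
  funext k
  refine eq_of_mul_log_sub_log_eq_zero (hz k) (hw k) ?_
  have := hsum k (Finset.mem_univ k)
  simp only [hg] at this
  linarith

/-! ### The optimum -/

theorem continuous_lyap : Continuous (S.lyap) := by
  unfold lyap
  refine continuous_finsetSum _ fun k _ => ?_
  have hc : S.cfact k / Real.exp 1 ≠ 0 := (div_pos (cfact_pos k) (Real.exp_pos 1)).ne'
  have : (fun z : S.Config → ℝ => z k * Real.log (z k * S.cfact k / Real.exp 1))
      = fun z => (z k * (S.cfact k / Real.exp 1)) * Real.log (z k * (S.cfact k / Real.exp 1))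
        / (S.cfact k / Real.exp 1) := by
    funext z
    rw [mul_div_assoc, mul_right_comm, mul_div_cancel_right₀ _ hc]
  rw [this]
  have h2 : Continuous fun z : S.Config → ℝ => z k * (S.cfact k / Real.exp 1) := by fun_prop
  exact (Real.continuous_mul_log.comp h2).div_const _

theorem hasDerivWithinAt_lyap {z : ℝ → S.Config → ℝ} {z' : S.Config → ℝ} {s : Set ℝ} {t : ℝ}
    (hpos : ∀ k, 0 < z t k) (hz : ∀ k, HasDerivWithinAt (fun u => z u k) (z' k) s t) :
    HasDerivWithinAt (fun u => S.lyap (z u)) (∑ k, Real.log (z t k * S.cfact k) * z' k) s t := by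
  unfold lyap
  refine HasDerivWithinAt.fun_sum fun k _ => ?_
  have hc : 0 < S.cfact k := cfact_pos k
  have hne : z t k * S.cfact k / Real.exp 1 ≠ 0 := by have := hpos k; positivity
  have h1 := (hz k).mul ((((hz k).mul_const (S.cfact k)).div_const (Real.exp 1)).log hne)
  refine HasDerivWithinAt.congr_deriv h1 ?_
  have := (hpos k).ne'
  rw [Real.log_div (mul_pos (hpos k) hc).ne' (Real.exp_pos 1).ne', Real.log_exp]
  field_simp
  ring

/-- Subgradient inequality for the convex summands of the Lyapunov function. -/
theorem mul_log_sub_le {c z w : ℝ} (hc : 0 < c) (hz : 0 ≤ z) (hw : 0 < w) :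
    w * Real.log (w * c / Real.exp 1) - z * Real.log (z * c / Real.exp 1)
      ≤ (w - z) * Real.log (w * c) := by
  have he := Real.exp_pos 1
  rw [Real.log_div (mul_pos hw hc).ne' he.ne', Real.log_exp]
  rcases hz.eq_or_lt with rfl | hz
  · simp; linarith
  · rw [Real.log_div (mul_pos hz hc).ne' he.ne', Real.log_exp, Real.log_mul hw.ne' hc.ne',
      Real.log_mul hz.ne' hc.ne']
    have h := Real.log_le_sub_one_of_pos (div_pos hw hz)
    rw [Real.log_div hw.ne' hz.ne'] at h
    have h2 := mul_le_mul_of_nonneg_left h hz.le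
    have h3 : z * (w / z - 1) = w - z := by field_simp
    rw [h3] at h2
    nlinarith

/-- Under subcritical load some state of the diamond has all configurations occupied. -/
theorem exists_pos_mem_diamond (hS : S.Subcritical) : ∃ y ∈ S.diamond, ∀ k, 0 < S.bar y k := by
  obtain ⟨x, hx, hx0⟩ := hS
  choose p hp using S.single_mem
  -- `w` meets the loads with all nonzero configurations occupied, perhaps beyond the pool sizes
  obtain ⟨w, hwpos, hwload⟩ : ∃ w : S.State, (∀ k, 0 < w k) ∧
      ∀ i, ∑ k : S.NzConfig, (k.1.2.1 i : ℝ) * w k = S.lam i / S.mu i := by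
    have hev : ∀ᶠ ε : ℝ in 𝓝[>] 0, ∀ i,
        ε * ∑ k : S.NzConfig, (k.1.2.1 i : ℝ) < S.lam i / S.mu i := by
      rw [eventually_all]
      intro i
      have : Tendsto (fun ε : ℝ => ε * ∑ k : S.NzConfig, (k.1.2.1 i : ℝ)) (𝓝[>] 0) (𝓝 0) := by
        have : Continuous fun ε : ℝ => ε * ∑ k : S.NzConfig, (k.1.2.1 i : ℝ) := by fun_prop
        have := this.tendsto 0
        rw [zero_mul] at this
        exact this.mono_left nhdsWithin_le_nhds
      exact this.eventually_lt_const (div_pos (S.lam_pos i) (S.mu_pos i))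
    obtain ⟨ε, hε, hε0⟩ := (hev.and self_mem_nhdsWithin).exists
    have hε0 : 0 < ε := hε0
    let q : ι → S.NzConfig := fun i => ⟨⟨p i, Pi.single i 1, hp i⟩, by
      intro h0
      have := congrFun h0 i
      simp at this⟩
    let b : ι → ℝ := fun i => S.lam i / S.mu i - ε * ∑ k : S.NzConfig, (k.1.2.1 i : ℝ)
    have hb : ∀ i, 0 ≤ b i := fun i => by linarith [hε i]
    refine ⟨WithLp.toLp 2 fun k => ε + ∑ j, if k = q j then b j else 0, fun k => ?_, fun i => ?_⟩
    · have : 0 ≤ ∑ j, if k = q j then b j else 0 :=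
        Finset.sum_nonneg fun j _ => by split_ifs <;> simp [hb]
      change 0 < ε + ∑ j, if k = q j then b j else 0
      linarith
    · change ∑ k : S.NzConfig, (k.1.2.1 i : ℝ) * (ε + ∑ j, if k = q j then b j else 0) = _
      simp only [mul_add, Finset.sum_add_distrib, Finset.mul_sum]
      rw [Finset.sum_comm]
      have : ∀ j, ∑ k : S.NzConfig, (k.1.2.1 i : ℝ) * (if k = q j then b j else 0)
          = if i = j then b j else 0 := by
        intro j
        rw [Finset.sum_eq_single (q j)]
        · simp [q, Pi.single_apply]
        · intro k _ hk; simp [hk]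
        · simp
      simp only [this, Finset.sum_ite_eq, Finset.mem_univ, if_true, b]
      rw [Finset.mul_sum]
      simp only [mul_comm ε]
      ring
  have hbar : ∀ θ : ℝ, ∀ k, S.bar ((1 - θ) • x + θ • w) k
      = (1 - θ) * S.bar x k + θ * S.bar w k := by
    intro θ k
    by_cases hk : k.2.1 = 0
    · have hk' : k = S.zeroConfig k.1 := config_ext rfl hk
      rw [hk']
      simp only [bar_zero, PiLp.add_apply, PiLp.smul_apply, smul_eq_mul, Finset.sum_add_distrib,
        ← Finset.mul_sum]
      ring
    · simp [bar_nz _ ⟨k, hk⟩]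
  have hx' := (mem_diamond_iff x).1 hx
  have hev : ∀ᶠ θ : ℝ in 𝓝[>] 0, ∀ s,
      0 < (1 - θ) * S.bar x (S.zeroConfig s) + θ * S.bar w (S.zeroConfig s) := by
    rw [eventually_all]
    intro s
    have hc : Continuous fun θ : ℝ =>
        (1 - θ) * S.bar x (S.zeroConfig s) + θ * S.bar w (S.zeroConfig s) := by fun_prop
    have := (hc.tendsto 0).mono_left (nhdsWithin_le_nhds (s := Ioi 0))
    refine this.eventually_const_lt ?_
    simpa using hx0 s
  have hev1 : ∀ᶠ θ : ℝ in 𝓝[>] 0, θ < 1 :=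
    nhdsWithin_le_nhds (eventually_lt_nhds zero_lt_one)
  obtain ⟨θ, ⟨hθ, hθ1⟩, hθ0⟩ := ((hev.and hev1).and self_mem_nhdsWithin).exists
  have hθ0 : 0 < θ := hθ0
  have hpos : ∀ k, 0 < S.bar ((1 - θ) • x + θ • w) k := by
    intro k
    rw [hbar]
    by_cases hk : k.2.1 = 0
    · have hk' : k = S.zeroConfig k.1 := config_ext rfl hk
      rw [hk']; exact hθ _
    · have h1 := hx'.1 k
      have h2 : 0 < S.bar w k := by rw [bar_nz _ ⟨k, hk⟩]; exact hwpos _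
      have : 0 ≤ (1 - θ) * S.bar x k := mul_nonneg (by linarith) h1
      positivity
  refine ⟨(1 - θ) • x + θ • w, (mem_diamond_iff _).2 ⟨fun k => (hpos k).le, fun i => ?_⟩, hpos⟩
  have hw' : ∑ k : S.Config, (k.2.1 i : ℝ) * S.bar w k = S.lam i / S.mu i := by
    rw [sum_load_bar]; exact hwload i
  simp only [hbar, mul_add, Finset.sum_add_distrib, mul_left_comm _ (1 - θ), mul_left_comm _ θ,
    ← Finset.mul_sum, hx'.2 i, hw']
  ring

theorem toState_mem_diamond {z : S.Config → ℝ} (h0 : ∀ k, 0 ≤ z k)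
    (hp : ∀ s, ∑ k : S.Config with k.1 = s, z k = S.h s)
    (hl : ∀ i, ∑ k : S.Config, (k.2.1 i : ℝ) * z k = S.lam i / S.mu i) :
    toState z ∈ S.diamond := by
  rw [mem_diamond_iff, bar_toState hp]
  exact ⟨h0, hl⟩

/-- The logarithmic singularity of the entropy keeps minimizers away from the boundary. -/
theorem IsOptimal.bar_pos {x : S.State} (hx : S.IsOptimal x) (hS : S.Subcritical)
    (k : S.Config) : 0 < S.bar x k := by
  obtain ⟨y, hy, hypos⟩ := exists_pos_mem_diamond hS
  obtain ⟨hx0, hxl⟩ := (mem_diamond_iff x).1 hx.1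
  obtain ⟨-, hyl⟩ := (mem_diamond_iff y).1 hy
  by_contra hk
  -- along the segment `w` from `x` to the interior point `y` the derivative
  -- would tend to `-∞` at `x`
  have hk0 : S.bar x k = 0 := le_antisymm (not_lt.1 hk) (hx0 k)
  set w : ℝ → S.Config → ℝ := fun δ l => S.bar x l + δ * (S.bar y l - S.bar x l) with hw
  have hwpos : ∀ δ, 0 < δ → δ < 1 → ∀ l, 0 < w δ l := by
    intro δ h0 h1 l
    have h2 := hx0 l
    have h3 := hypos l
    have : w δ l = (1 - δ) * S.bar x l + δ * S.bar y l := by simp only [hw]; ring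
    rw [this]
    have : 0 ≤ (1 - δ) * S.bar x l := mul_nonneg (by linarith) h2
    positivity
  have hineq : ∀ δ, 0 < δ → δ < 1 →
      0 ≤ ∑ l, (S.bar y l - S.bar x l) * Real.log (w δ l * S.cfact l) := by
    intro δ h0 h1
    have hmem : toState (w δ) ∈ S.diamond := by
      refine toState_mem_diamond (fun l => (hwpos δ h0 h1 l).le) (fun s => ?_) (fun i => ?_)
      · simp only [hw, Finset.sum_add_distrib, ← Finset.mul_sum, Finset.sum_sub_distrib,
          sum_pool_bar]
        ring
      · simp only [hw, mul_add, mul_sub, mul_left_comm _ δ, Finset.sum_add_distrib,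
          Finset.sum_sub_distrib, ← Finset.mul_sum, hxl i, hyl i]
        ring
    have hbar : S.bar (toState (w δ)) = w δ := by
      refine bar_toState fun s => ?_
      simp only [hw, Finset.sum_add_distrib, ← Finset.mul_sum, Finset.sum_sub_distrib,
          sum_pool_bar]
      ring
    have hopt := hx.2 _ hmem
    rw [hbar] at hopt
    have hle : S.lyap (w δ) - S.lyap (S.bar x)
        ≤ δ * ∑ l, (S.bar y l - S.bar x l) * Real.log (w δ l * S.cfact l) := by
      unfold lyap
      rw [← Finset.sum_sub_distrib, Finset.mul_sum]
      refine Finset.sum_le_sum fun l _ => ?_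
      refine (mul_log_sub_le (cfact_pos l) (hx0 l) (hwpos δ h0 h1 l)).trans_eq ?_
      simp only [hw]; ring
    by_contra hneg
    have := mul_neg_of_pos_of_neg h0 (not_le.1 hneg)
    linarith
  have hbot : ∀ l, S.bar x l = 0 → Tendsto (fun δ =>
      (S.bar y l - S.bar x l) * Real.log (w δ l * S.cfact l)) (𝓝[>] 0) atBot := by
    intro l hl
    have : (fun δ => (S.bar y l - S.bar x l) * Real.log (w δ l * S.cfact l))
        = fun δ => S.bar y l * Real.log (δ * (S.bar y l * S.cfact l)) := by
      funext δ
      simp only [hw, hl, sub_zero, zero_add, mul_assoc]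
    rw [this]
    refine Tendsto.const_mul_atBot (hypos l) ?_
    refine Real.tendsto_log_nhdsGT_zero.comp ?_
    have hpos : 0 < S.bar y l * S.cfact l := mul_pos (hypos l) (cfact_pos l)
    refine tendsto_nhdsWithin_iff.2 ⟨?_, ?_⟩
    · have hc : Continuous fun δ : ℝ => δ * (S.bar y l * S.cfact l) := by fun_prop
      have := (hc.tendsto 0).mono_left (nhdsWithin_le_nhds (s := Ioi 0))
      simpa using this
    · filter_upwards [self_mem_nhdsWithin] with δ hδ
      exact mul_pos hδ hpos
  have hbdd : ∀ l, ∃ B : ℝ, ∀ᶠ δ in 𝓝[>] (0 : ℝ),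
      (S.bar y l - S.bar x l) * Real.log (w δ l * S.cfact l) ≤ B := by
    intro l
    rcases (hx0 l).eq_or_lt with hl | hl
    · exact ⟨0, (hbot l hl.symm).eventually_le_atBot 0⟩
    · refine ⟨(S.bar y l - S.bar x l) * Real.log (S.bar x l * S.cfact l) + 1, ?_⟩
      have hc : ContinuousAt (fun δ : ℝ =>
          (S.bar y l - S.bar x l) * Real.log (w δ l * S.cfact l)) 0 := by
        refine ContinuousAt.mul continuousAt_const (ContinuousAt.log ?_ ?_)
        · simp only [hw]; fun_prop
        · simp only [hw, zero_mul, add_zero]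
          exact (mul_pos hl (cfact_pos l)).ne'
      have := hc.tendsto.mono_left (nhdsWithin_le_nhds (s := Ioi 0))
      refine this.eventually_le_const ?_
      simp [hw]
  choose B hB using hbdd
  have hev1 : ∀ᶠ δ : ℝ in 𝓝[>] 0, δ < 1 :=
    nhdsWithin_le_nhds (eventually_lt_nhds zero_lt_one)
  obtain ⟨δ, ⟨⟨hδB, hδk⟩, hδ1⟩, hδ0⟩ := (((eventually_all.2 hB).and
    ((hbot k hk0).eventually_le_atBot (-(∑ l ∈ Finset.univ.erase k, B l) - 1))).and
    (hev1)).and self_mem_nhdsWithin |>.exists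
  have h1 := hineq δ hδ0 hδ1
  rw [← Finset.add_sum_erase _ _ (Finset.mem_univ k)] at h1
  have h2 := Finset.sum_le_sum (s := Finset.univ.erase k) fun l _ => hδB l
  linarith

/-- A minimizer is in detailed balance: to first order the fluid dynamics do not change the
Lyapunov function there, because they move along the diamond. -/
theorem IsOptimal.flow_eq_zero {x : S.State} (hx : S.IsOptimal x) (hS : S.Subcritical)
    (e : S.Edge) : flow (S.bar x) e = 0 := by
  have hpos := hx.bar_pos hS
  obtain ⟨-, hxl⟩ := (mem_diamond_iff x).1 hx.1
  have hf := sum_flow_eq_zero hpos hxl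
  refine flow_eq_zero_of_dissipation_eq_zero hpos hf ?_ e
  set n : S.Config → ℝ := net (flow (S.bar x)) with hn
  set w : ℝ → S.Config → ℝ := fun δ l => S.bar x l + δ * n l with hw
  have hw0 : w 0 = S.bar x := by funext l; simp [hw]
  have hwp : ∀ δ s, ∑ k : S.Config with k.1 = s, w δ k = S.h s := by
    intro δ s
    simp only [hw, Finset.sum_add_distrib, ← Finset.mul_sum, sum_pool_bar, hn, sum_pool_net]
    ring
  have hmin : IsLocalMin (fun δ => S.lyap (w δ)) 0 := by
    have hev : ∀ᶠ δ : ℝ in 𝓝 0, ∀ l, 0 < w δ l := by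
      rw [eventually_all]
      intro l
      have hc : Continuous fun δ : ℝ => w δ l := by simp only [hw]; fun_prop
      refine (hc.tendsto 0).eventually_const_lt ?_
      rw [hw0]; exact hpos l
    filter_upwards [hev] with δ hδ
    have hmem : toState (w δ) ∈ S.diamond := by
      refine toState_mem_diamond (fun l => (hδ l).le) (hwp δ) (fun i => ?_)
      simp only [hw, mul_add, mul_left_comm _ δ, Finset.sum_add_distrib, ← Finset.mul_sum, hxl i,
        hn, sum_load_net, hf i]
      ring
    have := hx.2 _ hmem
    rwa [bar_toState (hwp δ), ← hw0] at this
  have hd : HasDerivAt (fun δ => S.lyap (w δ)) (dissipation (S.bar x)) 0 := by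
    rw [← hasDerivWithinAt_univ]
    have := hasDerivWithinAt_lyap (S := S) (z := w) (z' := n) (s := univ) (t := 0)
      (by rw [hw0]; exact hpos) (fun k => by
        have h1 : HasDerivAt (fun δ : ℝ => S.bar x k + δ * n k) (1 * n k) 0 :=
          ((hasDerivAt_id 0).mul_const (n k)).const_add _
        rw [one_mul] at h1
        exact h1.hasDerivWithinAt)
    rw [hw0] at this
    exact this
  exact hmin.hasDerivAt_eq_zero hd

theorem exists_isOptimal (hS : S.Subcritical) : ∃ x, S.IsOptimal x := by
  obtain ⟨y, hy, -⟩ := hS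
  obtain ⟨x, hx, hmin⟩ := isCompact_diamond.exists_isMinOn ⟨y, hy⟩
    (continuous_lyap.comp continuous_bar).continuousOn
  exact ⟨x, hx, fun y hy => hmin hy⟩

/-- A state of the diamond in detailed balance with all configurations occupied is the minimizer. -/
theorem IsOptimal.eq_of_flow_eq_zero {x y : S.State} (hx : S.IsOptimal x) (hS : S.Subcritical)
    (hy : y ∈ S.diamond) (hpos : ∀ k, 0 < S.bar y k) (hf : ∀ e, flow (S.bar y) e = 0) :
    y = x := by
  refine bar_injective (PackingSystem.eq_of_flow_eq_zero hpos (hx.bar_pos hS) (fun s => ?_)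
    (fun i => ?_) hf (hx.flow_eq_zero hS))
  · rw [sum_pool_bar, sum_pool_bar]
  · rw [((mem_diamond_iff y).1 hy).2, ((mem_diamond_iff x).1 hx.1).2]

theorem IsOptimal.unique {x y : S.State} (hx : S.IsOptimal x) (hS : S.Subcritical)
    (hy : S.IsOptimal y) : y = x :=
  hx.eq_of_flow_eq_zero hS hy.1 (hy.bar_pos hS) (hy.flow_eq_zero hS)

/-! ### Local stability of the fluid dynamics -/

/-- Continuous paths which obey the fluid dynamics, in the sense of right derivatives, at all times
at which servers are available for every customer type. -/
structure IsFluidSolution (x : ℝ → S.State) : Prop where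
  continuousOn : ContinuousOn x (Ici 0)
  hasDeriv : ∀ t, 0 ≤ t → (∀ i, 0 < fluidAvail i (S.bar (x t))) → ∀ k,
    HasDerivWithinAt (fun u => S.bar (x u) k) (net (flow (S.bar (x t))) k) (Ici t) t

theorem IsFluidSolution.continuousOn_bar {x : ℝ → S.State} (h : IsFluidSolution x) (k : S.Config) :
    ContinuousOn (fun t => S.bar (x t) k) (Ici 0) :=
  ((continuous_apply k).comp continuous_bar).comp_continuousOn h.continuousOn

/-- As long as all configurations are occupied, the loads stay at their equilibrium values. -/
theorem IsFluidSolution.mem_diamond {x : ℝ → S.State} (h : IsFluidSolution x)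
    (h0 : x 0 ∈ S.diamond) {t₀ : ℝ} (hpos : ∀ u ∈ Icc 0 t₀, ∀ k, 0 < S.bar (x u) k) :
    ∀ u ∈ Icc 0 t₀, x u ∈ S.diamond := by
  intro u hu
  refine (mem_diamond_iff _).2 ⟨fun k => (hpos u hu k).le, fun i => ?_⟩
  set y : ℝ → ℝ := fun t => ∑ k : S.Config, (k.2.1 i : ℝ) * S.bar (x t) k with hy
  -- the deviation of the load from equilibrium decays exponentially at rate `μ_i`
  set f : ℝ → ℝ := fun t => (y t - S.lam i / S.mu i) * Real.exp (S.mu i * t) with hf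
  have hμ := S.mu_pos i
  have hcont : ContinuousOn f (Icc 0 t₀) := by
    have : ContinuousOn y (Icc 0 t₀) := continuousOn_finsetSum _ fun k _ =>
      continuousOn_const.mul ((h.continuousOn_bar k).mono Icc_subset_Ici_self)
    simp only [hf]
    fun_prop
  have hderiv : ∀ t ∈ Ico 0 t₀, HasDerivWithinAt f 0 (Ici t) t := by
    intro t ht
    have hpt := hpos t (Ico_subset_Icc_self ht)
    have hyd : HasDerivWithinAt y (S.lam i - S.mu i * y t) (Ici t) t := by
      have h1 : HasDerivWithinAt y
          (∑ k : S.Config, (k.2.1 i : ℝ) * net (flow (S.bar (x t))) k) (Ici t) t :=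
        HasDerivWithinAt.fun_sum fun k _ =>
          (h.hasDeriv t ht.1 (fluidAvail_pos hpt) k).const_mul _
      rwa [sum_load_net, sum_flow (fluidAvail_pos hpt i)] at h1
    have he : HasDerivWithinAt (fun t => Real.exp (S.mu i * t))
        (Real.exp (S.mu i * t) * (S.mu i * 1)) (Ici t) t :=
      (((hasDerivAt_id t).const_mul (S.mu i)).exp).hasDerivWithinAt
    refine HasDerivWithinAt.congr_deriv ((hyd.sub_const (S.lam i / S.mu i)).mul he) ?_
    field_simp
    ring
  have hconst := constant_of_has_deriv_right_zero hcont hderiv u hu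
  have hy0 : y 0 = S.lam i / S.mu i := ((mem_diamond_iff _).1 h0).2 i
  simp only [hf, hy0, sub_self, zero_mul, mul_eq_zero, (Real.exp_pos _).ne', or_false] at hconst
  exact sub_eq_zero.1 hconst

/-- While the dissipation is at most `-g`, the Lyapunov function decreases at least at rate `g`. -/
theorem IsFluidSolution.lyap_le {x : ℝ → S.State} (h : IsFluidSolution x) {a b g : ℝ} (ha : 0 ≤ a)
    (hpos : ∀ u ∈ Ico a b, ∀ k, 0 < S.bar (x u) k)
    (hg : ∀ u ∈ Ico a b, dissipation (S.bar (x u)) ≤ -g) :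
    ∀ t ∈ Icc a b, S.lyap (S.bar (x t)) ≤ S.lyap (S.bar (x a)) - g * (t - a) := by
  intro t ht
  refine image_le_of_deriv_right_le_deriv_boundary (f := fun u => S.lyap (S.bar (x u)))
    (f' := fun u => dissipation (S.bar (x u)))
    (B := fun u => S.lyap (S.bar (x a)) - g * (u - a)) (B' := fun _ => -g)
    ?_ ?_ ?_ ?_ ?_ hg ht
  · exact (continuous_lyap.comp continuous_bar).comp_continuousOn
      (h.continuousOn.mono fun u hu => ha.trans hu.1)
  · intro u hu
    exact hasDerivWithinAt_lyap (hpos u hu) fun k =>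
      h.hasDeriv u (ha.trans hu.1) (fluidAvail_pos (hpos u hu)) k
  · simp
  · fun_prop
  · intro u _
    have := ((((hasDerivAt_id u).sub_const a).const_mul g).const_sub
      (S.lyap (S.bar (x a)))).hasDerivWithinAt (s := Ici u)
    simpa using this

theorem IsFluidSolution.antitoneOn_lyap {x : ℝ → S.State} (h : IsFluidSolution x)
    (h0 : x 0 ∈ S.diamond) {t₀ : ℝ} (hpos : ∀ u ∈ Icc 0 t₀, ∀ k, 0 < S.bar (x u) k)
    {a b : ℝ} (ha : 0 ≤ a) (hab : a ≤ b) (hb : b ≤ t₀) :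
    S.lyap (S.bar (x b)) ≤ S.lyap (S.bar (x a)) := by
  have hsub : Ico a b ⊆ Icc 0 t₀ := fun u hu => ⟨ha.trans hu.1, hu.2.le.trans hb⟩
  have := h.lyap_le (g := 0) ha (fun u hu => hpos u (hsub hu)) (fun u hu => by
    rw [neg_zero]
    exact dissipation_nonpos (hpos u (hsub hu)) (sum_flow_eq_zero (hpos u (hsub hu))
      ((mem_diamond_iff _).1 (h.mem_diamond h0 hpos u (hsub hu))).2)) b ⟨hab, le_rfl⟩
  simpa using this

theorem exists_closedBall_pos {xs : S.State} (hpos : ∀ k, 0 < S.bar xs k) :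
    ∃ R : ℝ, 0 < R ∧ ∀ y ∈ Metric.closedBall xs R, ∀ k, 0 < S.bar y k := by
  have hev : ∀ᶠ y in 𝓝 xs, ∀ k, 0 < S.bar y k := by
    rw [eventually_all]
    intro k
    exact (((continuous_apply k).comp continuous_bar).tendsto xs).eventually_const_lt (hpos k)
  exact Metric.nhds_basis_closedBall.mem_iff.1 hev

theorem IsOptimal.lyap_lt {x y : S.State} (hx : S.IsOptimal x) (hS : S.Subcritical)
    (hy : y ∈ S.diamond) (hne : y ≠ x) : S.lyap (S.bar x) < S.lyap (S.bar y) := by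
  refine lt_of_le_of_ne (hx.2 y hy) fun heq => hne (hx.unique hS ⟨hy, fun z hz => ?_⟩)
  rw [← heq]
  exact hx.2 z hz

theorem IsOptimal.dissipation_neg {x y : S.State} (hx : S.IsOptimal x) (hS : S.Subcritical)
    (hy : y ∈ S.diamond) (hpos : ∀ k, 0 < S.bar y k) (hne : y ≠ x) :
    dissipation (S.bar y) < 0 := by
  have hf := sum_flow_eq_zero hpos ((mem_diamond_iff y).1 hy).2
  refine lt_of_le_of_ne (dissipation_nonpos hpos hf) fun heq => hne ?_
  exact hx.eq_of_flow_eq_zero hS hy hpos (flow_eq_zero_of_dissipation_eq_zero hpos hf heq)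

theorem continuousAt_dissipation {z : S.Config → ℝ} (hpos : ∀ k, 0 < z k) :
    ContinuousAt (dissipation (S := S)) z := by
  have hav : ∀ i, Continuous fun z : S.Config → ℝ => fluidAvail i z := fun i => by
    unfold fluidAvail; fun_prop
  have hflow : ∀ e, ContinuousAt (fun z : S.Config → ℝ => flow z e) z := by
    intro e
    unfold flow upRate downRate
    have h1 := (hav (S.ctype e)).continuousAt (x := z)
    have h2 := (fluidAvail_pos hpos (S.ctype e)).ne'
    have h3 : ∀ l, ContinuousAt (fun z : S.Config → ℝ => z l) z := fun l => continuousAt_apply l z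
    exact (continuousAt_const.mul ((h3 _).div h1 h2)).sub
      (((h3 _).mul continuousAt_const).mul continuousAt_const)
  unfold dissipation net
  refine tendsto_finsetSum _ fun k _ => ?_
  refine ContinuousAt.mul (ContinuousAt.log ((continuousAt_apply k z).mul continuousAt_const)
    (mul_pos (hpos k) (cfact_pos k)).ne') (ContinuousAt.sub ?_ ?_)
  · exact tendsto_finsetSum _ fun e _ => hflow e
  · exact tendsto_finsetSum _ fun e _ => hflow e

/-- A fluid path whose initial energy is below the energy on a sphere around the minimizer never
crosses that sphere. -/
theorem IsFluidSolution.mem_closedBall {x : ℝ → S.State} (h : IsFluidSolution x)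
    (h0 : x 0 ∈ S.diamond) {xs : S.State} {R m : ℝ}
    (hR : ∀ y ∈ Metric.closedBall xs R, ∀ k, 0 < S.bar y k)
    (hm : ∀ y ∈ S.diamond ∩ Metric.sphere xs R, m ≤ S.lyap (S.bar y))
    (hx : x 0 ∈ Metric.closedBall xs R) (hlt : S.lyap (S.bar (x 0)) < m) :
    ∀ t, 0 ≤ t → x t ∈ Metric.closedBall xs R := by
  intro t ht
  by_contra hout
  rw [Metric.mem_closedBall, not_le] at hout
  -- the path leaves the open ball at the first time `τ` in `A`
  set A : Set ℝ := {u | u ∈ Icc 0 t ∧ R ≤ dist (x u) xs} with hA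
  have hcont : ContinuousOn (fun u => dist (x u) xs) (Icc 0 t) :=
    (continuous_id.dist continuous_const).comp_continuousOn
      (h.continuousOn.mono Icc_subset_Ici_self)
  have hAc : IsCompact A := by
    have : A = Icc 0 t ∩ (fun u => dist (x u) xs) ⁻¹' Ici R := rfl
    rw [this]
    exact isCompact_Icc.of_isClosed_subset
      (hcont.preimage_isClosed_of_isClosed isClosed_Icc isClosed_Ici) inter_subset_left
  obtain ⟨τ, ⟨hτ, hτR⟩, hmin⟩ := hAc.exists_isMinOn ⟨t, ⟨ht, le_rfl⟩, hout.le⟩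
    continuousOn_id
  have hlt' : ∀ u ∈ Ico 0 τ, dist (x u) xs < R := by
    intro u hu
    by_contra hc
    have : τ ≤ u := hmin ⟨⟨hu.1, hu.2.le.trans hτ.2⟩, not_lt.1 hc⟩
    exact absurd hu.2 (not_lt.2 this)
  have hτeq : dist (x τ) xs ≤ R := by
    rcases hτ.1.eq_or_lt with h' | h'
    · rw [← h']; exact hx
    · have hτ2 := hτ.2
      have htend : Tendsto (fun u => dist (x u) xs) (𝓝[Ico 0 τ] τ) (𝓝 (dist (x τ) xs)) :=
        (hcont τ hτ).mono_left (nhdsWithin_mono _ fun u hu => ⟨hu.1, hu.2.le.trans hτ2⟩)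
      have : (𝓝[Ico 0 τ] τ).NeBot := by
        rw [← mem_closure_iff_nhdsWithin_neBot, closure_Ico h'.ne]
        exact ⟨h'.le, le_rfl⟩
      exact le_of_tendsto htend (eventually_mem_nhdsWithin.mono fun u hu => (hlt' u hu).le)
  have hpos : ∀ u ∈ Icc 0 τ, ∀ k, 0 < S.bar (x u) k := by
    intro u hu
    refine hR _ ?_
    rcases hu.2.eq_or_lt with rfl | h'
    · exact hτeq
    · exact (hlt' u ⟨hu.1, h'⟩).le
  have h1 := h.antitoneOn_lyap h0 hpos le_rfl hτ.1 le_rfl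
  have h2 := hm (x τ) ⟨h.mem_diamond h0 hpos τ ⟨hτ.1, le_rfl⟩, le_antisymm hτeq hτR⟩
  linarith

/-- The level of the Lyapunov function on a part of the diamond away from the minimizer. -/
theorem IsOptimal.exists_level {xs : S.State} (hx : S.IsOptimal xs) (hS : S.Subcritical)
    {K : Set S.State} (hK : IsClosed K) (hne : xs ∉ K) :
    ∃ m, S.lyap (S.bar xs) < m ∧ ∀ y ∈ S.diamond ∩ K, m ≤ S.lyap (S.bar y) :=
  (isCompact_diamond.inter_right hK).exists_forall_le'
    (continuous_lyap.comp continuous_bar).continuousOn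
    fun _ hy => hx.lyap_lt hS hy.1 fun h => hne (h ▸ hy.2)

/-- Fluid solutions do not leave the minimizer, because the Lyapunov function cannot increase. -/
theorem IsFluidSolution.eq_of_isOptimal {x : ℝ → S.State} (h : IsFluidSolution x) {xs : S.State}
    (hx : S.IsOptimal xs) (hS : S.Subcritical) (h0 : x 0 = xs) : ∀ t, 0 ≤ t → x t = xs := by
  intro t ht
  obtain ⟨R, hR0, hR⟩ := exists_closedBall_pos (hx.bar_pos hS)
  obtain ⟨m, hm, hm'⟩ := hx.exists_level hS (Metric.isClosed_sphere (x := xs) (ε := R))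
    (by simp [hR0.ne])
  have h0d : x 0 ∈ S.diamond := h0 ▸ hx.1
  have hball := h.mem_closedBall h0d hR hm' (by rw [h0]; simp [hR0.le]) (by rwa [h0])
  have hpos : ∀ u ∈ Icc 0 t, ∀ k, 0 < S.bar (x u) k := fun u hu => hR _ (hball u hu.1)
  have hd := h.mem_diamond h0d hpos t ⟨ht, le_rfl⟩
  by_contra hne
  have h1 := hx.lyap_lt hS hd hne
  have h2 := h.antitoneOn_lyap h0d hpos le_rfl ht le_rfl
  rw [h0] at h2
  linarith

/-- Uniform local stability of the minimizer under the fluid dynamics on the diamond. -/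
theorem IsOptimal.exists_stable {xs : S.State} (hx : S.IsOptimal xs) (hS : S.Subcritical) :
    ∃ ε : ℝ, 0 < ε ∧ ∀ η : ℝ, 0 < η → ∃ T : ℝ, ∀ x : ℝ → S.State, IsFluidSolution x →
      x 0 ∈ S.diamond → ‖x 0 - xs‖ ≤ ε → ∀ t, T ≤ t → 0 ≤ t → ‖x t - xs‖ ≤ η := by
  obtain ⟨R, hR0, hR⟩ := exists_closedBall_pos (hx.bar_pos hS)
  obtain ⟨m, hm, hm'⟩ := hx.exists_level hS (Metric.isClosed_sphere (x := xs) (ε := R))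
    (by simp [hR0.ne])
  have hcl : Continuous fun y : S.State => S.lyap (S.bar y) := continuous_lyap.comp continuous_bar
  obtain ⟨ε, hε0, hε⟩ := Metric.nhds_basis_closedBall.mem_iff.1
    (((hcl.tendsto xs).eventually_lt_const hm).and (Metric.closedBall_mem_nhds xs hR0))
  refine ⟨ε, hε0, fun η hη => ?_⟩
  obtain ⟨l, hl, hl'⟩ := hx.exists_level hS (K := (Metric.ball xs η)ᶜ)
    Metric.isOpen_ball.isClosed_compl (by simp [hη])
  -- the dissipation is bounded away from zero on the states of energy at least `l`
  obtain ⟨g, hg0, hg⟩ : ∃ g, 0 < g ∧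
      ∀ y ∈ S.diamond ∩ (Metric.closedBall xs R ∩ {y | l ≤ S.lyap (S.bar y)}),
        g ≤ -dissipation (S.bar y) := by
    refine (isCompact_diamond.inter_right (Metric.isClosed_closedBall.inter
      (isClosed_le continuous_const hcl))).exists_forall_le' ?_ ?_
    · refine ContinuousOn.neg fun y hy => ContinuousAt.continuousWithinAt ?_
      exact ContinuousAt.comp (g := dissipation (S := S)) (f := S.bar)
        (continuousAt_dissipation (hR y hy.2.1)) continuous_bar.continuousAt
    · intro y hy
      have hne : y ≠ xs := by
        rintro rfl
        have : l ≤ S.lyap (S.bar y) := hy.2.2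
        linarith
      linarith [hx.dissipation_neg hS hy.1 (hR y hy.2.1) hne]
  refine ⟨(m - l) / g, fun x h h0 hxε t ht ht0 => ?_⟩
  have hxε' := hε (show x 0 ∈ Metric.closedBall xs ε by rwa [Metric.mem_closedBall, dist_eq_norm])
  have hball := h.mem_closedBall h0 hR hm' hxε'.2 hxε'.1
  have hpos : ∀ u ∈ Icc 0 t, ∀ k, 0 < S.bar (x u) k := fun u hu => hR _ (hball u hu.1)
  have hd := h.mem_diamond h0 hpos
  have hlow : S.lyap (S.bar (x t)) < l := by
    by_contra hc
    have hc := not_lt.1 hc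
    have hall : ∀ u ∈ Icc 0 t, l ≤ S.lyap (S.bar (x u)) := fun u hu =>
      hc.trans (h.antitoneOn_lyap h0 hpos hu.1 hu.2 le_rfl)
    have h1 := h.lyap_le (g := g) le_rfl (fun u hu => hpos u (Ico_subset_Icc_self hu))
      (fun u hu => by
        have hu' := Ico_subset_Icc_self hu
        linarith [hg (x u) ⟨hd u hu', hball u hu'.1, hall u hu'⟩]) t ⟨ht0, le_rfl⟩
    have h2 : S.lyap (S.bar (x 0)) < m := hxε'.1
    have h3 : m - l ≤ g * t := by
      rw [div_le_iff₀ hg0] at ht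
      linarith
    rw [sub_zero] at h1
    linarith
  by_contra hc
  have := hl' (x t) ⟨hd t ⟨ht0, le_rfl⟩, by
    rw [mem_compl_iff, Metric.mem_ball, dist_eq_norm]; exact fun h => hc h.le⟩
  linarith

/-- A constant solution with idle servers in each pool is the minimizer. -/
theorem IsOptimal.eq_of_net_flow_eq_zero {xs y : S.State} (hx : S.IsOptimal xs)
    (hS : S.Subcritical) (h0 : ∀ k, 0 ≤ S.bar y k) (hidle : ∀ s, 0 < S.bar y (S.zeroConfig s))
    (hnet : ∀ k, net (flow (S.bar y)) k = 0) : y = xs := by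
  have hav := fluidAvail_pos_of_idle h0 hidle
  have hl : ∀ i, ∑ k : S.Config, (k.2.1 i : ℝ) * S.bar y k = S.lam i / S.mu i := by
    intro i
    have h1 := sum_load_net i (flow (S.bar y))
    rw [sum_flow (hav i)] at h1
    simp only [hnet, mul_zero, Finset.sum_const_zero] at h1
    rw [eq_div_iff (S.mu_pos i).ne']
    linarith
  -- if `k` were empty, nothing could flow into it, so that `k - e_i` would be empty too
  have hpos : ∀ k, 0 < S.bar y k := by
    refine induction_on_lower hidle fun e he => ?_
    by_contra hc
    have hk0 : S.bar y (S.upper e) = 0 := le_antisymm (not_lt.1 hc) (h0 _)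
    have hup : ∀ f : S.Edge, 0 ≤ upRate (S.bar y) f := fun f =>
      mul_nonneg (S.lam_pos _).le (div_nonneg (h0 _) (hav _).le)
    have hdown : ∀ f : S.Edge, 0 ≤ downRate (S.bar y) f := fun f =>
      mul_nonneg (mul_nonneg (h0 _) (Nat.cast_nonneg _)) (S.mu_pos _).le
    have h1 : ∑ f : S.Edge with S.lower f = S.upper e, flow (S.bar y) f ≤ 0 := by
      refine Finset.sum_nonpos fun f hf => ?_
      have : S.lower f = S.upper e := by simpa using hf
      have h2 := hdown f
      simp only [flow, upRate, this, hk0, zero_div, mul_zero]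
      linarith
    have h2 : 0 < ∑ f : S.Edge with S.upper f = S.upper e, flow (S.bar y) f := by
      have hz : ∀ f : S.Edge, S.upper f = S.upper e → downRate (S.bar y) f = 0 := by
        intro f hf
        simp [downRate, hf, hk0]
      refine Finset.sum_pos' (fun f hf => ?_) ⟨e, by simp, ?_⟩
      · rw [flow, hz f (by simpa using hf), sub_zero]; exact hup f
      · rw [flow, hz e rfl, sub_zero]
        exact mul_pos (S.lam_pos _) (div_pos he (hav _))
    have h3 := hnet (S.upper e)
    rw [net] at h3
    linarith
  have hf := sum_flow_eq_zero hpos hl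
  refine hx.eq_of_flow_eq_zero hS ((mem_diamond_iff y).2 ⟨h0, hl⟩) hpos
    (flow_eq_zero_of_dissipation_eq_zero hpos hf ?_)
  simp [dissipation, hnet]

/-! ### Counting processes -/

theorem IsEpochs.exists_eq_Iio {T : ℕ → ℝ} (h : IsEpochs T) (t : ℝ) :
    ∃ N, {m : ℕ | T m ≤ t} = Iio N := by
  classical
  have hex : ∃ N, t < T N := (h.2.2.eventually_gt_atTop t).exists
  refine ⟨Nat.find hex, Set.ext fun m => ⟨fun hm => ?_, fun hm => ?_⟩⟩
  · by_contra hc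
    have h1 := h.2.1.monotone (not_lt.1 hc)
    have h2 := Nat.find_spec hex
    have h3 : T m ≤ t := hm
    linarith
  · exact not_lt.1 (Nat.find_min hex hm)

theorem IsEpochs.lt_counting_iff {T : ℕ → ℝ} (h : IsEpochs T) {m : ℕ} {t : ℝ} :
    m < counting T t ↔ T m ≤ t := by
  obtain ⟨N, hN⟩ := h.exists_eq_Iio t
  have h1 : m ∈ {m : ℕ | T m ≤ t} ↔ m ∈ Iio N := by rw [hN]
  rw [counting, hN, Set.ncard_eq_toFinset_card']
  simpa using h1.symm

theorem IsEpochs.counting_mono {T : ℕ → ℝ} (h : IsEpochs T) : Monotone (counting T) := by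
  intro s t hst
  by_contra hc
  have h1 := h.lt_counting_iff.1 (not_le.1 hc)
  exact lt_irrefl _ (h.lt_counting_iff.2 (h1.trans hst))

theorem IsEpochs.counting_zero {T : ℕ → ℝ} (h : IsEpochs T) : counting T 0 = 0 := by
  by_contra hc
  have h1 := h.lt_counting_iff.1 (Nat.pos_of_ne_zero hc)
  linarith [h.1]

/-- The number of type `i` arrivals, blocked or not, up to time `t` in the `n`-th system. -/
def arrCount (C : S.Scaling) (ω : S.Driving) (n : ℕ) (i : ι) (t : ℝ) : ℕ :=
  counting (ω.arr i) (C.r n * (S.lam i * t))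

theorem lt_arrCount_iff {C : S.Scaling} {ω : S.Driving} {n : ℕ} {i : ι} {t : ℝ} {m : ℕ} :
    m < arrCount C ω n i t ↔ arrTime C ω n i m ≤ t := by
  rw [arrCount, (ω.arr_epochs i).lt_counting_iff, arrTime,
    div_le_iff₀ (mul_pos (S.lam_pos i) (C.r_pos n))]
  constructor <;> intro h <;> linarith

theorem arrTime_pos {C : S.Scaling} {ω : S.Driving} {n : ℕ} {i : ι} (m : ℕ) :
    0 < arrTime C ω n i m :=
  div_pos ((ω.arr_epochs i).1.trans_le ((ω.arr_epochs i).2.1.monotone (Nat.zero_le m)))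
    (mul_pos (S.lam_pos i) (C.r_pos n))

theorem arrCount_mono {C : S.Scaling} {ω : S.Driving} {n : ℕ} {i : ι} :
    Monotone (arrCount C ω n i) := fun s t hst => by
  refine (ω.arr_epochs i).counting_mono ?_
  have := (C.r_pos n).le
  have := (S.lam_pos i).le
  gcongr

/-! ### Trajectories of the finite systems -/

section Trajectory

variable {C : S.Scaling} {ω : S.Driving} {n : ℕ} {X : ℝ → S.Config → ℕ} {A D : ℝ → S.Edge → ℕ}

/-- The fluid-scaled state. -/
def scaled (r : ℝ) (X : S.Config → ℕ) (k : S.Config) : ℝ := (X k : ℝ) / r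

/-- Trajectories are locally step functions, so that functions of the state are integrable. -/
theorem IsTrajectory.intervalIntegrable (H : IsTrajectory C ω n X A D) (g : (S.Config → ℕ) → ℝ)
    {a b : ℝ} (ha : 0 ≤ a) (hb : 0 ≤ b) :
    IntervalIntegrable (fun u => g (X u)) MeasureTheory.volume a b := by
  have hconst : ∀ {s : Set ℝ} {c : S.Config → ℕ}, MeasurableSet s →
      MeasureTheory.volume s ≠ ⊤ → (∀ u ∈ s, X u = c) →
      MeasureTheory.IntegrableOn (fun u => g (X u)) s := by
    intro s c hs hfin hc
    have : MeasureTheory.IntegrableOn (fun _ : ℝ => g c) s :=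
      MeasureTheory.integrableOn_const hfin
    exact this.congr_fun (fun u hu => by simp only [hc u hu]) hs
  have hloc : ∀ B, MeasureTheory.LocallyIntegrableOn (fun u => g (X u)) (Icc 0 B) := by
    intro B u hu
    obtain ⟨w, hw, hwX⟩ := mem_nhdsGT_iff_exists_Ioo_subset.1 (H.right_const u hu.1)
    have hw : u < w := hw
    have hr : MeasureTheory.IntegrableOn (fun u => g (X u)) (Ico u w) := by
      refine hconst (c := X u) measurableSet_Ico (by simp) fun v hv => ?_
      rcases hv.1.eq_or_lt with rfl | h
      · rfl
      · exact hwX ⟨h, hv.2⟩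
    rcases hu.1.eq_or_lt with rfl | h0
    · refine ⟨Ico 0 w, ?_, hr⟩
      exact nhdsWithin_mono _ Icc_subset_Ici_self (Ico_mem_nhdsGE hw)
    · obtain ⟨c, hc⟩ := H.left_const u h0
      obtain ⟨v, hv, hvX⟩ := mem_nhdsLT_iff_exists_Ioo_subset.1 hc
      have hv : v < u := hv
      have hl : MeasureTheory.IntegrableOn (fun u => g (X u)) (Ioo v u) :=
        hconst measurableSet_Ioo (by simp) fun y hy => hvX hy
      refine ⟨Ioo v u ∪ Ico u w, nhdsWithin_le_nhds ?_, hl.union hr⟩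
      rw [Ioo_union_Ico_eq_Ioo hv hw.le]
      exact Ioo_mem_nhds hv hw
  have hint : MeasureTheory.IntegrableOn (fun u => g (X u)) (Icc 0 (max a b)) :=
    (hloc _).integrableOn_isCompact isCompact_Icc
  refine MeasureTheory.IntegrableOn.intervalIntegrable (hint.mono_set ?_)
  intro u hu
  exact ⟨(le_min ha hb).trans hu.1, hu.2⟩

theorem IsTrajectory.balance_net (H : IsTrajectory C ω n X A D) {t : ℝ} (ht : 0 ≤ t)
    (k : S.Config) : (X t k : ℝ) = X 0 k + net (fun e => (A t e : ℝ) - D t e) k := by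
  have := congrArg (Int.cast : ℤ → ℝ) (H.balance t ht k)
  push_cast at this
  rw [this, net]
  ring

theorem IsTrajectory.sum_pool (H : IsTrajectory C ω n X A D) {t : ℝ} (ht : 0 ≤ t) (s : σ) :
    ∑ k : S.Config with k.1 = s, (X t k : ℝ) = C.H n s := by
  have h1 : ∑ k : S.Config with k.1 = s, (X t k : ℝ)
      = ∑ k : S.Config with k.1 = s, ((X 0 k : ℝ) + net (fun e => (A t e : ℝ) - D t e) k) :=
    Finset.sum_congr rfl fun k _ => H.balance_net ht k
  rw [h1, Finset.sum_add_distrib, sum_pool_net, add_zero]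
  exact_mod_cast H.pool s

theorem IsTrajectory.le_pool (H : IsTrajectory C ω n X A D) {t : ℝ} (ht : 0 ≤ t) (k : S.Config) :
    (X t k : ℝ) ≤ C.H n k.1 := by
  rw [← H.sum_pool ht]
  exact Finset.single_le_sum (f := fun k => (X t k : ℝ)) (fun l _ => Nat.cast_nonneg _) (by simp)

/-- The `m`-th customer of type `i` is placed along the edge `e`. -/
def Placed (C : S.Scaling) (ω : S.Driving) (n : ℕ) (X : ℝ → S.Config → ℕ) (e : S.Edge) (m : ℕ) :
    Prop :=
  ∀ᶠ u in 𝓝[<] (arrTime C ω n (S.ctype e) m),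
    Selects C (S.ctype e) (ω.mark (S.ctype e) m) (X u) (S.lower e)

open Classical in
theorem ncard_placed (C : S.Scaling) (ω : S.Driving) (n : ℕ) (X : ℝ → S.Config → ℕ) (e : S.Edge)
    (t : ℝ) : {m : ℕ | arrTime C ω n (S.ctype e) m ≤ t ∧ Placed C ω n X e m}.ncard
      = ((Finset.range (arrCount C ω n (S.ctype e) t)).filter (Placed C ω n X e)).card := by
  rw [← Set.ncard_coe_finset]
  congr 1
  ext m
  simp [lt_arrCount_iff]

open Classical in
theorem IsTrajectory.arr_sub (H : IsTrajectory C ω n X A D) {s t : ℝ} (hs : 0 ≤ s) (hst : s ≤ t)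
    (e : S.Edge) : (A t e : ℝ) - A s e
      = ∑ m ∈ Finset.Ico (arrCount C ω n (S.ctype e) s) (arrCount C ω n (S.ctype e) t),
          if Placed C ω n X e m then (1 : ℝ) else 0 := by
  have key : ∀ u, 0 ≤ u → (A u e : ℝ) = ∑ m ∈ Finset.range (arrCount C ω n (S.ctype e) u),
      if Placed C ω n X e m then (1 : ℝ) else 0 := by
    intro u hu
    rw [H.arr_eq u hu e]
    refine (congrArg (Nat.cast (R := ℝ)) (ncard_placed C ω n X e u)).trans ?_
    rw [Finset.card_filter]
    push_cast
    rfl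
  rw [key t (hs.trans hst), key s hs, Finset.sum_Ico_eq_sub _ (arrCount_mono hst)]

theorem IsTrajectory.arr_zero (H : IsTrajectory C ω n X A D) (e : S.Edge) : A 0 e = 0 := by
  rw [H.arr_eq 0 le_rfl e]
  refine (congrArg Set.ncard (Set.eq_empty_of_forall_notMem fun m hm => ?_)).trans
    (Set.ncard_empty ℕ)
  exact absurd hm.1 (not_le.2 (arrTime_pos m))

theorem IsTrajectory.dep_zero (H : IsTrajectory C ω n X A D) (e : S.Edge) : D 0 e = 0 := by
  rw [H.dep_eq 0 le_rfl e, intervalIntegral.integral_same, (ω.dep_epochs e).counting_zero]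

/-- The fluid-scaled clock of the departures along the edge `e`. -/
def depClock (r : ℝ) (X : ℝ → S.Config → ℕ) (e : S.Edge) (t : ℝ) : ℝ :=
  ∫ u in (0 : ℝ)..t, downRate (scaled r (X u)) e

theorem IsTrajectory.dep_eq_depClock (H : IsTrajectory C ω n X A D) {t : ℝ} (ht : 0 ≤ t)
    (e : S.Edge) : D t e = counting (ω.dep e) (C.r n * depClock (C.r n) X e t) := by
  rw [H.dep_eq t ht e, depClock, ← intervalIntegral.integral_const_mul]
  congr 2
  funext u
  have := (C.r_pos n).ne'
  simp only [downRate, scaled]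
  field_simp

theorem IsTrajectory.depClock_sub (H : IsTrajectory C ω n X A D) {s t : ℝ} (hs : 0 ≤ s)
    (ht : 0 ≤ t) (r : ℝ) (e : S.Edge) :
    depClock r X e t - depClock r X e s = ∫ u in s..t, downRate (scaled r (X u)) e :=
  intervalIntegral.integral_interval_sub_left
    (H.intervalIntegrable (fun y => downRate (scaled r y) e) le_rfl ht)
    (H.intervalIntegrable (fun y => downRate (scaled r y) e) le_rfl hs)

theorem IsTrajectory.depClock_sub_mem (H : IsTrajectory C ω n X A D) {s t lo hi : ℝ} (hs : 0 ≤ s)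
    (hst : s ≤ t) (r : ℝ) (e : S.Edge)
    (h : ∀ u ∈ Icc s t, downRate (scaled r (X u)) e ∈ Icc lo hi) :
    depClock r X e t - depClock r X e s ∈ Icc (lo * (t - s)) (hi * (t - s)) := by
  rw [H.depClock_sub hs (hs.trans hst)]
  have hi' := H.intervalIntegrable (fun y => downRate (scaled r y) e) hs (hs.trans hst)
  constructor
  · have := intervalIntegral.integral_mono_on hst (intervalIntegrable_const (c := lo)) hi'
      fun u hu => (h u hu).1
    rwa [intervalIntegral.integral_const, smul_eq_mul, mul_comm] at this
  · have := intervalIntegral.integral_mono_on hst hi' (intervalIntegrable_const (c := hi))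
      fun u hu => (h u hu).2
    rwa [intervalIntegral.integral_const, smul_eq_mul, mul_comm] at this

end Trajectory

/-! ### The selection of configurations as a comparison of marks with fractions -/

/-- The lower end of the interval of marks which select the edge `e`, as a function of the fluid
state. -/
def lowFrac (C : S.Scaling) (e : S.Edge) (y : S.Config → ℝ) : ℝ :=
  (∑ k : S.Config with S.Fits (S.ctype e) k ∧
    C.rank (S.ctype e) k < C.rank (S.ctype e) (S.lower e), y k) / fluidAvail (S.ctype e) y

/-- The upper end of the interval of marks which select the edge `e`, as a function of the fluid
state. -/
def highFrac (C : S.Scaling) (e : S.Edge) (y : S.Config → ℝ) : ℝ :=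
  lowFrac C e y + y (S.lower e) / fluidAvail (S.ctype e) y

theorem selects_iff {C : S.Scaling} {e : S.Edge} {r ξ : ℝ} {X : S.Config → ℕ} (hr : 0 < r)
    (hX : 0 < fluidAvail (S.ctype e) (scaled r X)) :
    Selects C (S.ctype e) ξ X (S.lower e)
      ↔ lowFrac C e (scaled r X) < ξ ∧ ξ ≤ highFrac C e (scaled r X) := by
  have h1 : (avail (S.ctype e) X : ℝ) = r * fluidAvail (S.ctype e) (scaled r X) := by
    simp only [avail, fluidAvail, scaled, Finset.mul_sum]
    push_cast
    exact Finset.sum_congr rfl fun k _ => by field_simp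
  have h2 : (∑ k : S.Config with S.Fits (S.ctype e) k ∧
      C.rank (S.ctype e) k < C.rank (S.ctype e) (S.lower e), (X k : ℝ))
      = r * (lowFrac C e (scaled r X) * fluidAvail (S.ctype e) (scaled r X)) := by
    rw [lowFrac, div_mul_cancel₀ _ hX.ne', Finset.mul_sum]
    exact Finset.sum_congr rfl fun k _ => by simp only [scaled]; field_simp
  have h3 : (X (S.lower e) : ℝ) = r * scaled r X (S.lower e) := by
    simp only [scaled]; field_simp
  have h4 : highFrac C e (scaled r X) * fluidAvail (S.ctype e) (scaled r X)
      = lowFrac C e (scaled r X) * fluidAvail (S.ctype e) (scaled r X)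
        + scaled r X (S.lower e) := by
    rw [highFrac, add_mul, div_mul_cancel₀ _ hX.ne']
  rw [Selects, h1, h2, h3, ← mul_add, ← h4, and_iff_right (fits_lower e)]
  rw [mul_left_comm ξ, mul_lt_mul_iff_right₀ hr, mul_le_mul_iff_right₀ hr,
    mul_lt_mul_iff_left₀ hX, mul_le_mul_iff_left₀ hX]

theorem lowFrac_nonneg {C : S.Scaling} {e : S.Edge} {y : S.Config → ℝ} (hy : ∀ k, 0 ≤ y k) :
    0 ≤ lowFrac C e y :=
  div_nonneg (Finset.sum_nonneg fun k _ => hy k) (Finset.sum_nonneg fun k _ => hy k)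

theorem lowFrac_le_highFrac {C : S.Scaling} {e : S.Edge} {y : S.Config → ℝ} (hy : ∀ k, 0 ≤ y k) :
    lowFrac C e y ≤ highFrac C e y :=
  le_add_of_nonneg_right (div_nonneg (hy _) (Finset.sum_nonneg fun k _ => hy k))

theorem highFrac_le_one {C : S.Scaling} {e : S.Edge} {y : S.Config → ℝ} (hy : ∀ k, 0 ≤ y k)
    (hav : 0 < fluidAvail (S.ctype e) y) : highFrac C e y ≤ 1 := by
  rw [highFrac, lowFrac, ← add_div, div_le_one hav, fluidAvail,
    ← Finset.sum_erase_add _ _ (show S.lower e ∈ Finset.univ.filter (S.Fits (S.ctype e)) by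
      simpa using fits_lower e)]
  refine add_le_add ?_ le_rfl
  refine Finset.sum_le_sum_of_subset_of_nonneg (fun k hk => ?_) fun k _ _ => hy k
  simp only [Finset.mem_filter, Finset.mem_univ, true_and] at hk
  rw [Finset.mem_erase, Finset.mem_filter]
  refine ⟨?_, Finset.mem_univ _, hk.1⟩
  rintro rfl
  exact lt_irrefl _ hk.2

theorem continuousAt_fluidAvail (i : ι) (w : S.Config → ℝ) :
    ContinuousAt (fun y : S.Config → ℝ => fluidAvail i y) w :=
  tendsto_finsetSum _ fun k _ => continuousAt_apply k w

theorem continuousAt_lowFrac {C : S.Scaling} {e : S.Edge} {w : S.Config → ℝ}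
    (hav : 0 < fluidAvail (S.ctype e) w) : ContinuousAt (lowFrac C e) w :=
  ContinuousAt.div (tendsto_finsetSum _ fun k _ => continuousAt_apply k w)
    (continuousAt_fluidAvail _ w) hav.ne'

theorem continuousAt_highFrac {C : S.Scaling} {e : S.Edge} {w : S.Config → ℝ}
    (hav : 0 < fluidAvail (S.ctype e) w) : ContinuousAt (highFrac C e) w :=
  (continuousAt_lowFrac hav).add
    ((continuousAt_apply _ w).div (continuousAt_fluidAvail _ w) hav.ne')

theorem continuous_downRate (e : S.Edge) :
    Continuous fun y : S.Config → ℝ => downRate y e := by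
  unfold downRate
  exact ((continuous_apply _).mul continuous_const).mul continuous_const

/-! ### Laws of large numbers for the primitives along a filter -/

section Prelimit

/-- Trajectories of the systems with indices `φ n`, where `φ n → ∞` along the filter `ℓ`. -/
structure IsPrelimit (C : S.Scaling) (ω : S.Driving) (ℓ : Filter ℕ) (φ : ℕ → ℕ)
    (X : ℕ → ℝ → S.Config → ℕ) (A D : ℕ → ℝ → S.Edge → ℕ) : Prop where
  fslln : ω.FSLLN C
  tendsto : Tendsto φ ℓ atTop
  traj : ∀ n, IsTrajectory C ω (φ n) (X n) (A n) (D n)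

variable {C : S.Scaling} {ω : S.Driving} {ℓ : Filter ℕ} {φ : ℕ → ℕ}
  {X : ℕ → ℝ → S.Config → ℕ} {A D : ℕ → ℝ → S.Edge → ℕ}

theorem CountingFSLLN.eventually {r : ℕ → ℝ} {T : ℕ → ℝ} (h : CountingFSLLN r T) (b : ℝ) {ε : ℝ}
    (hε : 0 < ε) : ∀ᶠ n in atTop, ∀ t ∈ Icc 0 b, |(counting T (r n * t) : ℝ) / r n - t| < ε := by
  filter_upwards [Metric.tendstoUniformlyOn_iff.1 (h b) ε hε] with n hn t ht
  rw [← Real.dist_eq, dist_comm]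
  exact hn t ht

theorem IsPrelimit.eventually_arrCount (H : IsPrelimit C ω ℓ φ X A D) (i : ι) (b : ℝ) {ε : ℝ}
    (hε : 0 < ε) : ∀ᶠ n in ℓ, ∀ t ∈ Icc 0 b,
      |(arrCount C ω (φ n) i t : ℝ) / C.r (φ n) - S.lam i * t| < ε := by
  have hl := S.lam_pos i
  filter_upwards [H.tendsto.eventually ((H.fslln.2.1 i).eventually (S.lam i * b) hε)] with n hn t ht
  exact hn _ ⟨mul_nonneg hl.le ht.1, by have := ht.2; gcongr⟩

theorem IsPrelimit.tendsto_arrCount (H : IsPrelimit C ω ℓ φ X A D) (i : ι) {t : ℝ} (ht : 0 ≤ t) :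
    Tendsto (fun n => (arrCount C ω (φ n) i t : ℝ) / C.r (φ n)) ℓ (𝓝 (S.lam i * t)) := by
  rw [Metric.tendsto_nhds]
  intro ε hε
  filter_upwards [H.eventually_arrCount i t hε] with n hn
  rw [Real.dist_eq]
  exact hn t ⟨ht, le_rfl⟩

/-- The number of the first `N` marks which are at most `ζ`. -/
def markCount (ξ : ℕ → ℝ) (N : ℕ) (ζ : ℝ) : ℕ := ((Finset.range N).filter (fun m => ξ m ≤ ζ)).card

theorem IsPrelimit.tendsto_markCount (H : IsPrelimit C ω ℓ φ X A D) (i : ι) {t ζ : ℝ}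
    (ht : 0 ≤ t) (hζ : ζ ∈ Icc (0 : ℝ) 1) :
    Tendsto (fun n => (markCount (ω.mark i) (arrCount C ω (φ n) i t) ζ : ℝ) / C.r (φ n)) ℓ
      (𝓝 (S.lam i * t * ζ)) := by
  have hN := H.tendsto_arrCount i ht
  have hmul := hN.mul_const ζ
  have hM := H.fslln.2.2 i (S.lam i * t + 1)
  rw [Metric.tendsto_nhds]
  intro ε hε
  have hM' := H.tendsto.eventually (Metric.tendstoUniformlyOn_iff.1 hM (ε / 2) (by positivity))
  filter_upwards [hM', (Metric.tendsto_nhds.1 hmul) (ε / 2) (by positivity),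
    hN.eventually_le_const (lt_add_one _)] with n h1 h2 h3
  have hr := C.r_pos (φ n)
  have h4 := h1 ((arrCount C ω (φ n) i t : ℝ) / C.r (φ n), ζ) ⟨⟨by positivity, h3⟩, hζ⟩
  simp only [mul_div_cancel₀ _ hr.ne', Nat.floor_natCast] at h4
  have h5 := dist_triangle_left
    ((markCount (ω.mark i) (arrCount C ω (φ n) i t) ζ : ℝ) / C.r (φ n)) (S.lam i * t * ζ)
    ((arrCount C ω (φ n) i t : ℝ) / C.r (φ n) * ζ)
  have h6 : dist ((arrCount C ω (φ n) i t : ℝ) / C.r (φ n) * ζ)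
    ((markCount (ω.mark i) (arrCount C ω (φ n) i t) ζ : ℝ) / C.r (φ n)) < ε / 2 := h4
  linarith

theorem Scaling.exists_pool_bound (C : S.Scaling) : ∃ M : ℝ, 0 < M ∧
    ∀ n s, (C.H n s : ℝ) ≤ M * C.r n := by
  have h : ∀ s, ∃ M : ℝ, ∀ n, (C.H n s : ℝ) / C.r n ≤ M := fun s => by
    obtain ⟨M, hM⟩ := (C.H_tendsto s).bddAbove_range
    exact ⟨M, fun n => hM ⟨n, rfl⟩⟩
  choose M hM using h
  refine ⟨∑ s, |M s| + 1, by positivity, fun n s => ?_⟩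
  rw [← div_le_iff₀ (C.r_pos n)]
  calc _ ≤ M s := hM s n
    _ ≤ |M s| := le_abs_self _
    _ ≤ ∑ s, |M s| := Finset.single_le_sum (f := fun s => |M s|) (fun s _ => abs_nonneg _)
        (Finset.mem_univ s)
    _ ≤ _ := by linarith

theorem scaled_nonneg {r : ℝ} (hr : 0 < r) (Y : S.Config → ℕ) (k : S.Config) : 0 ≤ scaled r Y k :=
  div_nonneg (Nat.cast_nonneg _) hr.le

theorem exists_downRate_bound (C : S.Scaling) (ω : S.Driving) (e : S.Edge) : ∃ M : ℝ, 0 < M ∧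
    ∀ n X A D, IsTrajectory C ω n X A D → ∀ t, 0 ≤ t →
      downRate (scaled (C.r n) (X t)) e ∈ Icc 0 M := by
  obtain ⟨M, hM0, hM⟩ := C.exists_pool_bound
  have hm : (0 : ℝ) < ((S.upper e).2.1 (S.ctype e) : ℝ) := by
    exact_mod_cast upper_apply_ctype_pos e
  have hμ := S.mu_pos (S.ctype e)
  refine ⟨M * ((S.upper e).2.1 (S.ctype e) : ℝ) * S.mu (S.ctype e), by positivity, ?_⟩
  intro n X A D H t ht
  have h0 := scaled_nonneg (C.r_pos n) (X t) (S.upper e)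
  have h1 : scaled (C.r n) (X t) (S.upper e) ≤ M := by
    rw [scaled, div_le_iff₀ (C.r_pos n)]
    exact (H.le_pool ht _).trans (hM _ _)
  unfold downRate
  exact ⟨by positivity, by gcongr⟩

theorem IsTrajectory.depClock_mem {n : ℕ} {X : ℝ → S.Config → ℕ} {A D : ℝ → S.Edge → ℕ}
    (H : IsTrajectory C ω n X A D) {e : S.Edge} {M : ℝ}
    (hM : ∀ t, 0 ≤ t → downRate (scaled (C.r n) (X t)) e ∈ Icc 0 M) {t : ℝ} (ht : 0 ≤ t) :
    depClock (C.r n) X e t ∈ Icc 0 (M * t) := by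
  have := H.depClock_sub_mem le_rfl ht (C.r n) e (fun u hu => hM u hu.1)
  have h0 : depClock (C.r n) X e 0 = 0 := intervalIntegral.integral_same
  simpa [h0] using this

/-- The scaled departures are uniformly close to their clocks. -/
theorem IsPrelimit.eventually_dep (H : IsPrelimit C ω ℓ φ X A D) (e : S.Edge) (b : ℝ) {ε : ℝ}
    (hε : 0 < ε) : ∀ᶠ n in ℓ, ∀ t ∈ Icc 0 b,
      |(D n t e : ℝ) / C.r (φ n) - depClock (C.r (φ n)) (X n) e t| < ε := by
  obtain ⟨M, hM0, hM⟩ := exists_downRate_bound C ω e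
  filter_upwards [H.tendsto.eventually ((H.fslln.1 e).eventually (M * b) hε)] with n hn t ht
  rw [(H.traj n).dep_eq_depClock ht.1]
  have := (H.traj n).depClock_mem (hM _ _ _ _ (H.traj n)) ht.1
  refine hn _ ⟨this.1, this.2.trans ?_⟩
  have := ht.2
  gcongr

/-! ### Asymptotic equicontinuity -/

/-- The functions `f n` are Lipschitz on compact subsets of `[0, ∞)`, up to errors which vanish
along the filter `ℓ`. -/
def AsympLipschitz (ℓ : Filter ℕ) (f : ℕ → ℝ → ℝ) : Prop :=
  ∃ L : ℝ, 0 ≤ L ∧ ∀ b ε : ℝ, 0 < ε → ∀ᶠ n in ℓ, ∀ s ∈ Icc 0 b, ∀ t ∈ Icc 0 b,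
    |f n t - f n s| ≤ L * |t - s| + ε

theorem AsympLipschitz.of_le {f : ℕ → ℝ → ℝ} {L : ℝ} (hL : 0 ≤ L)
    (h : ∀ b ε : ℝ, 0 < ε → ∀ᶠ n in ℓ, ∀ s t, 0 ≤ s → s ≤ t → t ≤ b →
      |f n t - f n s| ≤ L * (t - s) + ε) : AsympLipschitz ℓ f := by
  refine ⟨L, hL, fun b ε hε => ?_⟩
  filter_upwards [h b ε hε] with n hn s hs t ht
  rcases le_total s t with hst | hst
  · rw [abs_of_nonneg (sub_nonneg.2 hst)]
    exact hn s t hs.1 hst ht.2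
  · rw [abs_sub_comm, abs_sub_comm t s, abs_of_nonneg (sub_nonneg.2 hst)]
    exact hn t s ht.1 hst hs.2

theorem AsympLipschitz.add {f g : ℕ → ℝ → ℝ} (hf : AsympLipschitz ℓ f) (hg : AsympLipschitz ℓ g) :
    AsympLipschitz ℓ (fun n t => f n t + g n t) := by
  obtain ⟨L, hL, hf⟩ := hf
  obtain ⟨M, hM, hg⟩ := hg
  refine ⟨L + M, add_nonneg hL hM, fun b ε hε => ?_⟩
  filter_upwards [hf b (ε / 2) (by positivity), hg b (ε / 2) (by positivity)] with n h1 h2 s hs t ht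
  have h3 := h1 s hs t ht
  have h4 := h2 s hs t ht
  have h5 : f n t + g n t - (f n s + g n s) = (f n t - f n s) + (g n t - g n s) := by ring
  rw [h5]
  have := abs_add_le (f n t - f n s) (g n t - g n s)
  linarith

theorem AsympLipschitz.neg {f : ℕ → ℝ → ℝ} (hf : AsympLipschitz ℓ f) :
    AsympLipschitz ℓ (fun n t => -f n t) := by
  obtain ⟨L, hL, hf⟩ := hf
  refine ⟨L, hL, fun b ε hε => ?_⟩
  filter_upwards [hf b ε hε] with n h1 s hs t ht
  have := h1 s hs t ht
  rwa [neg_sub_neg, abs_sub_comm]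

theorem AsympLipschitz.sub {f g : ℕ → ℝ → ℝ} (hf : AsympLipschitz ℓ f) (hg : AsympLipschitz ℓ g) :
    AsympLipschitz ℓ (fun n t => f n t - g n t) := by
  simpa only [sub_eq_add_neg] using hf.add hg.neg

theorem AsympLipschitz.of_const (c : ℕ → ℝ) : AsympLipschitz ℓ (fun n _ => c n) :=
  ⟨0, le_rfl, fun b ε hε => Eventually.of_forall fun n s _ t _ => by simp [hε.le]⟩

theorem AsympLipschitz.sum {α : Type*} (u : Finset α) {f : α → ℕ → ℝ → ℝ}
    (hf : ∀ a, AsympLipschitz ℓ (f a)) : AsympLipschitz ℓ (fun n t => ∑ a ∈ u, f a n t) := by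
  classical
  induction u using Finset.induction_on with
  | empty => simpa using AsympLipschitz.of_const (ℓ := ℓ) (fun _ => 0)
  | insert a u ha ih => simpa only [Finset.sum_insert ha] using (hf a).add ih

theorem AsympLipschitz.congr {f g : ℕ → ℝ → ℝ} (hf : AsympLipschitz ℓ f)
    (h : ∀ n t, 0 ≤ t → f n t = g n t) : AsympLipschitz ℓ g := by
  obtain ⟨L, hL, hf⟩ := hf
  refine ⟨L, hL, fun b ε hε => ?_⟩
  filter_upwards [hf b ε hε] with n h1 s hs t ht
  rw [← h n t ht.1, ← h n s hs.1]
  exact h1 s hs t ht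

/-- Limits of asymptotically Lipschitz functions are Lipschitz. -/
theorem AsympLipschitz.exists_lipschitz [NeBot ℓ] {f : ℕ → ℝ → ℝ} (hf : AsympLipschitz ℓ f)
    {F : ℝ → ℝ} (hF : ∀ t, 0 ≤ t → Tendsto (fun n => f n t) ℓ (𝓝 (F t))) :
    ∃ L, 0 ≤ L ∧ ∀ s, 0 ≤ s → ∀ t, 0 ≤ t → |F t - F s| ≤ L * |t - s| := by
  obtain ⟨L, hL, hf⟩ := hf
  refine ⟨L, hL, fun s hs t ht => le_of_forall_pos_le_add fun ε hε => ?_⟩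
  refine le_of_tendsto ((hF t ht).sub (hF s hs)).abs ?_
  filter_upwards [hf (max s t) ε hε] with n hn
  exact hn s ⟨hs, le_max_left _ _⟩ t ⟨ht, le_max_right _ _⟩

/-- Pointwise convergence of asymptotically Lipschitz functions is uniform on compact sets. -/
theorem AsympLipschitz.tendstoUniformlyOn {f : ℕ → ℝ → ℝ} (hf : AsympLipschitz ℓ f)
    {F : ℝ → ℝ} (hF : ∀ t, 0 ≤ t → Tendsto (fun n => f n t) ℓ (𝓝 (F t))) (b : ℝ) :
    TendstoUniformlyOn f F ℓ (Icc 0 b) := by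
  rcases ℓ.eq_or_neBot with rfl | hne
  · intro u _; exact mem_bot
  obtain ⟨M, hM, hFL⟩ := hf.exists_lipschitz hF
  obtain ⟨L, hL, hf⟩ := hf
  rw [Metric.tendstoUniformlyOn_iff]
  intro ε hε
  -- control the functions on a finite net
  set δ : ℝ := ε / (4 * (L + M + 1)) with hδ
  have hδ0 : 0 < δ := by positivity
  obtain ⟨N, hNsub, hN⟩ := (isCompact_Icc (a := (0 : ℝ)) (b := b)).elim_finite_subcover_image
    (b := Icc 0 b) (c := fun x => Metric.ball x δ) (fun _ _ => Metric.isOpen_ball)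
    (fun x hx => mem_iUnion₂.2 ⟨x, hx, Metric.mem_ball_self hδ0⟩)
  have hnet : ∀ᶠ n in ℓ, ∀ x ∈ N, |f n x - F x| < ε / 4 := by
    refine (eventually_all_finite hN.1).2 fun x hx => ?_
    filter_upwards [(Metric.tendsto_nhds.1 (hF x (hNsub hx).1)) (ε / 4) (by positivity)] with n hn
    rwa [Real.dist_eq] at hn
  filter_upwards [hnet, hf b (ε / 4) (by positivity)] with n h1 h2 t ht
  obtain ⟨x, hx, htx⟩ := mem_iUnion₂.1 (hN.2 ht)
  rw [Metric.mem_ball, Real.dist_eq] at htx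
  have h3 := h1 x hx
  have h4 := h2 x (hNsub hx) t ht
  have h5 := hFL x (hNsub hx).1 t ht.1
  have h6 : (L + M) * |t - x| ≤ ε / 4 := by
    have : (L + M) * |t - x| ≤ (L + M + 1) * δ :=
      mul_le_mul (by linarith) htx.le (abs_nonneg _) (by positivity)
    have h7 : (L + M + 1) * δ = ε / 4 := by rw [hδ]; field_simp
    linarith
  rw [Real.dist_eq]
  have h8 : F t - f n t = (F t - F x) - (f n t - f n x) - (f n x - F x) := by ring
  rw [h8]
  have h9 := abs_sub ((F t - F x) - (f n t - f n x)) (f n x - F x)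
  have h10 := abs_sub (F t - F x) (f n t - f n x)
  nlinarith

theorem IsPrelimit.asympLipschitz_arr (H : IsPrelimit C ω ℓ φ X A D) (e : S.Edge) :
    AsympLipschitz ℓ (fun n t => (A n t e : ℝ) / C.r (φ n)) := by
  classical
  refine AsympLipschitz.of_le (S.lam_pos (S.ctype e)).le fun b ε hε => ?_
  filter_upwards [H.eventually_arrCount (S.ctype e) b (ε := ε / 2) (by positivity)]
    with n hn s t hs hst ht
  have hr := C.r_pos (φ n)
  have h1 := abs_lt.1 (hn s ⟨hs, hst.trans ht⟩)
  have h2 := abs_lt.1 (hn t ⟨hs.trans hst, ht⟩)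
  rw [← sub_div, (H.traj n).arr_sub hs hst e]
  have h3 : ∑ m ∈ Finset.Ico (arrCount C ω (φ n) (S.ctype e) s) (arrCount C ω (φ n) (S.ctype e) t),
      (if Placed C ω (φ n) (X n) e m then (1 : ℝ) else 0)
      ≤ (arrCount C ω (φ n) (S.ctype e) t : ℝ) - arrCount C ω (φ n) (S.ctype e) s := by
    refine (Finset.sum_le_card_nsmul _ _ 1 fun m _ => by split_ifs <;> simp).trans_eq ?_
    rw [Nat.card_Ico, nsmul_one, Nat.cast_sub (arrCount_mono hst)]
  have h4 := Finset.sum_nonneg (s := Finset.Ico (arrCount C ω (φ n) (S.ctype e) s)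
    (arrCount C ω (φ n) (S.ctype e) t))
    (f := fun m => if Placed C ω (φ n) (X n) e m then (1 : ℝ) else 0)
    fun m _ => by split_ifs <;> simp
  rw [abs_of_nonneg (div_nonneg h4 hr.le)]
  have h5 := div_le_div_of_nonneg_right h3 hr.le
  rw [sub_div] at h5
  linarith

theorem IsPrelimit.asympLipschitz_dep (H : IsPrelimit C ω ℓ φ X A D) (e : S.Edge) :
    AsympLipschitz ℓ (fun n t => (D n t e : ℝ) / C.r (φ n)) := by
  obtain ⟨M, hM0, hM⟩ := exists_downRate_bound C ω e
  refine AsympLipschitz.of_le hM0.le fun b ε hε => ?_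
  filter_upwards [H.eventually_dep e b (ε := ε / 2) (by positivity)] with n hn s t hs hst ht
  have h1 := abs_lt.1 (hn s ⟨hs, hst.trans ht⟩)
  have h2 := abs_lt.1 (hn t ⟨hs.trans hst, ht⟩)
  have h3 := (H.traj n).depClock_sub_mem hs hst (C.r (φ n)) e
    (fun u hu => hM _ _ _ _ (H.traj n) u (hs.trans hu.1))
  rw [zero_mul] at h3
  have h4 := h3.1
  have h5 := h3.2
  rw [abs_le]
  constructor <;> nlinarith

theorem IsPrelimit.asympLipschitz_state (H : IsPrelimit C ω ℓ φ X A D) (k : S.Config) :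
    AsympLipschitz ℓ (fun n t => scaled (C.r (φ n)) (X n t) k) := by
  have h1 : ∀ e, AsympLipschitz ℓ
      (fun n t => (A n t e : ℝ) / C.r (φ n) - (D n t e : ℝ) / C.r (φ n)) := fun e =>
    (H.asympLipschitz_arr e).sub (H.asympLipschitz_dep e)
  refine ((AsympLipschitz.of_const fun n => scaled (C.r (φ n)) (X n 0) k).add
    ((AsympLipschitz.sum (Finset.univ.filter fun e => S.upper e = k) h1).sub
      (AsympLipschitz.sum (Finset.univ.filter fun e => S.lower e = k) h1))).congr fun n t ht => ?_
  simp only [scaled]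
  rw [(H.traj n).balance_net ht k, net, add_div, sub_div, Finset.sum_div, Finset.sum_div]
  simp only [sub_div]

/-! ### Fluid limits obey the fluid dynamics -/

/-- The projection of `ℝ` onto `[0, 1]`. -/
def clamp (ζ : ℝ) : ℝ := max 0 (min 1 ζ)

theorem clamp_mem (ζ : ℝ) : clamp ζ ∈ Icc (0 : ℝ) 1 :=
  ⟨le_max_left _ _, max_le zero_le_one (min_le_left _ _)⟩

theorem le_clamp_iff {ξ ζ : ℝ} (h : ξ ∈ Ioc (0 : ℝ) 1) : ξ ≤ clamp ζ ↔ ξ ≤ ζ := by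
  rw [clamp, le_max_iff, le_min_iff]
  have h1 := h.1
  have h2 := h.2
  constructor
  · rintro (h3 | h3)
    · linarith
    · exact h3.2
  · exact fun h3 => Or.inr ⟨h2, h3⟩

theorem clamp_le {ζ : ℝ} (h : 0 ≤ ζ) : clamp ζ ≤ ζ := max_le h (min_le_right _ _)

theorem le_clamp {ζ : ℝ} (h : ζ ≤ 1) : ζ ≤ clamp ζ := le_max_of_le_right (le_min h le_rfl)

/-- For `α ≤ β` the sum counts the type `i` arrivals during `(s, t]` with marks in `(α, β]`. -/
theorem IsPrelimit.tendsto_sum_marks (H : IsPrelimit C ω ℓ φ X A D) (i : ι) {s t : ℝ}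
    (hs : 0 ≤ s) (hst : s ≤ t) (α β : ℝ) :
    Tendsto (fun n => (∑ m ∈ Finset.Ico (arrCount C ω (φ n) i s) (arrCount C ω (φ n) i t),
      ((if ω.mark i m ≤ β then (1 : ℝ) else 0) - if ω.mark i m ≤ α then (1 : ℝ) else 0))
        / C.r (φ n)) ℓ (𝓝 (S.lam i * (t - s) * (clamp β - clamp α))) := by
  have hc : ∀ ζ N, (markCount (ω.mark i) N (clamp ζ) : ℝ)
      = ∑ m ∈ Finset.range N, if ω.mark i m ≤ ζ then (1 : ℝ) else 0 := by
    intro ζ N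
    rw [markCount, Finset.card_filter]
    push_cast
    refine Finset.sum_congr rfl fun m _ => ?_
    simp only [le_clamp_iff (ω.mark_mem i m)]
  have ht := hs.trans hst
  have h1 := ((H.tendsto_markCount i ht (clamp_mem β)).sub
    (H.tendsto_markCount i hs (clamp_mem β))).sub
    ((H.tendsto_markCount i ht (clamp_mem α)).sub (H.tendsto_markCount i hs (clamp_mem α)))
  have h2 : S.lam i * t * clamp β - S.lam i * s * clamp β
      - (S.lam i * t * clamp α - S.lam i * s * clamp α)
      = S.lam i * (t - s) * (clamp β - clamp α) := by ring
  rw [h2] at h1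
  refine h1.congr fun n => ?_
  rw [Finset.sum_sub_distrib, Finset.sum_Ico_eq_sub _ (arrCount_mono hst),
    Finset.sum_Ico_eq_sub _ (arrCount_mono hst), ← hc, ← hc, ← hc, ← hc]
  ring

theorem eventually_dist_scaled_lt {z : ℝ → S.Config → ℝ}
    (hz : ∀ b k, TendstoUniformlyOn (fun n t => scaled (C.r (φ n)) (X n t) k) (fun t => z t k) ℓ
      (Icc 0 b)) {w : S.Config → ℝ} {δ s t : ℝ} (hδ : 0 < δ) (hs : 0 ≤ s)
    (hnear : ∀ u ∈ Icc s t, dist (z u) w < δ) :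
    ∀ᶠ n in ℓ, ∀ u ∈ Icc s t, dist (scaled (C.r (φ n)) (X n u)) w < 2 * δ := by
  filter_upwards [eventually_all.2 fun k => Metric.tendstoUniformlyOn_iff.1 (hz t k) δ hδ]
    with n hn u hu
  have h1 : dist (z u) (scaled (C.r (φ n)) (X n u)) < δ :=
    (dist_pi_lt_iff hδ).2 fun k => hn k u ⟨hs.trans hu.1, hu.2⟩
  have h2 := hnear u hu
  have h3 := dist_triangle_left (scaled (C.r (φ n)) (X n u)) w (z u)
  linarith

/-- If the state stays close to `w` during `[s, t]`, then arrivals along `e` take place at a rate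
close to `upRate w e`: the marks which select `e` fill an interval close to the one for `w`. -/
theorem IsPrelimit.abs_arr_sub_le [NeBot ℓ] (H : IsPrelimit C ω ℓ φ X A D) {z : ℝ → S.Config → ℝ}
    (hz : ∀ b k, TendstoUniformlyOn (fun n t => scaled (C.r (φ n)) (X n t) k) (fun t => z t k) ℓ
      (Icc 0 b)) {e : S.Edge} {a : ℝ → ℝ}
    (ha : ∀ t, 0 ≤ t → Tendsto (fun n => (A n t e : ℝ) / C.r (φ n)) ℓ (𝓝 (a t)))
    {w : S.Config → ℝ} (hw : ∀ k, 0 ≤ w k) (hav : 0 < fluidAvail (S.ctype e) w) {ε δ : ℝ}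
    (hε : 0 < ε) (hδ : 0 < δ)
    (hgood : ∀ y, dist y w < 2 * δ → 0 < fluidAvail (S.ctype e) y ∧
      |lowFrac C e y - lowFrac C e w| ≤ ε ∧ |highFrac C e y - highFrac C e w| ≤ ε)
    {s t : ℝ} (hs : 0 ≤ s) (hst : s ≤ t) (hnear : ∀ u ∈ Icc s t, dist (z u) w < δ) :
    |a t - a s - (t - s) * upRate w e| ≤ (t - s) * (S.lam (S.ctype e) * (2 * ε)) := by
  classical
  set i := S.ctype e with hi
  have hlam := S.lam_pos i
  have hdiff := (ha t (hs.trans hst)).sub (ha s hs)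
  have hup : upRate w e = S.lam i * (highFrac C e w - lowFrac C e w) := by
    rw [upRate, highFrac, add_sub_cancel_left]
  have hl0 := lowFrac_nonneg (C := C) (e := e) hw
  have hlh := lowFrac_le_highFrac (C := C) (e := e) hw
  have hh1 := highFrac_le_one (C := C) hw hav
  have hev := eventually_dist_scaled_lt hz hδ hs hnear
  -- the times at which the arriving customers of `[s, t]` see the system
  have hsee : ∀ n, ∀ m ∈ Finset.Ico (arrCount C ω (φ n) i s) (arrCount C ω (φ n) i t),
      ∀ᶠ u in 𝓝[<] (arrTime C ω (φ n) i m), u ∈ Icc s t := by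
    intro n m hm
    rw [Finset.mem_Ico] at hm
    have h1 : s < arrTime C ω (φ n) i m := by
      by_contra hc
      exact absurd (lt_arrCount_iff.2 (not_lt.1 hc)) (not_lt.2 hm.1)
    have h2 := lt_arrCount_iff.1 hm.2
    filter_upwards [Ioo_mem_nhdsLT h1] with u hu
    exact ⟨hu.1.le, hu.2.le.trans h2⟩
  have upper : a t - a s ≤ S.lam i * (t - s)
      * (clamp (highFrac C e w + ε) - clamp (lowFrac C e w - ε)) := by
    refine le_of_tendsto_of_tendsto hdiff (H.tendsto_sum_marks i hs hst _ _) ?_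
    filter_upwards [hev] with n hn
    rw [← sub_div, (H.traj n).arr_sub hs hst e]
    refine div_le_div_of_nonneg_right (Finset.sum_le_sum fun m hm => ?_) (C.r_pos _).le
    by_cases hp : Placed C ω (φ n) (X n) e m
    · obtain ⟨u, hu, hu'⟩ := (hp.and (hsee n m hm)).exists
      obtain ⟨g1, g2, g3⟩ := hgood _ (hn u hu')
      rw [selects_iff (C.r_pos _) g1] at hu
      have h2 := abs_le.1 g2
      have h3 := abs_le.1 g3
      rw [if_pos hp, if_pos (by linarith [hu.2]), if_neg (by push Not; linarith [hu.1]), sub_zero]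
    · rw [if_neg hp, sub_nonneg]
      split_ifs with h1 h2
      · rfl
      · exact absurd (h1.trans (by linarith)) h2
      · exact zero_le_one
      · rfl
  have lower : S.lam i * (t - s) * (clamp (highFrac C e w - ε) - clamp (lowFrac C e w + ε))
      ≤ a t - a s := by
    refine le_of_tendsto_of_tendsto (H.tendsto_sum_marks i hs hst _ _) hdiff ?_
    filter_upwards [hev] with n hn
    rw [← sub_div, (H.traj n).arr_sub hs hst e]
    refine div_le_div_of_nonneg_right (Finset.sum_le_sum fun m hm => ?_) (C.r_pos _).le
    by_cases hp : ω.mark i m ≤ highFrac C e w - ε ∧ lowFrac C e w + ε < ω.mark i m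
    · have : Placed C ω (φ n) (X n) e m := by
        filter_upwards [hsee n m hm] with u hu
        obtain ⟨g1, g2, g3⟩ := hgood _ (hn u hu)
        rw [selects_iff (C.r_pos _) g1]
        have h2 := abs_le.1 g2
        have h3 := abs_le.1 g3
        exact ⟨by linarith [hp.2], by linarith [hp.1]⟩
      rw [if_pos this, if_pos hp.1, if_neg (not_le.2 hp.2), sub_zero]
    · have h0 : (0 : ℝ) ≤ if Placed C ω (φ n) (X n) e m then (1 : ℝ) else 0 := by
        split_ifs <;> simp
      refine le_trans ?_ h0
      rw [sub_nonpos]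
      split_ifs with h1 h2
      · rfl
      · exact absurd ⟨h1, not_le.1 h2⟩ hp
      · exact zero_le_one
      · rfl
  have hts : 0 ≤ S.lam i * (t - s) := mul_nonneg hlam.le (sub_nonneg.2 hst)
  have c1 := clamp_le (ζ := highFrac C e w + ε) (by linarith)
  have c2 := le_clamp (ζ := lowFrac C e w - ε) (by linarith)
  have c3 := le_clamp (ζ := highFrac C e w - ε) (by linarith)
  have c4 := clamp_le (ζ := lowFrac C e w + ε) (by linarith)
  have u1 := upper.trans (mul_le_mul_of_nonneg_left (add_le_add c1 (neg_le_neg c2)) hts)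
  have u2 := (mul_le_mul_of_nonneg_left (add_le_add c3 (neg_le_neg c4)) hts).trans lower
  rw [hup, abs_le]
  constructor <;> nlinarith

/-- If the state stays close to `w` during `[s, t]`, then departures along `e` take place at a rate
close to `downRate w e`. -/
theorem IsPrelimit.abs_dep_sub_le [NeBot ℓ] (H : IsPrelimit C ω ℓ φ X A D) {z : ℝ → S.Config → ℝ}
    (hz : ∀ b k, TendstoUniformlyOn (fun n t => scaled (C.r (φ n)) (X n t) k) (fun t => z t k) ℓ
      (Icc 0 b)) {e : S.Edge} {d : ℝ → ℝ}
    (hd : ∀ t, 0 ≤ t → Tendsto (fun n => (D n t e : ℝ) / C.r (φ n)) ℓ (𝓝 (d t)))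
    {w : S.Config → ℝ} {ε δ : ℝ} (hδ : 0 < δ)
    (hgood : ∀ y, dist y w < 2 * δ → |downRate y e - downRate w e| ≤ ε)
    {s t : ℝ} (hs : 0 ≤ s) (hst : s ≤ t) (hnear : ∀ u ∈ Icc s t, dist (z u) w < δ) :
    |d t - d s - (t - s) * downRate w e| ≤ (t - s) * ε := by
  refine le_of_forall_pos_le_add fun η hη => ?_
  have hdiff := (((hd t (hs.trans hst)).sub (hd s hs)).sub_const ((t - s) * downRate w e)).abs
  refine le_of_tendsto hdiff ?_
  filter_upwards [eventually_dist_scaled_lt hz hδ hs hnear,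
    H.eventually_dep e t (ε := η / 2) (by positivity)] with n h1 h2
  have h3 := abs_lt.1 (h2 s ⟨hs, hst⟩)
  have h4 := abs_lt.1 (h2 t ⟨hs.trans hst, le_rfl⟩)
  have h5 := (H.traj n).depClock_sub_mem (lo := downRate w e - ε) (hi := downRate w e + ε) hs hst
    (C.r (φ n)) e fun u hu => by
      have := abs_le.1 (hgood _ (h1 u hu))
      exact ⟨by linarith, by linarith⟩
  have h6 := h5.1
  have h7 := h5.2
  rw [abs_le]
  constructor <;> nlinarith

theorem hasDerivWithinAt_Ici_of_forall_abs_sub_le {f : ℝ → ℝ} {q s : ℝ}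
    (h : ∀ ε, 0 < ε → ∃ τ, s < τ ∧ ∀ t ∈ Icc s τ, |f t - f s - (t - s) * q| ≤ (t - s) * ε) :
    HasDerivWithinAt f q (Ici s) s := by
  rw [hasDerivWithinAt_iff_isLittleO, Asymptotics.isLittleO_iff]
  intro ε hε
  obtain ⟨τ, hτ, hτ'⟩ := h ε hε
  filter_upwards [Icc_mem_nhdsGE hτ] with t ht
  rw [Real.norm_eq_abs, Real.norm_eq_abs, abs_of_nonneg (sub_nonneg.2 ht.1), smul_eq_mul,
    mul_comm ε]
  exact hτ' t ht

theorem exists_Icc_forall_dist_lt {z : ℝ → S.Config → ℝ}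
    (hc : ∀ k, ContinuousOn (fun t => z t k) (Ici 0)) {s : ℝ} (hs : 0 ≤ s) {δ : ℝ} (hδ : 0 < δ) :
    ∃ τ, s < τ ∧ ∀ u ∈ Icc s τ, dist (z u) (z s) < δ := by
  have : ContinuousWithinAt z (Ici s) s :=
    continuousWithinAt_pi.2 fun k => ((hc k) s hs).mono (Ici_subset_Ici.2 hs)
  obtain ⟨τ, hτ, h⟩ := (mem_nhdsGE_iff_exists_Icc_subset).1
    ((Metric.tendsto_nhds.1 this) δ hδ)
  exact ⟨τ, hτ, fun u hu => h hu⟩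

theorem exists_good_radius_arr (C : S.Scaling) {e : S.Edge} {w : S.Config → ℝ}
    (hav : 0 < fluidAvail (S.ctype e) w) {ε : ℝ} (hε : 0 < ε) :
    ∃ δ, 0 < δ ∧ ∀ y, dist y w < 2 * δ → 0 < fluidAvail (S.ctype e) y ∧
      |lowFrac C e y - lowFrac C e w| ≤ ε ∧ |highFrac C e y - highFrac C e w| ≤ ε := by
  have h1 := (continuousAt_fluidAvail (S.ctype e) w).tendsto.eventually_const_lt hav
  have h2 := (Metric.tendsto_nhds.1 (continuousAt_lowFrac (C := C) hav).tendsto) ε hε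
  have h3 := (Metric.tendsto_nhds.1 (continuousAt_highFrac (C := C) hav).tendsto) ε hε
  obtain ⟨δ, hδ, h⟩ := Metric.eventually_nhds_iff.1 (h1.and (h2.and h3))
  refine ⟨δ / 2, by positivity, fun y hy => ?_⟩
  obtain ⟨g1, g2, g3⟩ := h (y := y) (by linarith)
  exact ⟨g1, g2.le, g3.le⟩

theorem exists_good_radius_dep {e : S.Edge} {w : S.Config → ℝ} {ε : ℝ} (hε : 0 < ε) :
    ∃ δ, 0 < δ ∧ ∀ y, dist y w < 2 * δ → |downRate y e - downRate w e| ≤ ε := by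
  obtain ⟨δ, hδ, h⟩ := Metric.eventually_nhds_iff.1
    ((Metric.tendsto_nhds.1 ((continuous_downRate e).tendsto w)) ε hε)
  exact ⟨δ / 2, by positivity, fun y hy => (h (y := y) (by linarith)).le⟩

/-- The fluid limit `(z, a, d)` of a family of trajectories along a filter. -/
structure IsFluidLimit (C : S.Scaling) (ω : S.Driving) (ℓ : Filter ℕ) (φ : ℕ → ℕ)
    (X : ℕ → ℝ → S.Config → ℕ) (A D : ℕ → ℝ → S.Edge → ℕ) (z : ℝ → S.Config → ℝ)
    (a d : ℝ → S.Edge → ℝ) : Prop extends IsPrelimit C ω ℓ φ X A D where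
  cont : ∀ k, ContinuousOn (fun t => z t k) (Ici 0)
  state : ∀ b k, TendstoUniformlyOn (fun n t => scaled (C.r (φ n)) (X n t) k) (fun t => z t k) ℓ
    (Icc 0 b)
  arr : ∀ e t, 0 ≤ t → Tendsto (fun n => (A n t e : ℝ) / C.r (φ n)) ℓ (𝓝 (a t e))
  dep : ∀ e t, 0 ≤ t → Tendsto (fun n => (D n t e : ℝ) / C.r (φ n)) ℓ (𝓝 (d t e))

variable {z : ℝ → S.Config → ℝ} {a d : ℝ → S.Edge → ℝ}

theorem IsFluidLimit.tendsto_state (H : IsFluidLimit C ω ℓ φ X A D z a d) (k : S.Config) {t : ℝ}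
    (ht : 0 ≤ t) : Tendsto (fun n => scaled (C.r (φ n)) (X n t) k) ℓ (𝓝 (z t k)) :=
  (H.state t k).tendsto_at ⟨ht, le_rfl⟩

theorem IsFluidLimit.nonneg [NeBot ℓ] (H : IsFluidLimit C ω ℓ φ X A D z a d) {t : ℝ} (ht : 0 ≤ t)
    (k : S.Config) : 0 ≤ z t k :=
  ge_of_tendsto (H.tendsto_state k ht) (Eventually.of_forall fun _ => scaled_nonneg (C.r_pos _) _ _)

theorem IsFluidLimit.sum_pool [NeBot ℓ] (H : IsFluidLimit C ω ℓ φ X A D z a d) {t : ℝ} (ht : 0 ≤ t)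
    (s : σ) : ∑ k : S.Config with k.1 = s, z t k = S.h s := by
  refine tendsto_nhds_unique (tendsto_finsetSum _ fun k _ => H.tendsto_state k ht) ?_
  refine ((C.H_tendsto s).comp H.tendsto).congr fun n => ?_
  simp only [scaled, Function.comp_apply]
  rw [← Finset.sum_div, (H.traj n).sum_pool ht]

theorem IsFluidLimit.balance [NeBot ℓ] (H : IsFluidLimit C ω ℓ φ X A D z a d) {t : ℝ} (ht : 0 ≤ t)
    (k : S.Config) : z t k = z 0 k + net (fun e => a t e - d t e) k := by
  refine tendsto_nhds_unique (H.tendsto_state k ht) ?_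
  have h1 : ∀ e, Tendsto (fun n => (A n t e : ℝ) / C.r (φ n) - (D n t e : ℝ) / C.r (φ n)) ℓ
      (𝓝 (a t e - d t e)) := fun e => (H.arr e t ht).sub (H.dep e t ht)
  refine ((H.tendsto_state k le_rfl).add ((tendsto_finsetSum _ fun e _ => h1 e).sub
    (tendsto_finsetSum _ fun e _ => h1 e))).congr fun n => ?_
  simp only [scaled]
  rw [(H.traj n).balance_net ht k, net, add_div, sub_div, Finset.sum_div, Finset.sum_div]
  simp only [sub_div]

theorem IsFluidLimit.arr_zero [NeBot ℓ] (H : IsFluidLimit C ω ℓ φ X A D z a d) (e : S.Edge) :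
    a 0 e = 0 := by
  refine tendsto_nhds_unique (H.arr e 0 le_rfl) ?_
  simp [(H.traj _).arr_zero]

theorem IsFluidLimit.dep_zero [NeBot ℓ] (H : IsFluidLimit C ω ℓ φ X A D z a d) (e : S.Edge) :
    d 0 e = 0 := by
  refine tendsto_nhds_unique (H.dep e 0 le_rfl) ?_
  simp [(H.traj _).dep_zero]

theorem IsFluidLimit.hasDeriv_arr [NeBot ℓ] (H : IsFluidLimit C ω ℓ φ X A D z a d) {e : S.Edge}
    {s : ℝ} (hs : 0 ≤ s) (hav : 0 < fluidAvail (S.ctype e) (z s)) :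
    HasDerivWithinAt (fun t => a t e) (upRate (z s) e) (Ici s) s := by
  refine hasDerivWithinAt_Ici_of_forall_abs_sub_le fun ε hε => ?_
  have hlam := S.lam_pos (S.ctype e)
  have hε' : 0 < ε / (2 * S.lam (S.ctype e)) := by positivity
  obtain ⟨δ, hδ, hgood⟩ := exists_good_radius_arr C hav hε'
  obtain ⟨τ, hτ, hnear⟩ := exists_Icc_forall_dist_lt H.cont hs hδ
  refine ⟨τ, hτ, fun t ht => ?_⟩
  have := H.abs_arr_sub_le H.state (H.arr e) (H.nonneg hs) hav hε' hδ hgood hs ht.1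
    fun u hu => hnear u ⟨hu.1, hu.2.trans ht.2⟩
  have h2 : S.lam (S.ctype e) * (2 * (ε / (2 * S.lam (S.ctype e)))) = ε := by field_simp
  rwa [h2] at this

theorem IsFluidLimit.hasDeriv_dep [NeBot ℓ] (H : IsFluidLimit C ω ℓ φ X A D z a d) (e : S.Edge)
    {s : ℝ} (hs : 0 ≤ s) :
    HasDerivWithinAt (fun t => d t e) (downRate (z s) e) (Ici s) s := by
  refine hasDerivWithinAt_Ici_of_forall_abs_sub_le fun ε hε => ?_
  obtain ⟨δ, hδ, hgood⟩ := exists_good_radius_dep (e := e) (w := z s) hε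
  obtain ⟨τ, hτ, hnear⟩ := exists_Icc_forall_dist_lt H.cont hs hδ
  refine ⟨τ, hτ, fun t ht => ?_⟩
  exact H.abs_dep_sub_le H.state (H.dep e) hδ hgood hs ht.1
    fun u hu => hnear u ⟨hu.1, hu.2.trans ht.2⟩

theorem IsFluidLimit.hasDeriv_state [NeBot ℓ] (H : IsFluidLimit C ω ℓ φ X A D z a d) {s : ℝ}
    (hs : 0 ≤ s) (hav : ∀ i, 0 < fluidAvail i (z s)) (k : S.Config) :
    HasDerivWithinAt (fun t => z t k) (net (flow (z s)) k) (Ici s) s := by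
  have h1 : ∀ e, HasDerivWithinAt (fun t => a t e - d t e) (flow (z s) e) (Ici s) s := fun e =>
    (H.hasDeriv_arr hs (hav _)).sub (H.hasDeriv_dep e hs)
  have h2 : HasDerivWithinAt (fun t => z 0 k + net (fun e => a t e - d t e) k)
      (net (flow (z s)) k) (Ici s) s :=
    ((HasDerivWithinAt.fun_sum fun e _ => h1 e).sub
      (HasDerivWithinAt.fun_sum fun e _ => h1 e)).const_add _
  exact h2.congr (fun t ht => H.balance (hs.trans ht) k) (H.balance hs k)

/-- A Lipschitz function with constant right derivative is linear. -/
theorem eq_mul_of_hasDerivWithinAt {f : ℝ → ℝ} {q : ℝ}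
    (hL : ∃ L, 0 ≤ L ∧ ∀ s, 0 ≤ s → ∀ t, 0 ≤ t → |f t - f s| ≤ L * |t - s|) (h0 : f 0 = 0)
    (hd : ∀ s, 0 ≤ s → HasDerivWithinAt f q (Ici s) s) {t : ℝ} (ht : 0 ≤ t) : f t = q * t := by
  obtain ⟨L, hL, hlip⟩ := hL
  have hcont : ContinuousOn f (Icc 0 t) := by
    have : LipschitzOnWith L.toNNReal f (Icc 0 t) :=
      LipschitzOnWith.of_dist_le_mul fun x hx y hy => by
        rw [Real.dist_eq, Real.dist_eq, Real.coe_toNNReal _ hL]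
        exact hlip y hy.1 x hx.1
    exact this.continuousOn
  have hd' : ∀ s ∈ Ico 0 t, HasDerivWithinAt (fun t => f t - q * t) 0 (Ici s) s := fun s hs =>
    HasDerivWithinAt.congr_deriv
      ((hd s hs.1).sub (((hasDerivAt_id s).const_mul q).hasDerivWithinAt)) (by simp)
  have := constant_of_has_deriv_right_zero (f := fun t => f t - q * t) (hcont.sub (by fun_prop))
    hd' t ⟨ht, le_rfl⟩
  simp only [h0, mul_zero, sub_zero] at this
  linarith

/-- When the state is constant, arrivals and departures accumulate linearly. -/
theorem IsFluidLimit.arr_eq_of_const [NeBot ℓ] (H : IsFluidLimit C ω ℓ φ X A D z a d)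
    (hconst : ∀ t, 0 ≤ t → z t = z 0) {e : S.Edge} (hav : 0 < fluidAvail (S.ctype e) (z 0)) {t : ℝ}
    (ht : 0 ≤ t) : a t e = upRate (z 0) e * t := by
  refine eq_mul_of_hasDerivWithinAt (f := fun t => a t e)
    ((H.asympLipschitz_arr e).exists_lipschitz (H.arr e)) (H.arr_zero e) (fun s hs => ?_) ht
  have h1 := H.hasDeriv_arr (e := e) hs (by rwa [hconst s hs])
  rwa [hconst s hs] at h1

theorem IsFluidLimit.dep_eq_of_const [NeBot ℓ] (H : IsFluidLimit C ω ℓ φ X A D z a d)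
    (hconst : ∀ t, 0 ≤ t → z t = z 0) (e : S.Edge) {t : ℝ}
    (ht : 0 ≤ t) : d t e = downRate (z 0) e * t := by
  refine eq_mul_of_hasDerivWithinAt (f := fun t => d t e)
    ((H.asympLipschitz_dep e).exists_lipschitz (H.dep e)) (H.dep_zero e) (fun s hs => ?_) ht
  have h1 := H.hasDeriv_dep e hs
  rwa [hconst s hs] at h1

theorem IsFluidLimit.isFluidSolution [NeBot ℓ] (H : IsFluidLimit C ω ℓ φ X A D z a d) :
    IsFluidSolution (fun t => toState (z t)) where
  continuousOn := continuous_toState.comp_continuousOn (continuousOn_pi.2 H.cont)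
  hasDeriv t ht hav k := by
    have hbar : ∀ u, 0 ≤ u → S.bar (toState (z u)) = z u := fun u hu =>
      bar_toState (H.sum_pool hu)
    simp only [hbar t ht] at hav ⊢
    exact (H.hasDeriv_state ht hav k).congr (fun u hu => by simp only [hbar u (ht.trans hu)])
      (by simp only [hbar t ht])

end Prelimit

/-! ### A realization of the primitives -/

/-- Over a countable subfield of `ℝ`, linearly independent families of reals can be placed in
prescribed intervals. -/
theorem exists_linearIndependent_mem_Ioo {J : Type*} [Countable J] (K : Subfield ℝ) [Countable K]
    (lo : J → ℝ) (hlo : ∀ j, 0 ≤ lo j) :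
    ∃ T : J → ℝ, LinearIndependent K T ∧ ∀ j, T j ∈ Ioo (lo j) (lo j + 1) := by
  let b := Module.Basis.ofVectorSpace K ℝ
  have hI : Infinite (Module.Basis.ofVectorSpaceIndex K ℝ) := by
    by_contra hfin
    rw [not_infinite_iff_finite] at hfin
    have hc : Countable (Module.Basis.ofVectorSpaceIndex K ℝ →₀ K) := inferInstance
    have : Countable ℝ := b.repr.toEquiv.countable_iff.2 hc
    exact not_countable (α := ℝ) this
  obtain ⟨f, hf⟩ := exists_injective_nat J
  let g : J → Module.Basis.ofVectorSpaceIndex K ℝ := fun j => Infinite.natEmbedding _ (f j)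
  have hg : Function.Injective g := (Infinite.natEmbedding _).injective.comp hf
  have hq : ∀ j, ∃ q : ℚ, (q : ℝ) * b (g j) ∈ Ioo (lo j) (lo j + 1) := by
    intro j
    rcases lt_or_gt_of_ne (b.ne_zero (g j)) with h | h
    · obtain ⟨q, h1, h2⟩ := exists_rat_btwn
        (show (lo j + 1) / b (g j) < lo j / b (g j) from
          (div_lt_div_right_of_neg h).2 (lt_add_one _))
      exact ⟨q, (lt_div_iff_of_neg h).1 h2, (div_lt_iff_of_neg h).1 h1⟩
    · obtain ⟨q, h1, h2⟩ := exists_rat_btwn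
        (show lo j / b (g j) < (lo j + 1) / b (g j) from
          (div_lt_div_iff_of_pos_right h).2 (lt_add_one _))
      exact ⟨q, (div_lt_iff₀ h).1 h1, (lt_div_iff₀ h).1 h2⟩
  choose q hq using hq
  have hq0 : ∀ j, (q j : K) ≠ 0 := by
    intro j h0
    have h1 : q j = 0 := by exact_mod_cast h0
    have h2 := (hq j).1
    rw [h1, Rat.cast_zero, zero_mul] at h2
    exact absurd h2 (not_lt.2 (hlo j))
  have hli := (b.linearIndependent.comp g hg).units_smul fun j => Units.mk0 (q j : K) (hq0 j)
  refine ⟨_, hli, fun j => ?_⟩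
  have : ((fun j => Units.mk0 (q j : K) (hq0 j)) • (b ∘ g)) j = (q j : ℝ) * b (g j) := by
    simp [Pi.smul_apply', Units.smul_def, Subfield.smul_def]
  rw [this]
  exact hq j

theorem isEpochs_of_mem_Ioo {T : ℕ → ℝ} (h : ∀ m : ℕ, T m ∈ Ioo (m : ℝ) (m + 1)) : IsEpochs T := by
  refine ⟨by simpa using (h 0).1, strictMono_nat_of_lt_succ fun m => ?_, ?_⟩
  · have h1 := (h m).2
    have h2 := (h (m + 1)).1
    push_cast at h2
    linarith
  · exact tendsto_atTop_mono (fun m => (h m).1.le) tendsto_natCast_atTop_atTop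

theorem abs_counting_sub_le {T : ℕ → ℝ} (h : ∀ m : ℕ, T m ∈ Ioo (m : ℝ) (m + 1)) {y : ℝ}
    (hy : 0 ≤ y) :
    |(counting T y : ℝ) - y| ≤ 1 := by
  have hT := isEpochs_of_mem_Ioo h
  have h1 : y < T (counting T y) := by
    by_contra hc
    exact lt_irrefl _ (hT.lt_counting_iff.2 (not_lt.1 hc))
  have h2 := (h (counting T y)).2
  rw [abs_le]
  refine ⟨by linarith, ?_⟩
  rcases Nat.eq_zero_or_pos (counting T y) with h0 | h0
  · rw [h0, Nat.cast_zero]; linarith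
  · have h3 := hT.lt_counting_iff.1 (Nat.sub_lt h0 one_pos)
    have h4 := (h (counting T y - 1)).1
    rw [Nat.cast_sub h0] at h4
    push_cast at h4
    linarith

theorem countingFSLLN_of_mem_Ioo {r : ℕ → ℝ} (hr0 : ∀ n, 0 < r n) (hr : Tendsto r atTop atTop)
    {T : ℕ → ℝ} (h : ∀ m : ℕ, T m ∈ Ioo (m : ℝ) (m + 1)) : CountingFSLLN r T := by
  intro b
  rw [Metric.tendstoUniformlyOn_iff]
  intro ε hε
  filter_upwards [hr.eventually_gt_atTop (1 / ε)] with n hn t ht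
  have hrn := hr0 n
  have h1 := abs_counting_sub_le h (mul_nonneg hrn.le ht.1)
  rw [dist_comm, Real.dist_eq]
  have h2 : (counting T (r n * t) : ℝ) / r n - t = (counting T (r n * t) - r n * t) / r n := by
    field_simp
  rw [h2, abs_div, abs_of_pos hrn, div_lt_iff₀ hrn]
  rw [div_lt_iff₀ hε] at hn
  linarith

/-- A uniformly distributed sequence of marks: for each `s`, the marks with indices in
`[s², (s + 1)²)` are the multiples of `1 / (2 s + 1)` in `(0, 1]`. -/
def blockMark (m : ℕ) : ℝ := ((m - Nat.sqrt m ^ 2 : ℕ) + 1 : ℝ) / (2 * Nat.sqrt m + 1)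

theorem blockMark_sq_add {s j : ℕ} (hj : j ≤ s + s) :
    blockMark (s ^ 2 + j) = ((j : ℝ) + 1) / (2 * s + 1) := by
  rw [blockMark, Nat.sqrt_add_eq' s hj, Nat.add_sub_cancel_left]

theorem blockMark_mem (m : ℕ) : blockMark m ∈ Ioc (0 : ℝ) 1 := by
  have h1 : m = Nat.sqrt m ^ 2 + (m - Nat.sqrt m ^ 2) :=
    (Nat.add_sub_of_le (Nat.sqrt_le' m)).symm
  have h2 : m - Nat.sqrt m ^ 2 ≤ Nat.sqrt m + Nat.sqrt m := by
    have := Nat.lt_succ_sqrt' m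
    rw [Nat.succ_eq_add_one] at this
    have h3 : (Nat.sqrt m + 1) ^ 2 = Nat.sqrt m ^ 2 + 2 * Nat.sqrt m + 1 := by ring
    omega
  have h3 : ((m - Nat.sqrt m ^ 2 : ℕ) : ℝ) ≤ Nat.sqrt m + Nat.sqrt m := by exact_mod_cast h2
  rw [blockMark]
  refine ⟨by positivity, (div_le_one (by positivity)).2 ?_⟩
  linarith

theorem markCount_add (ξ : ℕ → ℝ) (N c : ℕ) (ζ : ℝ) : markCount ξ (N + c) ζ
    = markCount ξ N ζ + markCount (fun j => ξ (N + j)) c ζ := by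
  simp only [markCount, Finset.card_filter, Finset.sum_range_add]

theorem markCount_le (ξ : ℕ → ℝ) (N : ℕ) (ζ : ℝ) : markCount ξ N ζ ≤ N :=
  (Finset.card_filter_le _ _).trans_eq (Finset.card_range N)

theorem markCount_block (s : ℕ) {ζ : ℝ} (hζ : ζ ∈ Icc (0 : ℝ) 1) :
    markCount (fun j => blockMark (s ^ 2 + j)) (2 * s + 1) ζ = ⌊(2 * s + 1) * ζ⌋₊ := by
  have hq : (0 : ℝ) < 2 * s + 1 := by positivity
  have h0 : 0 ≤ (2 * s + 1) * ζ := mul_nonneg hq.le hζ.1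
  have hle : ⌊(2 * s + 1) * ζ⌋₊ ≤ 2 * s + 1 := by
    refine Nat.floor_le_of_le ?_
    push_cast
    nlinarith [hζ.2]
  rw [markCount, ← Finset.card_range ⌊(2 * s + 1) * ζ⌋₊]
  congr 1
  ext j
  simp only [Finset.mem_filter, Finset.mem_range]
  constructor
  · rintro ⟨h1, h2⟩
    rw [blockMark_sq_add (by omega), div_le_iff₀ hq, mul_comm ζ] at h2
    exact Nat.le_floor (by push_cast; exact h2)
  · intro h1
    refine ⟨h1.trans_le hle, ?_⟩
    rw [blockMark_sq_add (by omega), div_le_iff₀ hq, mul_comm ζ]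
    have := (Nat.le_floor_iff h0).1 (Nat.succ_le_of_lt h1)
    push_cast at this
    exact this

/-- In the first `s` blocks the count falls short of its mean by at most one per block. -/
theorem markCount_sq_mem (s : ℕ) {ζ : ℝ} (hζ : ζ ∈ Icc (0 : ℝ) 1) :
    (markCount blockMark (s ^ 2) ζ : ℝ) ∈ Icc ((s : ℝ) ^ 2 * ζ - s) ((s : ℝ) ^ 2 * ζ) := by
  induction s with
  | zero => simp [markCount]
  | succ s ih =>
    have h1 : (s + 1) ^ 2 = s ^ 2 + (2 * s + 1) := by ring
    rw [h1, markCount_add, markCount_block s hζ]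
    have h2 := Nat.floor_le (show 0 ≤ (2 * s + 1) * ζ from mul_nonneg (by positivity) hζ.1)
    have h3 := Nat.lt_floor_add_one ((2 * s + 1) * ζ)
    have h4 := ih.1
    have h5 := ih.2
    push_cast
    constructor <;> nlinarith

theorem abs_markCount_sub_le (N : ℕ) {ζ : ℝ} (hζ : ζ ∈ Icc (0 : ℝ) 1) :
    |(markCount blockMark N ζ : ℝ) - N * ζ| ≤ 3 * Nat.sqrt N := by
  set s := Nat.sqrt N with hs
  obtain ⟨c, hc⟩ : ∃ c, N = s ^ 2 + c := ⟨N - s ^ 2, (Nat.add_sub_of_le (Nat.sqrt_le' N)).symm⟩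
  have hcs : c ≤ 2 * s := by
    have := Nat.lt_succ_sqrt' N
    rw [Nat.succ_eq_add_one, ← hs] at this
    have h3 : (s + 1) ^ 2 = s ^ 2 + 2 * s + 1 := by ring
    omega
  have hcs' : (c : ℝ) ≤ 2 * s := by exact_mod_cast hcs
  have h1 := markCount_sq_mem s hζ
  have h2 : (markCount (fun j => blockMark (s ^ 2 + j)) c ζ : ℝ) ≤ c := by
    exact_mod_cast markCount_le _ _ _
  have h3 : (0 : ℝ) ≤ markCount (fun j => blockMark (s ^ 2 + j)) c ζ := Nat.cast_nonneg _
  have h4 : (0 : ℝ) ≤ c := Nat.cast_nonneg _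
  have h5 := h1.1
  have h6 := h1.2
  have h7 := mul_nonneg h4 hζ.1
  have h8 := mul_le_mul_of_nonneg_left hζ.2 h4
  rw [hc, markCount_add]
  push_cast
  rw [abs_le]
  constructor <;> nlinarith

theorem markFSLLN_blockMark {r : ℕ → ℝ} (hr0 : ∀ n, 0 < r n) (hr : Tendsto r atTop atTop) :
    MarkFSLLN r blockMark := by
  intro b
  have hlim : Tendsto (fun n => 3 * (√b / √(r n)) + 1 / r n) atTop (𝓝 0) := by
    have h1 : Tendsto (fun n => √b / √(r n)) atTop (𝓝 0) :=
      (Real.tendsto_sqrt_atTop.comp hr).const_div_atTop _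
    have h2 : Tendsto (fun n => 1 / r n) atTop (𝓝 0) := hr.const_div_atTop _
    simpa using (h1.const_mul 3).add h2
  rw [Metric.tendstoUniformlyOn_iff]
  intro ε hε
  filter_upwards [hlim.eventually_lt_const hε] with n hn p hp
  obtain ⟨hp1, hp2⟩ := hp
  have hrn := hr0 n
  set N := ⌊r n * p.1⌋₊ with hN
  have hfl := Nat.floor_le (mul_nonneg hrn.le hp1.1)
  have hfl' := Nat.lt_floor_add_one (r n * p.1)
  rw [← hN] at hfl hfl'
  have h1 := abs_markCount_sub_le N hp2
  have h2 : (Nat.sqrt N : ℝ) ≤ √b * √(r n) := by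
    refine Real.nat_sqrt_le_real_sqrt.trans ?_
    rw [← Real.sqrt_mul (hp1.1.trans hp1.2)]
    refine Real.sqrt_le_sqrt (hfl.trans ?_)
    rw [mul_comm]
    exact mul_le_mul_of_nonneg_right hp1.2 hrn.le
  have h3 : |(N : ℝ) * p.2 - r n * p.1 * p.2| ≤ 1 := by
    rw [← sub_mul, abs_mul, abs_of_nonneg hp2.1]
    have : |(N : ℝ) - r n * p.1| ≤ 1 := abs_le.2 ⟨by linarith, by linarith⟩
    exact mul_le_one₀ this hp2.1 hp2.2
  rw [dist_comm, Real.dist_eq]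
  change |(markCount blockMark N p.2 : ℝ) / r n - p.1 * p.2| < ε
  have h4 : (markCount blockMark N p.2 : ℝ) / r n - p.1 * p.2
      = ((markCount blockMark N p.2 - N * p.2) + (N * p.2 - r n * p.1 * p.2)) / r n := by
    field_simp
    ring
  rw [h4, abs_div, abs_of_pos hrn]
  refine lt_of_le_of_lt ?_ hn
  have h5 : 3 * (√b / √(r n)) + 1 / r n = (3 * (√b * √(r n)) + 1) / r n := by
    have h6 : √(r n) ≠ 0 := (Real.sqrt_pos.2 hrn).ne'
    have h7 : √(r n) ^ 2 = r n := Real.sq_sqrt hrn.le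
    field_simp
    linear_combination (-3 * √b) * h7
  rw [h5]
  refine div_le_div_of_nonneg_right ((abs_add_le _ _).trans ?_) hrn.le
  linarith

/-- The jump times of the processes which drive arrivals and departures. -/
def Driving.epochs (ω : S.Driving) : ι ⊕ S.Edge → ℕ → ℝ := Sum.elim ω.arr ω.dep

theorem Driving.isEpochs (ω : S.Driving) (p : ι ⊕ S.Edge) : IsEpochs (ω.epochs p) := by
  rcases p with i | e
  · exact ω.arr_epochs i
  · exact ω.dep_epochs e

/-- The jump times of all driving processes are linearly independent over a field which contains
all parameters of the systems. -/
def Driving.IsGeneric (ω : S.Driving) (C : S.Scaling) : Prop :=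
  ∃ K : Subfield ℝ, (∀ i, S.lam i ∈ K) ∧ (∀ i, S.mu i ∈ K) ∧ (∀ n, C.r n ∈ K) ∧
    LinearIndependent K fun q : (ι ⊕ S.Edge) × ℕ => ω.epochs q.1 q.2

/-- There are primitives which satisfy the laws of large numbers and exclude simultaneous events. -/
theorem exists_driving (C : S.Scaling) : ∃ ω : S.Driving, ω.FSLLN C ∧ ω.IsGeneric C := by
  set G : Set ℝ := range S.lam ∪ range S.mu ∪ range C.r with hG
  have hGc : G.Countable :=
    ((countable_range _).union (countable_range _)).union (countable_range _)
  have : Countable (Subfield.closure G) := by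
    rw [← Cardinal.mk_le_aleph0_iff]
    exact (Subfield.cardinalMk_closure_le_max G).trans (max_le hGc.le_aleph0 le_rfl)
  obtain ⟨T, hT, hmem⟩ := exists_linearIndependent_mem_Ioo (J := (ι ⊕ S.Edge) × ℕ)
    (Subfield.closure G) (fun q => (q.2 : ℝ)) (fun q => Nat.cast_nonneg _)
  have hmem' : ∀ p (m : ℕ), T (p, m) ∈ Ioo (m : ℝ) (m + 1) := fun p m => hmem (p, m)
  refine ⟨⟨fun e m => T (Sum.inr e, m), fun e => isEpochs_of_mem_Ioo (hmem' _),
    fun i m => T (Sum.inl i, m), fun i => isEpochs_of_mem_Ioo (hmem' _),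
    fun _ => blockMark, fun _ => blockMark_mem⟩, ⟨?_, ?_, ?_⟩, Subfield.closure G, ?_, ?_, ?_, ?_⟩
  · exact fun e => countingFSLLN_of_mem_Ioo C.r_pos C.r_tendsto (hmem' _)
  · exact fun i => countingFSLLN_of_mem_Ioo C.r_pos C.r_tendsto (hmem' _)
  · exact fun i => markFSLLN_blockMark C.r_pos C.r_tendsto
  · exact fun i => Subfield.subset_closure (Or.inl (Or.inl ⟨i, rfl⟩))
  · exact fun i => Subfield.subset_closure (Or.inl (Or.inr ⟨i, rfl⟩))
  · exact fun n => Subfield.subset_closure (Or.inr ⟨n, rfl⟩)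
  · convert hT using 2 with q
    obtain ⟨p | p, m⟩ := q <;> rfl

/-! ### Jump processes driven by clocks -/

/-- A pure jump process driven by the clocks `p : P`. In state `q` the clock `p` runs at speed
`rate q p`, and when it reaches the epoch `T p m` the state jumps from `q` to `jump q p m`. The
`j`-th jump takes place at time `t (j + 1)`, from `q j` to `q (j + 1)`, and is due to the clock
`p j`; at time `t j` the clock `p` shows `J j p` and has caused `N j p` jumps. -/
structure IsJumpProcess {P Q : Type*} [DecidableEq P] (T : P → ℕ → ℝ) (rate : Q → P → ℝ)
    (jump : Q → P → ℕ → Q) (t : ℕ → ℝ) (q : ℕ → Q) (p : ℕ → P) (N : ℕ → P → ℕ) (J : ℕ → P → ℝ) :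
    Prop where
  time_zero : t 0 = 0
  count_zero : ∀ a, N 0 a = 0
  clock_zero : ∀ a, J 0 a = 0
  time_lt : ∀ j, t j < t (j + 1)
  rate_nonneg : ∀ j a, 0 ≤ rate (q j) a
  rate_pos : ∀ j, 0 < rate (q j) (p j)
  clock_succ : ∀ j a, J (j + 1) a = J j a + (t (j + 1) - t j) * rate (q j) a
  count_succ : ∀ j, N (j + 1) = Function.update (N j) (p j) (N j (p j) + 1)
  state_succ : ∀ j, q (j + 1) = jump (q j) (p j) (N j (p j))
  clock_jump : ∀ j, J (j + 1) (p j) = T (p j) (N j (p j))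
  clock_lt : ∀ j a, J j a < T a (N j a)
  le_clock : ∀ j a m, m < N j a → T a m ≤ J j a

/-- Jumps do not accumulate when the speeds of the clocks are bounded. -/
theorem IsJumpProcess.tendsto_time {P Q : Type*} [Fintype P] [DecidableEq P] {T : P → ℕ → ℝ}
    {rate : Q → P → ℝ} {jump : Q → P → ℕ → Q} {t : ℕ → ℝ} {q : ℕ → Q} {p : ℕ → P} {N : ℕ → P → ℕ}
    {J : ℕ → P → ℝ} (H : IsJumpProcess T rate jump t q p N J) (hT : ∀ a, IsEpochs (T a)) {M : ℝ}
    (hM : ∀ j a, rate (q j) a ≤ M) : Tendsto t atTop atTop := by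
  have hmono : Monotone t := (strictMono_nat_of_lt_succ H.time_lt).monotone
  have hM0 : 0 ≤ M := (H.rate_pos 0).le.trans (hM 0 _)
  have hclock : ∀ j a, J j a ≤ M * t j := by
    intro j a
    induction j with
    | zero => rw [H.clock_zero, H.time_zero, mul_zero]
    | succ j ih =>
      rw [H.clock_succ]
      have := mul_le_mul_of_nonneg_left (hM j a) (sub_nonneg.2 (H.time_lt j).le)
      nlinarith
  have hcount : ∀ j, ∑ a, N j a = j := by
    intro j
    induction j with
    | zero => simp [H.count_zero]
    | succ j ih =>
      rw [H.count_succ, Finset.sum_update_of_mem (Finset.mem_univ _), ← Finset.erase_eq,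
        add_right_comm, Finset.add_sum_erase _ _ (Finset.mem_univ _), ih]
  refine tendsto_atTop_atTop_of_monotone hmono fun B => ?_
  -- otherwise the clocks stay bounded, and can cause only finitely many jumps
  by_contra! hB
  have hle : ∀ j a, N j a ≤ counting (T a) (M * B) := by
    intro j a
    by_contra! hc
    have h1 := H.le_clock j a _ hc
    have h2 : J j a ≤ M * B := (hclock j a).trans (mul_le_mul_of_nonneg_left (hB j).le hM0)
    exact lt_irrefl _ ((hT a).lt_counting_iff.2 (h1.trans h2))
  have h3 := Finset.sum_le_sum (s := Finset.univ)
    fun a _ => hle (∑ a, counting (T a) (M * B) + 1) a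
  rw [hcount] at h3
  omega

/-- Clocks with linearly independent epochs never ring simultaneously, so that they drive a jump
process. -/
theorem exists_isJumpProcess {P Q : Type*} [Fintype P] [DecidableEq P] {T : P → ℕ → ℝ}
    (hT : ∀ a, IsEpochs (T a)) {K : Subfield ℝ}
    (hli : LinearIndependent K fun x : P × ℕ => T x.1 x.2) {rate : Q → P → ℝ}
    (hK : ∀ q a, rate q a ∈ K) (h0 : ∀ q a, 0 ≤ rate q a) (hpos : ∀ q, ∃ a, 0 < rate q a)
    (jump : Q → P → ℕ → Q) (q₀ : Q) :
    ∃ t q p N J, IsJumpProcess T rate jump t q p N J ∧ q 0 = q₀ := by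
  -- a record consists of a time, a state, the clocks and the counts
  let wait : Q × (P → ℝ) × (P → ℕ) → P → ℝ := fun s a => (T a (s.2.2 a) - s.2.1 a) / rate s.1 a
  have hmin : ∀ s : Q × (P → ℝ) × (P → ℕ), ∃ a, 0 < rate s.1 a ∧
      ∀ b, 0 < rate s.1 b → wait s a ≤ wait s b := by
    intro s
    obtain ⟨a₀, ha₀⟩ := hpos s.1
    obtain ⟨a, ha, hmin⟩ := Finset.exists_min_image
      (Finset.univ.filter fun a => 0 < rate s.1 a) (wait s) ⟨a₀, by simpa using ha₀⟩
    exact ⟨a, by simpa using ha, fun b hb => hmin b (by simpa using hb)⟩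
  choose nxt hnpos hnmin using hmin
  let step : Q × (P → ℝ) × (P → ℕ) → Q × (P → ℝ) × (P → ℕ) := fun s =>
    (jump s.1 (nxt s) (s.2.2 (nxt s)), fun a => s.2.1 a + wait s (nxt s) * rate s.1 a,
      Function.update s.2.2 (nxt s) (s.2.2 (nxt s) + 1))
  let st : ℕ → Q × (P → ℝ) × (P → ℕ) := fun j => step^[j] (q₀, fun _ => 0, fun _ => 0)
  have hst : ∀ j, st (j + 1) = step (st j) := fun j => Function.iterate_succ_apply' _ _ _
  let t : ℕ → ℝ := fun j => ∑ l ∈ Finset.range j, wait (st l) (nxt (st l))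
  have ht : ∀ j, t (j + 1) - t j = wait (st j) (nxt (st j)) := fun j => by
    simp only [t, Finset.sum_range_succ, add_sub_cancel_left]
  let v : P × ℕ → ℝ := fun x => T x.1 x.2
  have hmulmem : ∀ (W : Submodule K ℝ) (c y : ℝ), c ∈ K → y ∈ W → c * y ∈ W := fun W c y hc hy =>
    W.smul_mem (⟨c, hc⟩ : K) hy
  -- the clocks stay in the span of the epochs which have been used
  have hspan : ∀ j a, (st j).2.1 a ∈ Submodule.span K (v '' {x | x.2 < (st j).2.2 x.1}) := by
    intro j
    induction j with
    | zero => intro a; exact Submodule.zero_mem _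
    | succ j ih =>
      have hsub : {x : P × ℕ | x.2 < (st j).2.2 x.1} ⊆ {x | x.2 < (st (j + 1)).2.2 x.1} := by
        intro x hx
        rw [hst]
        simp only [step, mem_ofPred_eq] at hx ⊢
        rcases eq_or_ne x.1 (nxt (st j)) with h | h
        · rw [h, Function.update_self]; rw [h] at hx; omega
        · rwa [Function.update_of_ne h]
      have hle : Submodule.span K (v '' {x | x.2 < (st j).2.2 x.1})
          ≤ Submodule.span K (v '' {x | x.2 < (st (j + 1)).2.2 x.1}) :=
        Submodule.span_mono (image_mono hsub)
      have hnew : T (nxt (st j)) ((st j).2.2 (nxt (st j)))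
          ∈ Submodule.span K (v '' {x | x.2 < (st (j + 1)).2.2 x.1}) := by
        refine Submodule.subset_span ⟨(nxt (st j), (st j).2.2 (nxt (st j))), ?_, rfl⟩
        rw [hst]
        simp [step]
      have hwait : wait (st j) (nxt (st j))
          ∈ Submodule.span K (v '' {x | x.2 < (st (j + 1)).2.2 x.1}) := by
        have h1 := hmulmem _ _ _ (K.inv_mem (hK (st j).1 (nxt (st j))))
          (Submodule.sub_mem _ hnew (hle (ih (nxt (st j)))))
        simpa only [wait, div_eq_inv_mul] using h1
      intro a
      have h2 : (st (j + 1)).2.1 a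
          = (st j).2.1 a + rate (st j).1 a * wait (st j) (nxt (st j)) := by
        rw [hst, mul_comm]
      rw [h2]
      exact Submodule.add_mem _ (hle (ih a)) (hmulmem _ _ _ (hK _ _) hwait)
  -- two clocks do not ring at the same time
  have huniq : ∀ j a, a ≠ nxt (st j) → 0 < rate (st j).1 a →
      wait (st j) (nxt (st j)) < wait (st j) a := by
    intro j a hne ha
    refine lt_of_le_of_ne (hnmin _ a ha) fun heq => ?_
    set b := nxt (st j) with hb
    have hbpos : 0 < rate (st j).1 b := hnpos _
    refine hli.notMem_span_image (x := (a, (st j).2.2 a))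
      (s := {x | x.2 < (st j).2.2 x.1} ∪ {(b, (st j).2.2 b)}) ?_ ?_
    · rintro (h | h)
      · exact lt_irrefl ((st j).2.2 a) h
      · exact hne (congrArg Prod.fst h)
    · have hle : Submodule.span K (v '' {x | x.2 < (st j).2.2 x.1}) ≤ Submodule.span K
          (v '' ({x | x.2 < (st j).2.2 x.1} ∪ {(b, (st j).2.2 b)})) :=
        Submodule.span_mono (image_mono subset_union_left)
      have hnew : T b ((st j).2.2 b) ∈ Submodule.span K
          (v '' ({x | x.2 < (st j).2.2 x.1} ∪ {(b, (st j).2.2 b)})) :=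
        Submodule.subset_span ⟨(b, (st j).2.2 b), Or.inr rfl, rfl⟩
      have h1 : T a ((st j).2.2 a) = (st j).2.1 a + rate (st j).1 a * ((rate (st j).1 b)⁻¹
          * (T b ((st j).2.2 b) - (st j).2.1 b)) := by
        have h2 : wait (st j) b = (rate (st j).1 b)⁻¹ * (T b ((st j).2.2 b) - (st j).2.1 b) := by
          simp only [wait, div_eq_inv_mul]
        rw [← h2, heq]
        simp only [wait]
        rw [mul_div_cancel₀ _ ha.ne']
        ring
      change T a ((st j).2.2 a) ∈ _
      rw [h1]
      exact Submodule.add_mem _ (hle (hspan j a)) (hmulmem _ _ _ (hK _ _)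
        (hmulmem _ _ _ (K.inv_mem (hK _ _)) (Submodule.sub_mem _ hnew (hle (hspan j b)))))
  have hjump : ∀ j, (st (j + 1)).2.1 (nxt (st j))
      = T (nxt (st j)) ((st j).2.2 (nxt (st j))) := by
    intro j
    rw [hst]
    simp only [step, wait]
    rw [div_mul_cancel₀ _ (hnpos _).ne']
    ring
  have hlt : ∀ j a, (st j).2.1 a < T a ((st j).2.2 a) := by
    intro j
    induction j with
    | zero => intro a; exact (hT a).1
    | succ j ih =>
      intro a
      rcases eq_or_ne a (nxt (st j)) with rfl | hne
      · rw [hjump, hst]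
        simp only [step, Function.update_self]
        exact (hT _).2.1 (Nat.lt_succ_self _)
      · rw [hst]
        simp only [step, Function.update_of_ne hne]
        rcases (h0 (st j).1 a).eq_or_lt with hz | hz
        · rw [← hz, mul_zero, add_zero]; exact ih a
        · have h1 := huniq j a hne hz
          have h2 : wait (st j) a * rate (st j).1 a = T a ((st j).2.2 a) - (st j).2.1 a :=
            div_mul_cancel₀ _ hz.ne'
          have h3 := mul_lt_mul_of_pos_right h1 hz
          linarith
  have hwpos : ∀ j, 0 < wait (st j) (nxt (st j)) := fun j =>
    div_pos (sub_pos.2 (hlt j _)) (hnpos _)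
  refine ⟨t, fun j => (st j).1, fun j => nxt (st j), fun j => (st j).2.2, fun j => (st j).2.1,
    ⟨rfl, fun _ => rfl, fun _ => rfl, ?_, fun j a => h0 _ _, fun j => hnpos _, ?_, ?_, ?_, hjump,
      hlt, ?_⟩, rfl⟩
  · intro j
    have := hwpos j
    rw [← ht] at this
    linarith
  · intro j a
    rw [ht, hst]
  · intro j
    rw [hst]
  · intro j
    rw [hst]
  · intro j
    induction j with
    | zero => intro a m hm; exact absurd hm (Nat.not_lt_zero _)
    | succ j ih =>
      intro a m hm
      have hmono : (st j).2.1 a ≤ (st (j + 1)).2.1 a := by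
        rw [hst]
        exact le_add_of_nonneg_right (mul_nonneg (hwpos j).le (h0 _ _))
      rcases eq_or_ne a (nxt (st j)) with rfl | hne
      · simp only [hst j, step, Function.update_self] at hm
        rcases Nat.lt_succ_iff_lt_or_eq.1 hm with h | rfl
        · exact (ih _ m h).trans hmono
        · exact (hjump j).ge
      · simp only [hst j, step, Function.update_of_ne hne] at hm
        exact (ih a m hm).trans hmono

/-! ### The jump process as a function of time -/

/-- The index `j` with `t j ≤ u < t (j + 1)`, for strictly increasing `t` and `u ≥ t 0`. -/
def stepIndex (t : ℕ → ℝ) (u : ℝ) : ℕ := sInf {j | u < t (j + 1)}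

theorem stepIndex_eq {t : ℕ → ℝ} (ht : StrictMono t) {u : ℝ} {j : ℕ}
    (hu : u ∈ Ico (t j) (t (j + 1))) : stepIndex t u = j := by
  refine le_antisymm (Nat.sInf_le hu.2) ?_
  by_contra! hc
  have h1 : u < t (stepIndex t u + 1) := Nat.sInf_mem (s := {j | u < t (j + 1)}) ⟨j, hu.2⟩
  have h2 := ht.monotone (Nat.succ_le_of_lt hc)
  exact absurd hu.1 (not_le.2 (h1.trans_le h2))

theorem exists_mem_Ico {t : ℕ → ℝ} (h0 : t 0 = 0) (hlim : Tendsto t atTop atTop) {u : ℝ}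
    (hu : 0 ≤ u) : ∃ j, u ∈ Ico (t j) (t (j + 1)) := by
  classical
  have hex : ∃ j, u < t j := (hlim.eventually_gt_atTop u).exists
  obtain ⟨j, hj⟩ : ∃ j, Nat.find hex = j + 1 := by
    refine Nat.exists_eq_succ_of_ne_zero fun h => ?_
    have := Nat.find_spec hex
    rw [h, h0] at this
    linarith
  refine ⟨j, not_lt.1 (Nat.find_min hex (by omega)), ?_⟩
  have := Nat.find_spec hex
  rwa [hj] at this

theorem exists_mem_Ioc {t : ℕ → ℝ} (h0 : t 0 = 0) (hlim : Tendsto t atTop atTop) {u : ℝ}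
    (hu : 0 < u) : ∃ j, u ∈ Ioc (t j) (t (j + 1)) := by
  classical
  have hex : ∃ j, u ≤ t j := (hlim.eventually_ge_atTop u).exists
  obtain ⟨j, hj⟩ : ∃ j, Nat.find hex = j + 1 := by
    refine Nat.exists_eq_succ_of_ne_zero fun h => ?_
    have := Nat.find_spec hex
    rw [h, h0] at this
    linarith
  refine ⟨j, not_le.1 (Nat.find_min hex (by omega)), ?_⟩
  have := Nat.find_spec hex
  rwa [hj] at this

namespace IsJumpProcess

variable {P Q : Type*} [DecidableEq P] {T : P → ℕ → ℝ} {rate : Q → P → ℝ} {jump : Q → P → ℕ → Q}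
  {t : ℕ → ℝ} {q : ℕ → Q} {p : ℕ → P} {N : ℕ → P → ℕ} {J : ℕ → P → ℝ}

theorem strictMono_time (H : IsJumpProcess T rate jump t q p N J) : StrictMono t :=
  strictMono_nat_of_lt_succ H.time_lt

theorem integral_rate_piece (H : IsJumpProcess T rate jump t q p N J) (a : P) {j : ℕ} {u : ℝ}
    (hu : u ∈ Icc (t j) (t (j + 1))) :
    IntervalIntegrable (fun v => rate (q (stepIndex t v)) a) MeasureTheory.volume (t j) u ∧
      ∫ v in t j..u, rate (q (stepIndex t v)) a = (u - t j) * rate (q j) a := by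
  have hae : ∀ᵐ v ∂MeasureTheory.volume, v ∈ Set.uIoc (t j) u →
      rate (q (stepIndex t v)) a = rate (q j) a := by
    have hne : ∀ᵐ v ∂(MeasureTheory.volume : MeasureTheory.Measure ℝ), v ≠ t (j + 1) := by
      simp [MeasureTheory.ae_iff]
    filter_upwards [hne] with v hv hmem
    rw [uIoc_of_le hu.1] at hmem
    rw [stepIndex_eq H.strictMono_time
      ⟨hmem.1.le, lt_of_le_of_ne (hmem.2.trans hu.2) hv⟩]
  constructor
  · refine (intervalIntegrable_const (c := rate (q j) a)).congr_ae ?_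
    rw [Filter.EventuallyEq, MeasureTheory.ae_restrict_iff' measurableSet_uIoc]
    filter_upwards [hae] with v hv hm
    exact (hv hm).symm
  · rw [intervalIntegral.integral_congr_ae hae, intervalIntegral.integral_const, smul_eq_mul]

theorem integral_rate_time (H : IsJumpProcess T rate jump t q p N J) (a : P) (j : ℕ) :
    IntervalIntegrable (fun v => rate (q (stepIndex t v)) a) MeasureTheory.volume 0 (t j) ∧
      ∫ v in (0 : ℝ)..t j, rate (q (stepIndex t v)) a = J j a := by
  induction j with
  | zero => rw [H.time_zero, H.clock_zero]; simp
  | succ j ih =>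
    have h1 := H.integral_rate_piece a (j := j) ⟨(H.time_lt j).le, le_rfl⟩
    refine ⟨ih.1.trans h1.1, ?_⟩
    rw [← intervalIntegral.integral_add_adjacent_intervals ih.1 h1.1, ih.2, h1.2, H.clock_succ]

/-- The clocks show the integrals of their speeds. -/
theorem integral_rate (H : IsJumpProcess T rate jump t q p N J) (a : P) {j : ℕ} {u : ℝ}
    (hu : u ∈ Icc (t j) (t (j + 1))) :
    ∫ v in (0 : ℝ)..u, rate (q (stepIndex t v)) a = J j a + (u - t j) * rate (q j) a := by
  have h1 := H.integral_rate_piece a hu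
  have h2 := H.integral_rate_time a j
  rw [← intervalIntegral.integral_add_adjacent_intervals h2.1 h1.1, h2.2, h1.2]

/-- Between jumps the count of a clock agrees with the counting process of its epochs at the time
which the clock shows. -/
theorem count_eq_counting (H : IsJumpProcess T rate jump t q p N J) (hT : ∀ a, IsEpochs (T a))
    (a : P) {j : ℕ} {u : ℝ} (hu : u ∈ Ico (t j) (t (j + 1))) :
    N j a = counting (T a) (J j a + (u - t j) * rate (q j) a) := by
  have hr := H.rate_nonneg j a
  have hlt : J j a + (u - t j) * rate (q j) a < T a (N j a) := by
    have h1 : (u - t j) * rate (q j) a ≤ (t (j + 1) - t j) * rate (q j) a :=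
      mul_le_mul_of_nonneg_right (by linarith [hu.2]) hr
    rcases eq_or_ne a (p j) with rfl | hne
    · have h2 := mul_lt_mul_of_pos_right (sub_lt_sub_right hu.2 (t j)) (H.rate_pos j)
      have h3 := H.clock_succ j (p j)
      rw [H.clock_jump] at h3
      linarith
    · have h2 := H.clock_lt (j + 1) a
      rw [H.clock_succ, H.count_succ, Function.update_of_ne hne] at h2
      linarith
  refine eq_of_forall_lt_iff fun m => ?_
  rw [(hT a).lt_counting_iff]
  constructor
  · intro hm
    have := mul_nonneg (sub_nonneg.2 hu.1) hr
    linarith [H.le_clock j a m hm]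
  · intro hm
    by_contra! hc
    have := (hT a).2.1.monotone hc
    linarith

theorem exists_jump_of_lt_count (H : IsJumpProcess T rate jump t q p N J) {a : P} {m j : ℕ}
    (h : m < N j a) : ∃ l, p l = a ∧ N l a = m := by
  induction j with
  | zero => rw [H.count_zero] at h; exact absurd h (Nat.not_lt_zero _)
  | succ j ih =>
    by_cases hm : m < N j a
    · exact ih hm
    · rw [H.count_succ] at h
      rcases eq_or_ne a (p j) with rfl | hne
      · rw [Function.update_self] at h
        exact ⟨j, rfl, by omega⟩
      · rw [Function.update_of_ne hne] at h
        exact absurd h hm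

end IsJumpProcess


/-! ### Existence of trajectories -/

/-- The state after one server has moved from configuration `k` to configuration `l`; meaningful
only if `X k` is positive, since the subtraction is truncated. -/
def moveServer (k l : S.Config) (X : S.Config → ℕ) (c : S.Config) : ℕ :=
  X c - (if k = c then 1 else 0) + if l = c then 1 else 0

theorem moveServer_cast {k l : S.Config} {X : S.Config → ℕ} (hX : 0 < X k) (c : S.Config) :
    (moveServer k l X c : ℤ) = X c - (if k = c then 1 else 0) + if l = c then 1 else 0 := by
  rw [moveServer]
  by_cases h : k = c
  · subst h
    simp only [if_true]
    push_cast [Nat.cast_sub (show 1 ≤ X k from hX)]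
    rfl
  · simp [h]

/-- At most one configuration is selected. -/
theorem Selects.unique {C : S.Scaling} {i : ι} {ξ : ℝ} {X : S.Config → ℕ} {k l : S.Config}
    (hk : Selects C i ξ X k) (hl : Selects C i ξ X l) : k = l := by
  have key : ∀ {k l : S.Config}, Selects C i ξ X k → Selects C i ξ X l →
      ¬ C.rank i k < C.rank i l := by
    intro k l hk hl hlt
    have hle : (∑ k' : S.Config with S.Fits i k' ∧ C.rank i k' < C.rank i k, (X k' : ℝ)) + X k
        ≤ ∑ k' : S.Config with S.Fits i k' ∧ C.rank i k' < C.rank i l, (X k' : ℝ) := by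
      have hk' : k ∉ Finset.univ.filter
          fun k' : S.Config => S.Fits i k' ∧ C.rank i k' < C.rank i k := by simp
      rw [add_comm, ← Finset.sum_insert (f := fun c => (X c : ℝ)) hk']
      refine Finset.sum_le_sum_of_subset_of_nonneg (fun c hc => ?_) fun c _ _ => Nat.cast_nonneg _
      rw [Finset.mem_insert, Finset.mem_filter] at hc
      rw [Finset.mem_filter]
      refine ⟨Finset.mem_univ _, ?_⟩
      rcases hc with rfl | ⟨-, h1, h2⟩
      · exact ⟨hk.1, hlt⟩
      · exact ⟨h1, h2.trans hlt⟩
    linarith [hk.2.2, hl.2.1]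
  exact C.rank_injective i (le_antisymm (not_lt.1 (key hl hk)) (not_lt.1 (key hk hl)))

theorem Selects.pos {C : S.Scaling} {i : ι} {ξ : ℝ} {X : S.Config → ℕ} {k : S.Config}
    (hk : Selects C i ξ X k) : 0 < X k := by
  have h1 := hk.2.1
  have h2 := hk.2.2
  have : (0 : ℝ) < X k := by linarith
  exact_mod_cast this

/-- The speeds of the clocks which drive arrivals and departures. -/
def eventRate (C : S.Scaling) (n : ℕ) (X : S.Config → ℕ) : ι ⊕ S.Edge → ℝ :=
  Sum.elim (fun i => S.lam i * C.r n)
    fun e => (X (S.upper e) : ℝ) * ((S.upper e).2.1 (S.ctype e) : ℝ) * S.mu (S.ctype e)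

open Classical in
/-- The state after the `m`-th arrival of a type, or after the `m`-th departure along an edge, if
it is `X` just before. A blocked arrival leaves the state as it is. -/
def eventJump (C : S.Scaling) (ω : S.Driving) (X : S.Config → ℕ) :
    ι ⊕ S.Edge → ℕ → S.Config → ℕ :=
  Sum.elim
    (fun i m => if h : ∃ e : S.Edge, S.ctype e = i ∧ Selects C i (ω.mark i m) X (S.lower e)
      then moveServer (S.lower h.choose) (S.upper h.choose) X else X)
    fun e _ => moveServer (S.upper e) (S.lower e) X

theorem eventJump_inl {C : S.Scaling} {ω : S.Driving} {X : S.Config → ℕ} {e : S.Edge} {m : ℕ}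
    (h : Selects C (S.ctype e) (ω.mark (S.ctype e) m) X (S.lower e)) :
    eventJump C ω X (Sum.inl (S.ctype e)) m = moveServer (S.lower e) (S.upper e) X := by
  have hex : ∃ f : S.Edge, S.ctype f = S.ctype e ∧
      Selects C (S.ctype e) (ω.mark (S.ctype e) m) X (S.lower f) := ⟨e, rfl, h⟩
  have heq : hex.choose = e :=
    edge_ext hex.choose_spec.1 (hex.choose_spec.2.unique h)
  simp only [eventJump, Sum.elim_inl]
  rw [dif_pos hex, heq]

theorem eventJump_inl_of_forall_not {C : S.Scaling} {ω : S.Driving} {X : S.Config → ℕ} {i : ι}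
    {m : ℕ} (h : ∀ e : S.Edge, S.ctype e = i → ¬ Selects C i (ω.mark i m) X (S.lower e)) :
    eventJump C ω X (Sum.inl i) m = X := by
  simp only [eventJump, Sum.elim_inl]
  rw [dif_neg]
  push Not
  exact h

/-- Instance search does not find this through the sum type `ι ⊕ S.Edge` by itself. -/
instance instDecidableEqEdge : DecidableEq S.Edge := inferInstance

/-- The net flow of a unit flow along the edge `e`. -/
theorem net_single (e : S.Edge) (c : S.Config) :
    ∑ f : S.Edge with S.upper f = c, (if f = e then (1 : ℤ) else 0)
      - ∑ f : S.Edge with S.lower f = c, (if f = e then (1 : ℤ) else 0)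
      = (if S.upper e = c then 1 else 0) - if S.lower e = c then 1 else 0 := by
  simp [Finset.sum_ite_eq', Finset.mem_filter]

/-- The pool sizes do not change when a server moves along an edge. -/
theorem sum_pool_moveServer {k l : S.Config} (hkl : k.1 = l.1) {X : S.Config → ℕ} (hX : 0 < X k)
    (s : σ) : ∑ c : S.Config with c.1 = s, moveServer k l X c
      = ∑ c : S.Config with c.1 = s, X c := by
  zify
  simp only [moveServer_cast hX, Finset.sum_add_distrib, Finset.sum_sub_distrib,
    Finset.sum_ite_eq, Finset.mem_filter, Finset.mem_univ, true_and, hkl]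
  ring

section

variable {C : S.Scaling} {ω : S.Driving} {n : ℕ} {t : ℕ → ℝ} {q : ℕ → S.Config → ℕ}
  {p : ℕ → ι ⊕ S.Edge} {N : ℕ → ι ⊕ S.Edge → ℕ} {J : ℕ → ι ⊕ S.Edge → ℝ}

theorem eventJump_cases {X : S.Config → ℕ} {a : ι ⊕ S.Edge} (ha : 0 < eventRate C n X a) (m : ℕ) :
    (∃ e : S.Edge, a = Sum.inl (S.ctype e) ∧
        Selects C (S.ctype e) (ω.mark (S.ctype e) m) X (S.lower e) ∧
        eventJump C ω X a m = moveServer (S.lower e) (S.upper e) X) ∨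
      (∃ i, a = Sum.inl i ∧
        (∀ e : S.Edge, S.ctype e = i → ¬ Selects C i (ω.mark i m) X (S.lower e)) ∧
        eventJump C ω X a m = X) ∨
      ∃ e : S.Edge, a = Sum.inr e ∧ 0 < X (S.upper e) ∧
        eventJump C ω X a m = moveServer (S.upper e) (S.lower e) X := by
  rcases a with i | e
  · by_cases h : ∀ e : S.Edge, S.ctype e = i → ¬ Selects C i (ω.mark i m) X (S.lower e)
    · exact Or.inr (Or.inl ⟨i, rfl, h, eventJump_inl_of_forall_not h⟩)
    · push Not at h
      obtain ⟨e, rfl, he⟩ := h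
      exact Or.inl ⟨e, rfl, he, eventJump_inl he⟩
  · refine Or.inr (Or.inr ⟨e, rfl, Nat.pos_of_ne_zero fun h0 => ?_, rfl⟩)
    simp [eventRate, h0] at ha

theorem IsJumpProcess.sum_pool
    (H : IsJumpProcess ω.epochs (eventRate C n) (eventJump C ω) t q p N J) (s : σ) (j : ℕ) :
    ∑ c : S.Config with c.1 = s, q j c = ∑ c : S.Config with c.1 = s, q 0 c := by
  induction j with
  | zero => rfl
  | succ j ih =>
    rw [← ih, H.state_succ]
    rcases eventJump_cases (ω := ω) (H.rate_pos j) (N j (p j)) with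
      ⟨e, -, h, heq⟩ | ⟨i, -, -, heq⟩ | ⟨e, -, h, heq⟩
    · rw [heq, sum_pool_moveServer (upper_fst e).symm h.pos]
    · rw [heq]
    · rw [heq, sum_pool_moveServer (upper_fst e) h]

open Classical in
/-- The number of the first `m` customers of the type of `e` which are placed along `e`. -/
def placedCount (C : S.Scaling) (ω : S.Driving) (n : ℕ) (X : ℝ → S.Config → ℕ) (e : S.Edge)
    (m : ℕ) : ℕ := ((Finset.range m).filter (Placed C ω n X e)).card

open Classical in
theorem placedCount_succ (X : ℝ → S.Config → ℕ) (e : S.Edge) (m : ℕ) :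
    placedCount C ω n X e (m + 1)
      = placedCount C ω n X e m + if Placed C ω n X e m then 1 else 0 := by
  rw [placedCount, placedCount, Finset.card_filter, Finset.card_filter, Finset.sum_range_succ]

theorem IsJumpProcess.clock_inl
    (H : IsJumpProcess ω.epochs (eventRate C n) (eventJump C ω) t q p N J)
    (i : ι) (j : ℕ) : J j (Sum.inl i) = S.lam i * C.r n * t j := by
  induction j with
  | zero => rw [H.clock_zero, H.time_zero, mul_zero]
  | succ j ih =>
    rw [H.clock_succ, ih]
    simp only [eventRate, Sum.elim_inl]
    ring

theorem IsJumpProcess.arrTime_eq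
    (H : IsJumpProcess ω.epochs (eventRate C n) (eventJump C ω) t q p N J)
    {i : ι} {j : ℕ} (hj : p j = Sum.inl i) :
    arrTime C ω n i (N j (Sum.inl i)) = t (j + 1) := by
  have h1 := H.clock_jump j
  rw [hj, H.clock_inl] at h1
  have h2 := S.lam_pos i
  have h3 := C.r_pos n
  rw [arrTime, div_eq_iff (by positivity)]
  change ω.epochs (Sum.inl i) _ = _
  rw [← h1]
  ring

theorem IsJumpProcess.count_inl
    (H : IsJumpProcess ω.epochs (eventRate C n) (eventJump C ω) t q p N J)
    {i : ι} {j : ℕ} {u : ℝ} (hu : u ∈ Ico (t j) (t (j + 1))) :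
    N j (Sum.inl i) = arrCount C ω n i u := by
  rw [H.count_eq_counting ω.isEpochs _ hu, H.clock_inl, arrCount]
  simp only [eventRate, Driving.epochs, Sum.elim_inl]
  congr 1
  ring

theorem IsJumpProcess.eventually_nhdsLT
    (H : IsJumpProcess ω.epochs (eventRate C n) (eventJump C ω) t q p N J)
    {j : ℕ} {u : ℝ} (hu : u ∈ Ioc (t j) (t (j + 1))) :
    ∀ᶠ v in 𝓝[<] u, stepIndex t v = j := by
  filter_upwards [Ioo_mem_nhdsLT hu.1] with v hv
  exact stepIndex_eq H.strictMono_time ⟨hv.1.le, hv.2.trans_le hu.2⟩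

theorem IsJumpProcess.placed_iff
    (H : IsJumpProcess ω.epochs (eventRate C n) (eventJump C ω) t q p N J)
    {e : S.Edge} {j : ℕ} (hj : p j = Sum.inl (S.ctype e)) :
    Placed C ω n (fun u => q (stepIndex t u)) e (N j (Sum.inl (S.ctype e)))
      ↔ Selects C (S.ctype e) (ω.mark (S.ctype e) (N j (Sum.inl (S.ctype e)))) (q j)
        (S.lower e) := by
  rw [Placed, H.arrTime_eq hj]
  have hev := H.eventually_nhdsLT (j := j) ⟨H.time_lt j, le_rfl⟩
  constructor
  · intro h
    obtain ⟨u, h1, h2⟩ := (h.and hev).exists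
    rwa [h2] at h1
  · intro h
    filter_upwards [hev] with u hu
    rwa [hu]

/-- The state changes by the net flow of the counts along the edges. -/
theorem IsJumpProcess.balance
    (H : IsJumpProcess ω.epochs (eventRate C n) (eventJump C ω) t q p N J)
    (j : ℕ) (k : S.Config) :
    (q j k : ℤ) = q 0 k
      + ∑ e : S.Edge with S.upper e = k,
        ((placedCount C ω n (fun u => q (stepIndex t u)) e (N j (Sum.inl (S.ctype e))) : ℤ)
          - N j (Sum.inr e))
      - ∑ e : S.Edge with S.lower e = k,
        ((placedCount C ω n (fun u => q (stepIndex t u)) e (N j (Sum.inl (S.ctype e))) : ℤ)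
          - N j (Sum.inr e)) := by
  classical
  set X : ℝ → S.Config → ℕ := fun u => q (stepIndex t u) with hX
  induction j with
  | zero => simp [H.count_zero, placedCount]
  | succ j ih =>
    -- the change of the counts along the edges in the `j`-th jump
    obtain ⟨w, hw, hq⟩ : ∃ w : S.Edge → ℤ,
        (∀ e, ((placedCount C ω n X e (N (j + 1) (Sum.inl (S.ctype e))) : ℤ)
          - N (j + 1) (Sum.inr e)) = (placedCount C ω n X e (N j (Sum.inl (S.ctype e))) : ℤ)
          - N j (Sum.inr e) + w e) ∧
        (q (j + 1) k : ℤ) = q j k + (∑ e : S.Edge with S.upper e = k, w e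
          - ∑ e : S.Edge with S.lower e = k, w e) := by
      have hstate := H.state_succ j
      rcases eventJump_cases (ω := ω) (H.rate_pos j) (N j (p j)) with
        ⟨e, hp, h, heq⟩ | ⟨i, hp, h, heq⟩ | ⟨e, hp, h, heq⟩
      · refine ⟨fun f => if f = e then 1 else 0, fun f => ?_, ?_⟩
        · rw [H.count_succ, Function.update_of_ne (a := Sum.inr f) (by rw [hp]; simp)]
          by_cases hf : S.ctype f = S.ctype e
          · have hpf : p j = Sum.inl (S.ctype f) := by rw [hp, hf]
            have hiff : Placed C ω n X f (N j (Sum.inl (S.ctype f))) ↔ f = e := by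
              rw [hX, H.placed_iff hpf]
              rw [hpf, ← hf] at h
              constructor
              · exact fun h' => edge_ext hf (h'.unique h)
              · rintro rfl; exact h
            rw [hpf, Function.update_self, placedCount_succ]
            simp only [hiff]
            push_cast
            ring
          · have hfe : f ≠ e := fun h' => hf (by rw [h'])
            rw [Function.update_of_ne (by rw [hp]; simpa using hf)]
            simp [hfe]
        · rw [net_single, hstate, heq, moveServer_cast h.pos]
          ring
      · refine ⟨fun _ => 0, fun f => ?_, by rw [hstate, heq]; simp⟩
        rw [H.count_succ, Function.update_of_ne (a := Sum.inr f) (by rw [hp]; simp)]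
        by_cases hf : S.ctype f = i
        · have hpf : p j = Sum.inl (S.ctype f) := by rw [hp, hf]
          have hnot : ¬ Placed C ω n X f (N j (Sum.inl (S.ctype f))) := by
            rw [hX, H.placed_iff hpf]
            rw [hpf, ← hf] at h
            exact h f rfl
          rw [hpf, Function.update_self, placedCount_succ, if_neg hnot]
          simp
        · rw [Function.update_of_ne (by rw [hp]; simpa using hf)]
          ring
      · refine ⟨fun f => -if f = e then 1 else 0, fun f => ?_, ?_⟩
        · rw [H.count_succ, Function.update_of_ne (a := Sum.inl (S.ctype f)) (by rw [hp]; simp)]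
          by_cases hf : f = e
          · rw [hf, hp, Function.update_self]
            simp only [if_true]
            push_cast
            ring
          · rw [Function.update_of_ne (by rw [hp]; simpa using hf)]
            simp [hf]
        · rw [Finset.sum_neg_distrib, Finset.sum_neg_distrib, hstate, heq, moveServer_cast h]
          have := net_single e k
          linarith
    simp only [hw, Finset.sum_add_distrib]
    rw [hq, ih]
    ring

end

/-- Generic primitives drive a trajectory from every initial state of the right pool sizes. -/
theorem exists_isTrajectory_of_nonempty [Nonempty ι] {C : S.Scaling} {ω : S.Driving}
    (hω : ω.IsGeneric C) (n : ℕ) (X₀ : S.Config → ℕ)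
    (hX₀ : ∀ s, ∑ k : S.Config with k.1 = s, X₀ k = C.H n s) :
    ∃ X A D, IsTrajectory C ω n X A D ∧ X 0 = X₀ := by
  obtain ⟨K, hlam, hmu, hr, hli⟩ := hω
  have hK : ∀ X a, eventRate C n X a ∈ K := by
    rintro X (i | e)
    · exact K.mul_mem (hlam i) (hr n)
    · exact K.mul_mem (K.mul_mem (natCast_mem K _) (natCast_mem K _)) (hmu _)
  have hr0 : ∀ X a, 0 ≤ eventRate C n X a := by
    rintro X (i | e)
    · exact (mul_pos (S.lam_pos i) (C.r_pos n)).le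
    · exact mul_nonneg (by positivity) (S.mu_pos _).le
  have hrpos : ∀ X, ∃ a, 0 < eventRate C n X a := fun X =>
    ⟨Sum.inl (Classical.arbitrary ι), mul_pos (S.lam_pos _) (C.r_pos n)⟩
  obtain ⟨t, q, p, N, J, H, hq0⟩ :=
    exists_isJumpProcess ω.isEpochs hli hK hr0 hrpos (eventJump C ω) X₀
  have hlim : Tendsto t atTop atTop := by
    have hle : ∀ j k, q j k ≤ C.H n k.1 := by
      intro j k
      rw [← hX₀, ← hq0, ← H.sum_pool k.1 j]
      exact Finset.single_le_sum (f := fun k => q j k) (fun _ _ => Nat.zero_le _) (by simp)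
    have hbound : ∀ a, ∃ M, ∀ j, eventRate C n (q j) a ≤ M := by
      rintro (i | e)
      · exact ⟨_, fun j => le_rfl⟩
      · refine ⟨(C.H n (S.upper e).1 : ℝ) * ((S.upper e).2.1 (S.ctype e) : ℝ)
          * S.mu (S.ctype e), fun j => ?_⟩
        have h1 : (q j (S.upper e) : ℝ) ≤ C.H n (S.upper e).1 := by exact_mod_cast hle j _
        have h2 := (S.mu_pos (S.ctype e)).le
        simp only [eventRate, Sum.elim_inr]
        gcongr
    choose M hM using hbound
    refine H.tendsto_time ω.isEpochs (M := ∑ a, |M a|) fun j a => ?_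
    exact (hM a j).trans ((le_abs_self _).trans (Finset.single_le_sum (f := fun a => |M a|)
      (fun _ _ => abs_nonneg _) (Finset.mem_univ a)))
  have hmono := H.strictMono_time
  set X : ℝ → S.Config → ℕ := fun u => q (stepIndex t u) with hX
  have hidx0 : stepIndex t 0 = 0 :=
    stepIndex_eq hmono ⟨H.time_zero.le, by rw [← H.time_zero]; exact H.time_lt 0⟩
  have hevent : ∀ u, 0 < u → ∀ a, EventAt C ω n (fun u e => N (stepIndex t u) (Sum.inr e)) u a →
      ∃ j, u = t (j + 1) ∧ a = p j := by
    rintro u hu (i | e) ha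
    · obtain ⟨m, hm⟩ := ha
      obtain ⟨j, hj⟩ := exists_mem_Ico H.time_zero hlim hu.le
      have h1 : m < N j (Sum.inl i) := by
        rw [H.count_inl hj, lt_arrCount_iff, hm]
      obtain ⟨l, hl1, hl2⟩ := H.exists_jump_of_lt_count h1
      refine ⟨l, ?_, hl1.symm⟩
      rw [← hm, ← hl2, H.arrTime_eq hl1]
    · obtain ⟨j, hj⟩ := exists_mem_Ioc H.time_zero hlim hu
      have hleft := H.eventually_nhdsLT hj
      rcases hj.2.eq_or_lt with heq | hlt
      · refine ⟨j, heq, ?_⟩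
        by_contra hne
        refine ha (hleft.mono fun v hv => ?_)
        have h1 : stepIndex t u = j + 1 :=
          stepIndex_eq hmono ⟨heq.ge, by rw [heq]; exact H.time_lt _⟩
        simp only [hv, h1]
        rw [H.count_succ, Function.update_of_ne hne]
      · exfalso
        refine ha (hleft.mono fun v hv => ?_)
        simp only [hv, stepIndex_eq hmono ⟨hj.1.le, hlt⟩]
  refine ⟨X, fun u e => {m : ℕ | arrTime C ω n (S.ctype e) m ≤ u ∧ Placed C ω n X e m}.ncard,
    fun u e => N (stepIndex t u) (Sum.inr e), ⟨?_, ?_, ?_, ?_, ?_, ?_, ?_⟩, ?_⟩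
  · intro u hu
    obtain ⟨j, hj⟩ := exists_mem_Ico H.time_zero hlim hu
    filter_upwards [Ioo_mem_nhdsGT hj.2] with v hv
    simp only [hX]
    rw [stepIndex_eq hmono hj, stepIndex_eq hmono ⟨hj.1.trans hv.1.le, hv.2⟩]
  · intro u hu
    obtain ⟨j, hj⟩ := exists_mem_Ioc H.time_zero hlim hu
    refine ⟨q j, (H.eventually_nhdsLT hj).mono fun v hv => ?_⟩
    simp only [hX, hv]
  · intro s
    simp only [hX, hidx0, hq0, hX₀]
  · intro u hu e
    obtain ⟨j, hj⟩ := exists_mem_Ico H.time_zero hlim hu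
    have h1 := H.integral_rate (Sum.inr e) ⟨hj.1, hj.2.le⟩
    rw [stepIndex_eq hmono hj, H.count_eq_counting ω.isEpochs _ hj, ← h1]
    rfl
  · intro u hu e
    rfl
  · intro u hu k
    obtain ⟨j, hj⟩ := exists_mem_Ico H.time_zero hlim hu
    have hA : ∀ e, {m : ℕ | arrTime C ω n (S.ctype e) m ≤ u ∧ Placed C ω n X e m}.ncard
        = placedCount C ω n X e (N j (Sum.inl (S.ctype e))) := by
      intro e
      rw [ncard_placed, H.count_inl hj]
      rfl
    simp only [hA]
    simp only [hX, hidx0, stepIndex_eq hmono hj]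
    exact H.balance j k
  · intro u hu a b ha hb
    obtain ⟨j, hj, rfl⟩ := hevent u hu a ha
    obtain ⟨l, hl, rfl⟩ := hevent u hu b hb
    have := hmono.injective (hj.symm.trans hl)
    obtain rfl : j = l := by omega
    rfl
  · simp only [hX, hidx0, hq0]

theorem exists_isTrajectory {C : S.Scaling} {ω : S.Driving}
    (hω : ω.IsGeneric C) (n : ℕ) (X₀ : S.Config → ℕ)
    (hX₀ : ∀ s, ∑ k : S.Config with k.1 = s, X₀ k = C.H n s) :
    ∃ X A D, IsTrajectory C ω n X A D ∧ X 0 = X₀ := by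
  rcases isEmpty_or_nonempty ι with hι | hι
  · -- without customer types nothing ever happens
    have hE : IsEmpty S.Edge := ⟨fun e => hι.elim e.1.2⟩
    refine ⟨fun _ => X₀, fun _ e => hE.elim e, fun _ e => hE.elim e, ⟨?_, ?_, hX₀, ?_, ?_, ?_, ?_⟩,
      rfl⟩
    · exact fun t _ => Eventually.of_forall fun _ => rfl
    · exact fun t _ => ⟨X₀, Eventually.of_forall fun _ => rfl⟩
    · exact fun t _ e => hE.elim e
    · exact fun t _ e => hE.elim e
    · intro t _ k
      simp
    · rintro t _ (i | e)
      · exact hι.elim i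
      · exact hE.elim e
  · exact exists_isTrajectory_of_nonempty hω n X₀ hX₀

section FluidSamplePath

variable {C : S.Scaling} {ω : S.Driving} {ℓ : Filter ℕ} {φ : ℕ → ℕ}
  {X : ℕ → ℝ → S.Config → ℕ} {A D : ℕ → ℝ → S.Edge → ℕ} {z : ℝ → S.Config → ℝ}
  {a d : ℝ → S.Edge → ℝ}

/-! ### Fluid sample paths -/

theorem IsPrelimit.isFluidLimit [NeBot ℓ] (H : IsPrelimit C ω ℓ φ X A D)
    (hz : ∀ k t, 0 ≤ t → Tendsto (fun n => scaled (C.r (φ n)) (X n t) k) ℓ (𝓝 (z t k)))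
    (ha : ∀ e t, 0 ≤ t → Tendsto (fun n => (A n t e : ℝ) / C.r (φ n)) ℓ (𝓝 (a t e)))
    (hd : ∀ e t, 0 ≤ t → Tendsto (fun n => (D n t e : ℝ) / C.r (φ n)) ℓ (𝓝 (d t e))) :
    IsFluidLimit C ω ℓ φ X A D z a d where
  toIsPrelimit := H
  cont k := by
    obtain ⟨L, hL, hlip⟩ := (H.asympLipschitz_state k).exists_lipschitz (hz k)
    have : LipschitzOnWith L.toNNReal (fun t => z t k) (Ici 0) :=
      LipschitzOnWith.of_dist_le_mul fun x hx y hy => by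
        rw [Real.dist_eq, Real.dist_eq, Real.coe_toNNReal _ hL]
        exact hlip y hy x hx
    exact this.continuousOn
  state b k := (H.asympLipschitz_state k).tendstoUniformlyOn (hz k) b
  arr := ha
  dep := hd

/-- The convergence in the definition of a fluid sample path covers the nonzero configurations; for
the zero configurations it follows from that of the pool sizes. -/
theorem IsFSP.exists_isFluidLimit {F : S.FluidPath} (hF : IsFSP C F) :
    ∃ ω φ X A D, IsFluidLimit C ω atTop φ X A D (fun t => S.bar (F.x t)) F.a F.d := by
  obtain ⟨-, -, -, ω, hω, φ, hφ, X, A, D, htraj, hconv⟩ := hF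
  have H : IsPrelimit C ω atTop φ X A D := ⟨hω, hφ.tendsto_atTop, htraj⟩
  have hnz : ∀ t, 0 ≤ t → ∀ k : S.NzConfig,
      Tendsto (fun n => scaled (C.r (φ n)) (X n t) k.1) atTop (𝓝 (F.x t k)) := by
    intro t ht k
    have h1 := (hconv t).1.tendsto_at ⟨ht, le_rfl⟩
    have h2 : Continuous fun x : S.State => x k := by fun_prop
    exact (h2.tendsto _).comp h1
  refine ⟨ω, φ, X, A, D, H.isFluidLimit (fun k t ht => ?_) (fun e t ht => ?_) (fun e t ht => ?_)⟩
  · by_cases hk : k.2.1 = 0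
    · have hk' : k = S.zeroConfig k.1 := config_ext rfl hk
      rw [hk', bar_zero]
      refine (((C.H_tendsto _).comp hφ.tendsto_atTop).sub
        (tendsto_finsetSum _ fun l _ => hnz t ht l)).congr fun n => ?_
      have h1 := (htraj n).sum_pool ht k.1
      rw [sum_pool_config] at h1
      simp only [scaled, Function.comp_apply]
      rw [← h1, ← Finset.sum_div, ← sub_div, add_sub_cancel_right]
    · rw [bar_nz _ ⟨k, hk⟩]
      exact hnz t ht ⟨k, hk⟩
  · exact (tendsto_pi_nhds.1 ((hconv t).2.2.tendsto_at ⟨ht, le_rfl⟩)) e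
  · exact (tendsto_pi_nhds.1 ((hconv t).2.1.tendsto_at ⟨ht, le_rfl⟩)) e

theorem IsFSP.isFluidSolution {F : S.FluidPath} (hF : IsFSP C F) : IsFluidSolution F.x := by
  obtain ⟨ω, φ, X, A, D, H⟩ := hF.exists_isFluidLimit
  have := H.isFluidSolution
  simpa only [toState_bar] using this

/-- Invariant fluid sample paths with idle servers stay at the minimizer, with arrivals and
departures at constant rates. -/
theorem IsIdleInvariantFSP.eq {xs : S.State} (hx : S.IsOptimal xs) (hS : S.Subcritical)
    {F : S.FluidPath} (hF : IsIdleInvariantFSP C F) {t : ℝ} (ht : 0 ≤ t) :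
    F.x t = xs ∧ F.d t = (fun e => downRate (S.bar xs) e * t) ∧
      F.a t = fun e => upRate (S.bar xs) e * t := by
  obtain ⟨hF, hinv, hidle⟩ := hF
  obtain ⟨ω, φ, X, A, D, H⟩ := hF.exists_isFluidLimit
  have hconst : ∀ t, 0 ≤ t → S.bar (F.x t) = S.bar (F.x 0) := fun t ht => by rw [hinv t ht]
  have h0 : ∀ k, 0 ≤ S.bar (F.x 0) k := H.nonneg le_rfl
  have hav := fluidAvail_pos_of_idle h0 hidle
  have hx0 : F.x 0 = xs := by
    refine hx.eq_of_net_flow_eq_zero hS h0 hidle fun k => ?_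
    have h1 := H.hasDeriv_state le_rfl hav k
    have h2 : HasDerivWithinAt (fun t => S.bar (F.x t) k) 0 (Ici 0) 0 :=
      (hasDerivWithinAt_const (0 : ℝ) (Ici 0) (S.bar (F.x 0) k)).congr
        (fun t ht => by rw [hinv t ht]) rfl
    exact (uniqueDiffOn_Ici (0 : ℝ) 0 self_mem_Ici).eq_deriv _ h1 h2
  refine ⟨(hinv t ht).trans hx0, funext fun e => ?_, funext fun e => ?_⟩
  · rw [H.dep_eq_of_const hconst e ht, hx0]
  · rw [H.arr_eq_of_const hconst (hav _) ht, hx0]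

/-! ### Existence of the invariant fluid sample path -/

/-- Fluid states with all configurations occupied are approximated by states of the finite
systems. -/
theorem exists_initial_states (C : S.Scaling) {x : S.State} (hx : ∀ k, 0 < S.bar x k) :
    ∃ X₀ : ℕ → S.Config → ℕ, (∀ n s, ∑ k : S.Config with k.1 = s, X₀ n k = C.H n s) ∧
      ∀ k, Tendsto (fun n => scaled (C.r n) (X₀ n) k) atTop (𝓝 (S.bar x k)) := by
  classical
  -- round the scaled state down, except for the finitely many systems in which the result would
  -- exceed a pool, and let the remaining servers be idle
  let m₀ : ℕ → S.NzConfig → ℕ := fun n k => ⌊x k * C.r n⌋₊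
  let good : ℕ → Prop := fun n => ∀ s, ∑ k : S.NzConfig with k.1.1 = s, m₀ n k ≤ C.H n s
  let m : ℕ → S.NzConfig → ℕ := fun n k => if good n then m₀ n k else 0
  have hm₀ : ∀ k, Tendsto (fun n => (m₀ n k : ℝ) / C.r n) atTop (𝓝 (x k)) := fun k => by
    have h0 : 0 ≤ x k := by rw [← bar_nz]; exact (hx _).le
    exact (tendsto_nat_floor_mul_div_atTop h0).comp C.r_tendsto
  have hgood : ∀ᶠ n in atTop, good n := by
    refine eventually_all.2 fun s => ?_
    have h1 := tendsto_finsetSum (Finset.univ.filter fun k : S.NzConfig => k.1.1 = s)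
      fun k _ => hm₀ k
    have h2 : ∑ k : S.NzConfig with k.1.1 = s, x k < S.h s := by
      have := hx (S.zeroConfig s)
      rw [bar_zero] at this
      linarith
    filter_upwards [h1.eventually_lt (C.H_tendsto s) h2] with n hn
    rw [← Finset.sum_div, div_lt_div_iff_of_pos_right (C.r_pos n)] at hn
    exact_mod_cast hn.le
  have hm : ∀ k, Tendsto (fun n => (m n k : ℝ) / C.r n) atTop (𝓝 (x k)) := fun k =>
    (hm₀ k).congr' (hgood.mono fun n hn => by simp only [m, if_pos hn])
  have hle : ∀ n s, ∑ k : S.NzConfig with k.1.1 = s, m n k ≤ C.H n s := by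
    intro n s
    by_cases hn : good n
    · simp only [m, if_pos hn]; exact hn s
    · simp only [m, if_neg hn, Finset.sum_const_zero]; exact Nat.zero_le _
  let X₀ : ℕ → S.Config → ℕ := fun n k => if hk : k.2.1 = 0
    then C.H n k.1 - ∑ l : S.NzConfig with l.1.1 = k.1, m n l else m n ⟨k, hk⟩
  have hX0 : ∀ n s, X₀ n (S.zeroConfig s)
      = C.H n s - ∑ l : S.NzConfig with l.1.1 = s, m n l := fun n s => dif_pos rfl
  have hX1 : ∀ n (k : S.NzConfig), X₀ n k.1 = m n k := fun n k => dif_neg k.2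
  refine ⟨X₀, fun n s => ?_, fun k => ?_⟩
  · have h1 := sum_pool_config (S := S) s (fun k => (X₀ n k : ℝ))
    simp only [hX0, hX1] at h1
    have h2 : ∑ k : S.Config with k.1 = s, X₀ n k
        = (C.H n s - ∑ l : S.NzConfig with l.1.1 = s, m n l)
          + ∑ l : S.NzConfig with l.1.1 = s, m n l := by
      exact_mod_cast h1
    rw [h2, Nat.sub_add_cancel (hle n s)]
  · by_cases hk : k.2.1 = 0
    · have hk' : k = S.zeroConfig k.1 := config_ext rfl hk
      rw [hk', bar_zero]
      refine ((C.H_tendsto k.1).sub (tendsto_finsetSum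
        (Finset.univ.filter fun l : S.NzConfig => l.1.1 = k.1) fun l _ => hm l)).congr fun n => ?_
      simp only [scaled, hX0]
      rw [Nat.cast_sub (hle n _), Nat.cast_sum, sub_div, Finset.sum_div]
    · rw [bar_nz _ ⟨k, hk⟩]
      refine (hm ⟨k, hk⟩).congr fun n => ?_
      simp only [scaled]
      rw [hX1 n ⟨k, hk⟩]

/-- Along ultrafilters, asymptotically Lipschitz functions converge pointwise if they converge at
time zero, because they are bounded at each time. -/
theorem AsympLipschitz.exists_tendsto {U : Ultrafilter ℕ} {f : ℕ → ℝ → ℝ}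
    (hf : AsympLipschitz (U : Filter ℕ) f) {c : ℝ} (h0 : Tendsto (fun n => f n 0) U (𝓝 c)) :
    ∃ F : ℝ → ℝ, ∀ t, 0 ≤ t → Tendsto (fun n => f n t) U (𝓝 (F t)) := by
  have key : ∀ t, ∃ y, 0 ≤ t → Tendsto (fun n => f n t) U (𝓝 y) := by
    intro t
    by_cases ht : 0 ≤ t
    · obtain ⟨L, hL, hf⟩ := hf
      have hev : ∀ᶠ n in (U : Filter ℕ),
          f n t ∈ Icc (c - 1 - (L * t + 1)) (c + 1 + (L * t + 1)) := by
        filter_upwards [hf t 1 one_pos, h0.eventually_lt_const (lt_add_one c),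
          h0.eventually_const_lt (sub_one_lt c)] with n h1 h2 h3
        have h4 := abs_le.1 (h1 0 ⟨le_rfl, ht⟩ t ⟨ht, le_rfl⟩)
        rw [sub_zero, abs_of_nonneg ht] at h4
        exact ⟨by linarith [h4.1], by linarith [h4.2]⟩
      obtain ⟨y, -, hy⟩ := isCompact_Icc.ultrafilter_le_nhds (U.map fun n => f n t)
        (le_principal_iff.2 hev)
      exact ⟨y, fun _ => hy⟩
    · exact ⟨0, fun h => absurd h ht⟩
  choose F hF using key
  exact ⟨F, hF⟩

/-- Trajectories which start near the minimizer stay near it on the fluid scale: the limit along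
any ultrafilter is a fluid solution which starts at the minimizer. -/
theorem IsPrelimit.tendsto_of_ultrafilter {U : Ultrafilter ℕ}
    (H : IsPrelimit C ω (U : Filter ℕ) φ X A D) {xs : S.State} (hx : S.IsOptimal xs)
    (hS : S.Subcritical)
    (h0 : ∀ k, Tendsto (fun n => scaled (C.r (φ n)) (X n 0) k) U (𝓝 (S.bar xs k))) {t : ℝ}
    (ht : 0 ≤ t) :
    (∀ k, Tendsto (fun n => scaled (C.r (φ n)) (X n t) k) U (𝓝 (S.bar xs k))) ∧
    (∀ e, Tendsto (fun n => (A n t e : ℝ) / C.r (φ n)) U (𝓝 (upRate (S.bar xs) e * t))) ∧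
    ∀ e, Tendsto (fun n => (D n t e : ℝ) / C.r (φ n)) U (𝓝 (downRate (S.bar xs) e * t)) := by
  choose z hz using fun k => (H.asympLipschitz_state k).exists_tendsto (h0 k)
  choose a ha using fun e => (H.asympLipschitz_arr e).exists_tendsto (c := 0)
    (by simp [(H.traj _).arr_zero])
  choose d hd using fun e => (H.asympLipschitz_dep e).exists_tendsto (c := 0)
    (by simp [(H.traj _).dep_zero])
  have L : IsFluidLimit C ω U φ X A D (fun t k => z k t) (fun t e => a e t) (fun t e => d e t) :=
    H.isFluidLimit hz ha hd
  have hz0 : (fun k => z k 0) = S.bar xs :=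
    funext fun k => tendsto_nhds_unique (hz k 0 le_rfl) (h0 k)
  have hzt : ∀ t, 0 ≤ t → (fun k => z k t) = S.bar xs := by
    intro t ht
    have h1 := L.isFluidSolution.eq_of_isOptimal hx hS (by simp only [hz0, toState_bar]) t ht
    rw [← h1, bar_toState (L.sum_pool ht)]
  have hconst : ∀ t, 0 ≤ t → (fun k => z k t) = fun k => z k 0 := fun t ht => by
    rw [hzt t ht, hz0]
  have hav : ∀ i, 0 < fluidAvail i (fun k => z k 0) := fun i => by
    rw [hz0]; exact fluidAvail_pos (hx.bar_pos hS) i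
  refine ⟨fun k => ?_, fun e => ?_, fun e => ?_⟩
  · have := hz k t ht
    rwa [congrFun (hzt t ht) k] at this
  · have := ha e t ht
    rwa [L.arr_eq_of_const hconst (hav _) ht, hz0] at this
  · have := hd e t ht
    rwa [L.dep_eq_of_const hconst e ht, hz0] at this

/-- The path which stays at the state `xs`, with arrivals and departures at constant rates. -/
def constPath (xs : S.State) : S.FluidPath where
  x _ := xs
  d t e := downRate (S.bar xs) e * t
  a t e := upRate (S.bar xs) e * t

theorem locallyLipschitzOn_linear (c : S.Edge → ℝ) :
    LocallyLipschitzOn (Ici 0) fun (t : ℝ) e => c e * t := by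
  have : ContDiff ℝ 1 fun (t : ℝ) e => c e * t := contDiff_pi.2 fun e => by fun_prop
  exact this.locallyLipschitz.locallyLipschitzOn

/-- The constant path is the limit of the systems which start close to the minimizer. -/
theorem isIdleInvariantFSP_constPath {xs : S.State} (hx : S.IsOptimal xs) (hS : S.Subcritical)
    (C : S.Scaling) : IsIdleInvariantFSP C (constPath xs) := by
  have hpos := hx.bar_pos hS
  refine ⟨⟨?_, locallyLipschitzOn_linear _, locallyLipschitzOn_linear _, ?_⟩, fun t _ => rfl,
    fun s => hpos _⟩
  · exact (LipschitzWith.const xs).locallyLipschitz.locallyLipschitzOn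
  obtain ⟨ω, hω, hgen⟩ := exists_driving C
  obtain ⟨X₀, hX₀, hX₀lim⟩ := exists_initial_states C hpos
  choose X A D htraj hX using fun n => exists_isTrajectory hgen n (X₀ n) (hX₀ n)
  have H : IsPrelimit C ω atTop id X A D := ⟨hω, tendsto_id, htraj⟩
  have key : ∀ U : Ultrafilter ℕ, (U : Filter ℕ) ≤ atTop → ∀ t : ℝ, 0 ≤ t →
      (∀ k, Tendsto (fun n => scaled (C.r n) (X n t) k) U (𝓝 (S.bar xs k))) ∧
      (∀ e, Tendsto (fun n => (A n t e : ℝ) / C.r n) U (𝓝 (upRate (S.bar xs) e * t))) ∧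
      ∀ e, Tendsto (fun n => (D n t e : ℝ) / C.r n) U (𝓝 (downRate (S.bar xs) e * t)) :=
    fun U hU t ht =>
    IsPrelimit.tendsto_of_ultrafilter (U := U) (φ := id) ⟨hω, hU, htraj⟩ hx hS
      (fun k => by simp only [hX]; exact (hX₀lim k).mono_left hU) ht
  have hstate : ∀ k t, 0 ≤ t →
      Tendsto (fun n => scaled (C.r n) (X n t) k) atTop (𝓝 (S.bar xs k)) := fun k t ht =>
    (tendsto_iff_ultrafilter _ _ _).2 fun U hU => (key U hU t ht).1 k
  have harr : ∀ e t, 0 ≤ t → Tendsto (fun n => (A n t e : ℝ) / C.r n) atTop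
      (𝓝 (upRate (S.bar xs) e * t)) := fun e t ht =>
    (tendsto_iff_ultrafilter _ _ _).2 fun U hU => (key U hU t ht).2.1 e
  have hdep : ∀ e t, 0 ≤ t → Tendsto (fun n => (D n t e : ℝ) / C.r n) atTop
      (𝓝 (downRate (S.bar xs) e * t)) := fun e t ht =>
    (tendsto_iff_ultrafilter _ _ _).2 fun U hU => (key U hU t ht).2.2 e
  have hpi : ∀ {α : Type _} [Fintype α] {f : ℕ → ℝ → α → ℝ} {F : ℝ → α → ℝ} {s : Set ℝ},
      (∀ k, TendstoUniformlyOn (fun n t => f n t k) (fun t => F t k) atTop s) →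
      TendstoUniformlyOn f F atTop s := by
    intro α _ f F s h
    rw [Metric.tendstoUniformlyOn_iff]
    intro ε hε
    filter_upwards [eventually_all.2 fun k => Metric.tendstoUniformlyOn_iff.1 (h k) ε hε]
      with n hn t ht
    exact (dist_pi_lt_iff hε).2 fun k => hn k t ht
  refine ⟨ω, hω, id, strictMono_id, X, A, D, htraj, fun b => ⟨?_, ?_, ?_⟩⟩
  · have h1 : TendstoUniformlyOn (fun n t (k : S.NzConfig) => scaled (C.r n) (X n t) k.1)
        (fun _ k => xs k) atTop (Icc 0 b) := by
      refine hpi fun k => (H.asympLipschitz_state k.1).tendstoUniformlyOn (fun t ht => ?_) b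
      have := hstate k.1 t ht
      rwa [bar_nz] at this
    exact (PiLp.uniformContinuous_toLp 2 _).comp_tendstoUniformlyOn h1
  · exact hpi fun e => (H.asympLipschitz_dep e).tendstoUniformlyOn (hdep e) b
  · exact hpi fun e => (H.asympLipschitz_arr e).tendstoUniformlyOn (harr e) b

end FluidSamplePath

end PackingSystem
end

theorem mainTheorem3 {ι σ : Type*} [Fintype ι] [DecidableEq ι] [Fintype σ] [DecidableEq σ]
    (S : PackingSystem ι σ) (hS : S.Subcritical) (C : S.Scaling) :
    ∃ xs : S.State,
      (∀ y, S.IsOptimal y ↔ y = xs) ∧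
      -- local stability on the diamond, uniformly over fluid sample paths
      (∃ ε : ℝ, 0 < ε ∧ ∀ η : ℝ, 0 < η → ∃ T : ℝ, ∀ F : S.FluidPath, PackingSystem.IsFSP C F →
        F.x 0 ∈ S.diamond → ‖F.x 0 - xs‖ ≤ ε → ∀ t, T ≤ t → 0 ≤ t → ‖F.x t - xs‖ ≤ η) ∧
      -- the constant path at the optimum is the unique invariant path with idle servers of each type
      (∃ F : S.FluidPath, PackingSystem.IsIdleInvariantFSP C F ∧
        (∀ t, 0 ≤ t → F.x t = xs) ∧
        -- no type is blocked along it
        (∀ i t, 0 ≤ t → ∑ e : S.Edge with S.ctype e = i, F.a t e = S.lam i * t) ∧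
        ∀ G : S.FluidPath, PackingSystem.IsIdleInvariantFSP C G →
          ∀ t, 0 ≤ t → G.x t = F.x t ∧ G.d t = F.d t ∧ G.a t = F.a t) := by
  obtain ⟨xs, hx⟩ := PackingSystem.exists_isOptimal hS
  refine ⟨xs, fun y => ⟨fun hy => hx.unique hS hy, fun hy => hy ▸ hx⟩, ?_,
    PackingSystem.constPath xs, PackingSystem.isIdleInvariantFSP_constPath hx hS C,
    fun _ _ => rfl, fun i t _ => ?_, fun G hG t ht => hG.eq hx hS ht⟩
  · obtain ⟨ε, hε, h⟩ := hx.exists_stable hS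
    refine ⟨ε, hε, fun η hη => ?_⟩
    obtain ⟨T, hT⟩ := h η hη
    exact ⟨T, fun F hF => hT F.x hF.isFluidSolution⟩
  · rw [← PackingSystem.sum_upRate (PackingSystem.fluidAvail_pos (hx.bar_pos hS) i),
      Finset.sum_mul]
    rfl
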